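/- Work on $\mathbb R^2$ with $\widehat g(\xi)=\int_{\mathbb R^2}e^{-ix\cdot\xi}g(x)\,dx$, $\langle a\rangle=(1+|a|^2)^{1/2}$, $D=-i\nabla$ and $\|g\|_{H^\sigma}=\|\langle D\rangle^\sigma g\|_{L^2}$. Let $s\ge 30$, and let $\chi\in C_0^\infty(B(0,2))$ be a real-valued function with $\chi(\xi)=1$ for $|\xi|\le 1$. For $L\in 2^{\mathbb Z}$ let $P_L$ be the Littlewood--Paley projection $\widehat{P_Lg}(\xi)=\big(\chi(\xi/L)-\chi(2\xi/L)\big)\widehat g(\xi)$. There is a constant $C>0$, depending only on $s$ and $\chi$, such that the following holds. Let $T\ge 0$, $\varepsilon_1>0$ and let $u:[0,T]\to L^2(\mathbb R^2;\mathbb C)$ (for instance a local solution $u\in C([0,T];H^s(\mathbb R^2))$ of the semi-relativistic Hartree equation $-i\partial_tu+\sqrt{1-\Delta}\,u=\lambda(|x|^{-\gamma}*|u|^2)u$, $1<\gamma<2$) satisfy, with $f(t)=e^{it\sqrt{1-\Delta}}u(t)$, the a priori assumption $$\sup_{t\in[0,T]}\Big(\|u(t)\|_{H^s(\mathbb R^2)}+\|\langle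 x\rangle^2f(t)\|_{H^{10}(\mathbb R^2)}\Big)\le\varepsilon_1 .$$ Then for every $t\in[0,T]$ and every dyadic number $L\in 2^{\mathbb Z}$, $$\big\|P_L(|u(t)|^2)\big\|_{L^2(\mathbb R^2)}\le C\min\big(L^{-2}\langle t\rangle^{-3},\,L\langle L\rangle^{-s}\big)\,\varepsilon_1^2$$ and $$\big\|P_L(|u(t)|^2)\big\|_{L^\infty(\mathbb R^2)}\le C\min\big(L^{-1}\langle t\rangle^{-3},\,L^2\langle L\rangle^{-s}\big)\,\varepsilon_1^2 .$$ -/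

import Mathlib

open MeasureTheory FourierTransform
open scoped ENNReal

noncomputable section

namespace SemiRel

/-- The plane with its Euclidean norm and Lebesgue measure. -/
abbrev R2 : Type := EuclideanSpace ℝ (Fin 2)

/-- The space `L²(ℝ²; ℂ)`. -/
abbrev L2 : Type := Lp ℂ 2 (volume : Measure R2)

/-- The Japanese bracket `⟨v⟩ = (1 + |v|²)^{1/2}`. -/
def bracket {V : Type*} [Norm V] (v : V) : ℝ := Real.sqrt (1 + ‖v‖ ^ 2)

/-- The `H^s(ℝ²)` norm, `s ≥ 0`, of a function, with the value `∞` off `H^s`.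
Mathlib's Fourier transform `𝓕` is the isometry of `L²` given by the kernel `e^{-2πi x·ξ}`, so that
the operator `m(D)`, `D = -i∇`, is the multiplication of `𝓕 g` by `m(2πξ)`. Hence the value is
`‖⟨D⟩^s g‖_{L²}`. -/
def sobolevNorm (s : ℝ) (g : R2 → ℂ) : ℝ≥0∞ :=
  open Classical in
  if h : MemLp g 2 (volume : Measure R2) then
    eLpNorm (fun ξ : R2 => ((bracket ((2 * Real.pi) • ξ) ^ s : ℝ) : ℂ) * (𝓕 (h.toLp g) : L2) ξ)
      2 volume
  else ∞

theorem memLp_phase_mul (t : ℝ) (h : L2) :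
    MemLp (fun ξ : R2 =>
      Complex.exp (Complex.I * ((t * bracket ((2 * Real.pi) • ξ) : ℝ) : ℂ)) * h ξ) 2 volume := by
  refine (Lp.memLp h).of_le ?_ (Filter.Eventually.of_forall fun ξ => ?_)
  · refine AEStronglyMeasurable.mul (Continuous.aestronglyMeasurable ?_)
      (Lp.aestronglyMeasurable h)
    unfold bracket
    fun_prop
  · rw [norm_mul, mul_comm Complex.I, Complex.norm_exp_ofReal_mul_I, one_mul]

/-- The unitary operator `e^{it⟨D⟩} = e^{it√(1-Δ)}` on `L²(ℝ²)`. -/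
def propagator (t : ℝ) (g : L2) : L2 :=
  𝓕⁻ ((memLp_phase_mul t (𝓕 g)).toLp _ : L2)

/-- `‖u‖_{X_T} = sup_{t ∈ [0,T]} (‖u(t)‖_{H^s} + ‖⟨x⟩² f(t)‖_{H^{10}})`, where
`f(t) = e^{it√(1-Δ)} u(t)`. -/
def normX (s T : ℝ) (u : ℝ → L2) : ℝ≥0∞ :=
  ⨆ t ∈ Set.Icc (0 : ℝ) T,
    (sobolevNorm s (u t) +
      sobolevNorm 10 (fun x : R2 => ((bracket x ^ 2 : ℝ) : ℂ) * propagator t (u t) x))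

/-- The bump functions from which the Littlewood-Paley decomposition is built:
`χ ∈ C₀^∞(B(0,2))` with `χ = 1` on the closed unit ball. -/
structure IsBump (χ : R2 → ℝ) : Prop where
  smooth : ContDiff ℝ ((⊤ : ℕ∞) : WithTop ℕ∞) χ
  support : tsupport χ ⊆ Metric.ball 0 2
  eq_one : ∀ ξ : R2, ‖ξ‖ ≤ 1 → χ ξ = 1

/-- `χ_L(ξ) = χ(ξ/L) - χ(2ξ/L)`. -/
def dyadicCutoff (χ : R2 → ℝ) (L : ℝ) (ξ : R2) : ℝ :=
  χ ((1 / L) • ξ) - χ ((2 / L) • ξ)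

/-- `ĝ(ξ) = ∫ e^{-ix·ξ} g(x) dx`, for integrable `g`. -/
def fourierHat (g : R2 → ℂ) (ξ : R2) : ℂ :=
  ∫ x : R2, Complex.exp (-Complex.I * (inner ℝ x ξ : ℝ)) * g x

/-- The Littlewood-Paley projection `P_L g = (2π)⁻² ∫ e^{ix·ξ} χ_L(ξ) ĝ(ξ) dξ` of an integrable
function `g`; the integrand is continuous with compact support. -/
def dyadicProj (χ : R2 → ℝ) (L : ℝ) (g : R2 → ℂ) (x : R2) : ℂ :=
  (1 / (2 * Real.pi) ^ 2 : ℝ) *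
    ∫ ξ : R2, Complex.exp (Complex.I * (inner ℝ x ξ : ℝ)) *
      ((dyadicCutoff χ L ξ : ℂ) * fourierHat g ξ)

/-- The function `|v|²`, for `v ∈ L²`. -/
def absSq (v : L2) (x : R2) : ℂ := ((‖v x‖ ^ 2 : ℝ) : ℂ)

end SemiRel

end

/-!
In frequency, the density is a bilinear form of the profile `f(t) = e^{it⟨D⟩}u(t)`. With `F = 𝓕 f`,
`a = 2π(ζ + η)` and `b = 2πη`,
`𝓕(|u|²)(ζ) = ∫ e^{-it(⟨a⟩ - ⟨b⟩)} F(ζ + η) conj F(η) dη` (`fourier_absSq_eq_form`).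

The bound by `L⟨L⟩⁻ˢ` uses only `u ∈ Hˢ`: one of the two interacting frequencies is at least comparable
to the output frequency, so that `𝓕(|u|²)` is `O(⟨2πζ⟩⁻ˢ)` pointwise (`norm_fourier_absSq_le`), and the
annulus of radius `L` has measure `O(L²)`.

The bound by `L⁻²⟨t⟩⁻³` consists of two integrations by parts and one dispersive estimate. The hypothesis
on `⟨x⟩²f` gives two weak derivatives of `F` in weighted `L²` spaces (`exists_reg_fourier`). The gradient
in `η` of the phase is `-2πt` times the difference `p - q` of the group velocities at `a` and `b`. It
vanishes only for `a = b`, and the identity `⟨a⟩² - ⟨b⟩² = ⟨a⟩²⟨b⟩²(p - q)·(p + q)` makes this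
quantitative: `(⟨a⟩ + ⟨b⟩)(a - b)_j` is a sum of terms `n(a) n'(b) (p - q)_k` with symbols `n`, `n'` of
order two (`exists_velocity_decomposition`). Hence multiplication of the form by `t ζ_j` moves a
derivative to one of the factors, without singular amplitudes and with a gain of a power of
`(⟨a⟩ + ⟨b⟩)⁻¹` (`form_vel_sub`, `exists_step`). Two such steps give the factor `(t|ζ|)⁻²`.

The remaining factor `t⁻¹` is the decay in `L^∞` of `e^{-it⟨D⟩}h` for regular integrable data `h` on the
plane. Its kernel is bounded by integrating by parts twice along the gradient of the phase, regularised
at the scale `t^{-1/2}`; the integral that is left is computed by the change of variables `ξ ↦ ξ/⟨ξ⟩`,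
whose Jacobian is `⟨ξ⟩⁻⁴` (`exists_lintegral_weight_le`, `exists_kernel_bound`, `exists_dispersive`). The
weights `(⟨a⟩ + ⟨b⟩)⁻ʳ`, which do not factor in `a` and `b`, are superpositions of the products
`e^{-σ⟨a⟩} e^{-σ⟨b⟩}` (`form_succ_eq`), so that the forms are superpositions of Fourier transforms of
products, estimated in `L² × L^∞` (`exists_eLpNorm_form_le`). This needs one factor with both derivatives
left. In the terms where each factor has been differentiated once, a further integration by parts gives a
pointwise bound `O(1/(t|ζ|))` instead, and on a dyadic annulus of the plane this is as good as an `L²`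
bound `O(1/t)` (`SplitBound`, `exists_splitBound_coord_sq_mul_form`).

Plancherel's theorem and Bernstein's inequality (`exists_eLpNorm_dyadicProj_le`) pass from the multiplier
to the two norms of the projection. For `t ≤ 1` the bound by `L⁻²⟨t⟩⁻³` follows from the one by
`L⟨L⟩⁻ˢ`.
-/

namespace SemiRel

open scoped SchwartzMap ContDiff LineDeriv ComplexConjugate
open Filter Topology

/-! ### Weak derivatives -/

/-- The `k`-th standard basis vector of the plane. -/
noncomputable def e (k : Fin 2) : R2 := EuclideanSpace.single k 1

lemma inner_e (x : R2) (k : Fin 2) : inner ℝ x (e k) = x k := by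
  simp [e, EuclideanSpace.inner_single_right]

/-- `G` is the weak `k`-th partial derivative of `F`; the test functions are the smooth functions
with compact support. -/
def HasWeakDeriv (k : Fin 2) (F G : R2 → ℂ) : Prop :=
  ∀ φ : R2 → ℂ, ContDiff ℝ ∞ φ → HasCompactSupport φ →
    ∫ x, F x * fderiv ℝ φ x (e k) = -∫ x, G x * φ x

lemma integrable_mul_of_compactSupport {F φ : R2 → ℂ} (hF : LocallyIntegrable F)
    (hφ : Continuous φ) (hc : HasCompactSupport φ) : Integrable (fun x => F x * φ x) := by
  have := hF.integrable_smul_right_of_hasCompactSupport hφ hc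
  simpa [smul_eq_mul] using this

lemma HasWeakDeriv.congr {k : Fin 2} {F G F' G' : R2 → ℂ} (h : HasWeakDeriv k F G)
    (hF : F =ᵐ[volume] F') (hG : G =ᵐ[volume] G') : HasWeakDeriv k F' G' := by
  intro φ h1 h2
  rw [integral_congr_ae (g := fun x => F x * fderiv ℝ φ x (e k)),
    integral_congr_ae (f := fun x => G' x * φ x) (g := fun x => G x * φ x), h φ h1 h2]
  · filter_upwards [hG] with x hx; rw [hx]
  · filter_upwards [hF] with x hx; rw [hx]

/-- Leibniz' rule for the product of a weakly differentiable function with a smooth one. -/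
lemma HasWeakDeriv.smooth_mul {k : Fin 2} {F G ψ : R2 → ℂ} (h : HasWeakDeriv k F G)
    (hF : LocallyIntegrable F) (hG : LocallyIntegrable G) (hψ : ContDiff ℝ ∞ ψ) :
    HasWeakDeriv k (fun x => ψ x * F x) (fun x => fderiv ℝ ψ x (e k) * F x + ψ x * G x) := by
  intro φ h1 h2
  have hd : ∀ {g : R2 → ℂ}, ContDiff ℝ ∞ g → Continuous fun x => fderiv ℝ g x (e k) := fun hg =>
    (hg.continuous_fderiv (by simp)).clm_apply continuous_const
  have h3 := h (fun x => ψ x * φ x) (hψ.mul h1) h2.mul_left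
  have h4 : ∀ x, fderiv ℝ (fun x => ψ x * φ x) x (e k) =
      ψ x * fderiv ℝ φ x (e k) + φ x * fderiv ℝ ψ x (e k) := by
    intro x
    rw [fderiv_fun_mul (hψ.differentiable (by simp) x) (h1.differentiable (by simp) x)]
    simp
  have c1 : HasCompactSupport fun x => fderiv ℝ φ x (e k) := h2.fderiv_apply ℝ (e k)
  have i1 : Integrable fun x => F x * (ψ x * fderiv ℝ φ x (e k)) :=
    integrable_mul_of_compactSupport hF (hψ.continuous.mul (hd h1)) c1.mul_left
  have i2 : Integrable fun x => F x * (φ x * fderiv ℝ ψ x (e k)) :=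
    integrable_mul_of_compactSupport hF (h1.continuous.mul (hd hψ)) h2.mul_right
  have i3 : Integrable fun x => G x * (ψ x * φ x) :=
    integrable_mul_of_compactSupport hG (hψ.continuous.mul h1.continuous) h2.mul_left
  have e1 : (∫ x, F x * fderiv ℝ (fun x => ψ x * φ x) x (e k)) =
      (∫ x, F x * (ψ x * fderiv ℝ φ x (e k))) + ∫ x, F x * (φ x * fderiv ℝ ψ x (e k)) := by
    rw [← integral_add i1 i2]
    congr 1; ext x; rw [h4]; ring
  have e2 : (∫ x, (fderiv ℝ ψ x (e k) * F x + ψ x * G x) * φ x) =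
      (∫ x, F x * (φ x * fderiv ℝ ψ x (e k))) + ∫ x, G x * (ψ x * φ x) := by
    rw [← integral_add i2 i3]
    congr 1; ext x; ring
  have e3 : (∫ x, ψ x * F x * fderiv ℝ φ x (e k)) = ∫ x, F x * (ψ x * fderiv ℝ φ x (e k)) := by
    congr 1; ext x; ring
  rw [e2, e3]
  linear_combination h3 - e1

lemma memLp_mul_integrable {F G : R2 → ℂ} (hF : MemLp F 2) (hG : MemLp G 2) :
    Integrable fun x => F x * G x := by
  have := MemLp.integrable_mul hF hG
  exact this

set_option maxHeartbeats 1000000 in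
/-- For square integrable functions, the defining identity of the weak derivative extends to
Schwartz functions, by cutting off at a large radius. -/
lemma HasWeakDeriv.schwartz {k : Fin 2} {F G : R2 → ℂ} (h : HasWeakDeriv k F G)
    (hF : MemLp F 2) (hG : MemLp G 2) (φ : 𝓢(R2, ℂ)) :
    ∫ x, F x * fderiv ℝ φ x (e k) = -∫ x, G x * φ x := by
  -- the test functions are `a n * φ` with `a n x = b (x / (n + 1))`
  let b : ContDiffBump (0 : R2) := ⟨1, 2, one_pos, one_lt_two⟩
  let g : R2 → ℂ := fun x => (b x : ℂ)
  have hg : ContDiff ℝ ∞ g := Complex.ofRealCLM.contDiff.comp b.contDiff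
  have hgc : HasCompactSupport g := b.hasCompactSupport.comp_left Complex.ofReal_zero
  obtain ⟨C, hC⟩ := (hgc.fderiv (𝕜 := ℝ)).exists_bound_of_continuous
    (hg.continuous_fderiv (by simp))
  let r : ℕ → ℝ := fun n => 1 / ((n : ℝ) + 1)
  have hr : Tendsto r atTop (𝓝 0) := tendsto_one_div_add_atTop_nhds_zero_nat
  have hr0 : ∀ n, 0 < r n := fun n => Nat.one_div_pos_of_nat
  have hr1 : ∀ n, r n ≤ 1 := fun n => by
    have : (0 : ℝ) ≤ n := n.cast_nonneg
    simp only [r]; rw [div_le_one (by positivity)]; linarith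
  let a : ℕ → R2 → ℂ := fun n x => g (r n • x)
  have ha : ∀ n, ContDiff ℝ ∞ (a n) := fun n => hg.comp (contDiff_const_smul _)
  have hac : ∀ n, HasCompactSupport (a n) := fun n => hgc.comp_smul (hr0 n).ne'
  have hφ : ContDiff ℝ ∞ φ := φ.smooth ⊤
  have key := fun n => h (fun x => a n x * φ x) ((ha n).mul hφ) (hac n).mul_right
  have hfd : ∀ n x, fderiv ℝ (a n) x (e k) = (r n : ℂ) * fderiv ℝ g (r n • x) (e k) := by
    intro n x
    have := fderiv_comp_smul (𝕜 := ℝ) (f := g) (x := x) (r n)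
    simp only [a]
    rw [this]
    simp
  have hfm : ∀ n x, fderiv ℝ (fun x => a n x * φ x) x (e k) =
      a n x * fderiv ℝ φ x (e k) + φ x * ((r n : ℂ) * fderiv ℝ g (r n • x) (e k)) := by
    intro n x
    rw [fderiv_fun_mul ((ha n).differentiable (by simp) x) (hφ.differentiable (by simp) x), ← hfd]
    simp
  have ha1 : ∀ n x, ‖a n x‖ ≤ 1 := fun n x => by
    simp only [a, g, Complex.norm_real, Real.norm_eq_abs, abs_of_nonneg b.nonneg]
    exact b.le_one
  have hae : ∀ x, ∀ᶠ n in atTop, a n x = 1 := by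
    intro x
    have h1 : Tendsto (fun n => ‖r n • x‖) atTop (𝓝 0) := by
      simpa [norm_smul] using (hr.abs.mul_const ‖x‖)
    filter_upwards [h1.eventually (gt_mem_nhds one_pos)] with n hn
    have : b (r n • x) = 1 := b.one_of_mem_closedBall (by simpa using hn.le)
    simp [a, g, this]
  have he : ‖e k‖ = 1 := by simp [e]
  have hφ2 : MemLp φ 2 := φ.memLp 2
  have hdφ : MemLp (fun x => fderiv ℝ φ x (e k)) 2 := by
    have := (∂_{e k} φ).memLp 2 (μ := volume)
    simpa [SchwartzMap.lineDerivOp_apply_eq_fderiv] using! this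
  have l1 : Tendsto (fun n => ∫ x, G x * (a n x * φ x)) atTop (𝓝 (∫ x, G x * φ x)) := by
    refine tendsto_integral_of_dominated_convergence (fun x => ‖G x * φ x‖) (fun n => ?_)
      (memLp_mul_integrable hG hφ2).norm (fun n => ?_) ?_
    · exact hG.1.mul (((ha n).continuous.mul hφ.continuous).aestronglyMeasurable)
    · refine Eventually.of_forall fun x => ?_
      rw [norm_mul, norm_mul, norm_mul]
      exact mul_le_mul_of_nonneg_left (mul_le_of_le_one_left (norm_nonneg _) (ha1 n x))
        (norm_nonneg _)
    · refine Eventually.of_forall fun x => tendsto_const_nhds.congr' ?_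
      filter_upwards [hae x] with n hn
      rw [hn, one_mul]
  have l2 : Tendsto (fun n => ∫ x, F x * fderiv ℝ (fun x => a n x * φ x) x (e k)) atTop
      (𝓝 (∫ x, F x * fderiv ℝ φ x (e k))) := by
    refine tendsto_integral_of_dominated_convergence
      (fun x => ‖F x * fderiv ℝ φ x (e k)‖ + C * ‖F x * φ x‖) (fun n => ?_)
      ((memLp_mul_integrable hF hdφ).norm.add ((memLp_mul_integrable hF hφ2).norm.const_mul C))
      (fun n => ?_) ?_
    · exact hF.1.mul (((((ha n).mul hφ).continuous_fderiv (by simp)).clm_apply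
        continuous_const).aestronglyMeasurable)
    · refine Eventually.of_forall fun x => ?_
      have h5 : ‖(r n : ℂ) * fderiv ℝ g (r n • x) (e k)‖ ≤ C := by
        rw [norm_mul, Complex.norm_real, Real.norm_eq_abs, abs_of_pos (hr0 n)]
        calc r n * ‖fderiv ℝ g (r n • x) (e k)‖ ≤ 1 * ‖fderiv ℝ g (r n • x) (e k)‖ := by
              gcongr; exact hr1 n
          _ ≤ ‖fderiv ℝ g (r n • x)‖ * ‖e k‖ := by
              rw [one_mul]; exact ContinuousLinearMap.le_opNorm _ _
          _ ≤ C := by rw [he, mul_one]; exact hC _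
      rw [hfm, mul_add]
      refine (norm_add_le _ _).trans (add_le_add ?_ ?_)
      · rw [norm_mul, norm_mul, norm_mul]
        exact mul_le_mul_of_nonneg_left (mul_le_of_le_one_left (norm_nonneg _) (ha1 n x))
          (norm_nonneg _)
      · rw [← mul_assoc, norm_mul, mul_comm C]
        exact mul_le_mul_of_nonneg_left h5 (norm_nonneg _)
    · refine Eventually.of_forall fun x => ?_
      have h6 : Tendsto (fun n => F x * (fderiv ℝ φ x (e k) +
          φ x * ((r n : ℂ) * fderiv ℝ g (r n • x) (e k)))) atTop
          (𝓝 (F x * (fderiv ℝ φ x (e k) + φ x * ((0 : ℝ) * fderiv ℝ g ((0 : ℝ) • x) (e k))))) := by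
        refine ((tendsto_const_nhds.mul (((Complex.continuous_ofReal.tendsto _).comp hr).mul
          ?_)).const_add _).const_mul _
        exact (((hg.continuous_fderiv (by simp)).clm_apply continuous_const).tendsto _).comp
          (hr.smul_const x)
      simp only [Complex.ofReal_zero, zero_mul, mul_zero, add_zero] at h6
      refine h6.congr' ?_
      filter_upwards [hae x] with n hn
      rw [hfm, hn, one_mul]
  have l3 := l2.congr key
  exact tendsto_nhds_unique l3 l1.neg

/-- The weak derivative agrees with Mathlib's derivative of tempered distributions, whose relation to
the Fourier transform is known. -/
lemma hasWeakDeriv_iff_lineDeriv {k : Fin 2} (F G : L2) :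
    HasWeakDeriv k F G ↔ ∂_{e k} (F : 𝓢'(R2, ℂ)) = (G : 𝓢'(R2, ℂ)) := by
  have hd : ∀ φ : 𝓢(R2, ℂ), (∂_{e k} (F : 𝓢'(R2, ℂ))) φ = -∫ x, F x * fderiv ℝ φ x (e k) := by
    intro φ
    rw [TemperedDistribution.lineDerivOp_apply_apply, Lp.toTemperedDistribution_apply,
      ← integral_neg]
    congr 1; ext x
    simp [SchwartzMap.lineDerivOp_apply_eq_fderiv, mul_comm]
  have hG : ∀ φ : 𝓢(R2, ℂ), (G : 𝓢'(R2, ℂ)) φ = ∫ x, G x * φ x := by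
    intro φ
    rw [Lp.toTemperedDistribution_apply]
    congr 1; ext x
    simp [mul_comm]
  constructor
  · intro h
    ext φ
    rw [hd, hG, h.schwartz (Lp.memLp F) (Lp.memLp G), neg_neg]
  · intro h φ h1 h2
    have := hd (h2.toSchwartzMap h1)
    rw [h, hG] at this
    have hc : ⇑(h2.toSchwartzMap h1) = φ := rfl
    rw [hc] at this
    linear_combination this

/-! ### Weak derivatives and the Fourier transform on `L²` -/

lemma memLp_locallyIntegrable {F : R2 → ℂ} (hF : MemLp F 2) : LocallyIntegrable F :=
  hF.locallyIntegrable (by norm_num)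

lemma locallyIntegrable_coord_mul {F : R2 → ℂ} (hF : MemLp F 2) (c : ℂ) (k : Fin 2) :
    LocallyIntegrable fun x : R2 => c * (x k : ℂ) * F x := by
  have hc : Continuous fun x : R2 => c * (x k : ℂ) := by fun_prop
  have := (memLp_locallyIntegrable hF).smul_continuous (g := fun x : R2 => c * (x k : ℂ)) hc
  simp only [smul_eq_mul] at this
  convert this using 2
  ring

/-- Multiplication of a tempered distribution by `c x_k`, for distributions given by `L²` functions. -/
lemma smulLeft_eq_iff (P Q : L2) (c : ℂ) (k : Fin 2) :
    (Q : 𝓢'(R2, ℂ)) =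
      c • TemperedDistribution.smulLeftCLM ℂ (inner ℝ · (e k)) (P : 𝓢'(R2, ℂ)) ↔
      ∀ᵐ x, Q x = c * (x k : ℂ) * P x := by
  have ht : (fun x : R2 => ((inner ℝ x (e k) : ℝ) : ℂ)).HasTemperateGrowth := by fun_prop
  have hP : ∀ φ : 𝓢(R2, ℂ),
      (c • TemperedDistribution.smulLeftCLM ℂ (inner ℝ · (e k)) (P : 𝓢'(R2, ℂ))) φ =
        ∫ x, φ x • (c * (x k : ℂ) * P x) := by
    intro φ
    change c • (TemperedDistribution.smulLeftCLM ℂ (fun x : R2 => ((inner ℝ x (e k) : ℝ) : ℂ))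
      (P : 𝓢'(R2, ℂ))) φ = _
    rw [TemperedDistribution.smulLeftCLM_apply_apply, Lp.toTemperedDistribution_apply,
      ← integral_smul]
    congr 1; ext x
    rw [SchwartzMap.smulLeftCLM_apply_apply ht, inner_e]
    simp only [smul_eq_mul]; ring
  constructor
  · intro h
    refine ae_eq_of_integral_contDiff_smul_eq (memLp_locallyIntegrable (Lp.memLp Q))
      (locallyIntegrable_coord_mul (Lp.memLp P) c k) fun g hg hc => ?_
    have hg' : ContDiff ℝ ∞ fun x => (g x : ℂ) := Complex.ofRealCLM.contDiff.comp hg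
    have hc' : HasCompactSupport fun x => (g x : ℂ) := hc.comp_left Complex.ofReal_zero
    have h1 := hP (hc'.toSchwartzMap hg')
    rw [← h, Lp.toTemperedDistribution_apply] at h1
    exact h1
  · intro h
    ext φ
    rw [hP, Lp.toTemperedDistribution_apply]
    refine integral_congr_ae ?_
    filter_upwards [h] with x hx
    rw [hx]

/-- For square integrable functions, a weak derivative corresponds to multiplication by `2πi ξ_k`
on the Fourier side. -/
theorem hasWeakDeriv_iff_fourier {k : Fin 2} (F G : L2) :
    HasWeakDeriv k F G ↔
      ∀ᵐ ξ, (𝓕 G : L2) ξ = 2 * Real.pi * Complex.I * (ξ k : ℂ) * (𝓕 F : L2) ξ := by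
  rw [hasWeakDeriv_iff_lineDeriv, ← smulLeft_eq_iff, ← Lp.fourier_toTemperedDistribution_eq,
    ← Lp.fourier_toTemperedDistribution_eq, ← TemperedDistribution.fourier_lineDerivOp_eq]
  constructor
  · intro h; rw [h]
  · intro h
    have := congrArg 𝓕⁻ h
    rw [FourierTransform.fourierInv_fourier_eq, FourierTransform.fourierInv_fourier_eq] at this
    exact this.symm

/-- The analogue of `hasWeakDeriv_iff_fourier` for the inverse Fourier transform. -/
theorem hasWeakDeriv_iff_fourierInv {k : Fin 2} (F G : L2) :
    HasWeakDeriv k F G ↔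
      ∀ᵐ x, (𝓕⁻ G : L2) x = -(2 * Real.pi * Complex.I) * (x k : ℂ) * (𝓕⁻ F : L2) x := by
  rw [hasWeakDeriv_iff_lineDeriv, ← smulLeft_eq_iff, ← Lp.fourierInv_toTemperedDistribution_eq,
    ← Lp.fourierInv_toTemperedDistribution_eq, ← TemperedDistribution.fourierInv_lineDerivOp_eq]
  constructor
  · intro h; rw [h]
  · intro h
    have := congrArg 𝓕 h
    rw [FourierTransform.fourier_fourierInv_eq, FourierTransform.fourier_fourierInv_eq] at this
    exact this.symm

/-- Plancherel's theorem for representatives. -/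
lemma integral_conj_mul_fourier {A B : R2 → ℂ} (hA : MemLp A 2) (hB : MemLp B 2) :
    ∫ x, conj (A x) * B x =
      ∫ ξ, conj ((𝓕 (hA.toLp A) : L2) ξ) * (𝓕 (hB.toLp B) : L2) ξ := by
  have := Lp.inner_fourier_eq (hA.toLp A) (hB.toLp B)
  rw [L2.inner_def, L2.inner_def] at this
  simp only [RCLike.inner_apply] at this
  rw [integral_congr_ae (g := fun x => (hB.toLp B) x * conj ((hA.toLp A) x)), ← this]
  · congr 1; ext x; ring
  · filter_upwards [hA.coeFn_toLp, hB.coeFn_toLp] with x h1 h2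
    rw [h1, h2, mul_comm]

/-- Integration by parts for weak derivatives of square integrable functions. -/
theorem HasWeakDeriv.integral_conj_mul {k : Fin 2} {F G H K : R2 → ℂ}
    (h1 : HasWeakDeriv k F G) (h2 : HasWeakDeriv k H K)
    (hF : MemLp F 2) (hG : MemLp G 2) (hH : MemLp H 2) (hK : MemLp K 2) :
    ∫ x, conj (F x) * K x = -∫ x, conj (G x) * H x := by
  rw [integral_conj_mul_fourier hF hK, integral_conj_mul_fourier hG hH, ← integral_neg]
  have h1' := (hasWeakDeriv_iff_fourier (hF.toLp F) (hG.toLp G)).1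
    (h1.congr hF.coeFn_toLp.symm hG.coeFn_toLp.symm)
  have h2' := (hasWeakDeriv_iff_fourier (hH.toLp H) (hK.toLp K)).1
    (h2.congr hH.coeFn_toLp.symm hK.coeFn_toLp.symm)
  refine integral_congr_ae ?_
  filter_upwards [h1', h2'] with x e1 e2
  rw [e1, e2]
  simp only [map_mul, Complex.conj_I, Complex.conj_ofReal, map_ofNat]
  ring

/-- The defining duality of the Fourier transform of a tempered distribution. -/
lemma integral_fourier_mul_eq (u : L2) (φ : 𝓢(R2, ℂ)) :
    ∫ ξ, φ ξ * (𝓕 u : L2) ξ = ∫ x, 𝓕 (φ : R2 → ℂ) x * u x := by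
  have h := congrArg (fun T : 𝓢'(R2, ℂ) => T φ) (Lp.fourier_toTemperedDistribution_eq u)
  simp only [TemperedDistribution.fourier_apply, Lp.toTemperedDistribution_apply,
    smul_eq_mul] at h
  rw [← h, SchwartzMap.fourier_coe]

/-- On `L¹ ∩ L²` the Fourier transform of `L²` is given by the Fourier integral. -/
theorem fourier_toLp_ae_eq {f : R2 → ℂ} (h1 : Integrable f) (h2 : MemLp f 2) :
    ((𝓕 (h2.toLp f) : L2) : R2 → ℂ) =ᵐ[volume] 𝓕 f := by
  have hcont : Continuous (𝓕 f) :=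
    VectorFourier.fourierIntegral_continuous Real.continuous_fourierChar
      (by exact continuous_inner) h1
  refine ae_eq_of_integral_contDiff_smul_eq (memLp_locallyIntegrable (Lp.memLp _))
    hcont.locallyIntegrable fun g hg hc => ?_
  have hg' : ContDiff ℝ ∞ fun x => (g x : ℂ) := Complex.ofRealCLM.contDiff.comp hg
  have hc' : HasCompactSupport fun x => (g x : ℂ) := hc.comp_left Complex.ofReal_zero
  have h3 := integral_fourier_mul_eq (h2.toLp f) (hc'.toSchwartzMap hg')
  have h4 := VectorFourier.integral_fourierIntegral_smul_eq_flip (μ := volume) (ν := volume)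
    (L := innerₗ R2) (f := (hc'.toSchwartzMap hg')) (g := f) Real.continuous_fourierChar
    (by exact continuous_inner) (hc'.toSchwartzMap hg').integrable h1
  have h5 : (∫ x, 𝓕 ((hc'.toSchwartzMap hg') : R2 → ℂ) x * (h2.toLp f) x) =
      ∫ x, 𝓕 ((hc'.toSchwartzMap hg') : R2 → ℂ) x * f x := by
    refine integral_congr_ae ?_
    filter_upwards [h2.coeFn_toLp] with x hx
    rw [hx]
  rw [h5] at h3
  rw [flip_innerₗ] at h4
  exact h3.trans h4

/-- On `L¹ ∩ L²` the inverse Fourier transform of `L²` is given by the inverse Fourier integral. -/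
theorem fourierInv_toLp_ae_eq {f : R2 → ℂ} (h1 : Integrable f) (h2 : MemLp f 2) :
    ((𝓕⁻ (h2.toLp f) : L2) : R2 → ℂ) =ᵐ[volume] 𝓕⁻ f := by
  have hcont : Continuous (𝓕 f) :=
    VectorFourier.fourierIntegral_continuous Real.continuous_fourierChar
      (by exact continuous_inner) h1
  have hcont' : Continuous (𝓕⁻ f) := by
    have : 𝓕⁻ f = fun x => 𝓕 f (-x) := by ext x; exact Real.fourierInv_eq_fourier_neg f x
    rw [this]; exact hcont.comp continuous_neg
  refine ae_eq_of_integral_contDiff_smul_eq (memLp_locallyIntegrable (Lp.memLp _))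
    hcont'.locallyIntegrable fun g hg hc => ?_
  have hg' : ContDiff ℝ ∞ fun x => (g x : ℂ) := Complex.ofRealCLM.contDiff.comp hg
  have hc' : HasCompactSupport fun x => (g x : ℂ) := hc.comp_left Complex.ofReal_zero
  set φ := hc'.toSchwartzMap hg' with hφ
  have h3 : (∫ ξ, φ ξ * (𝓕⁻ (h2.toLp f) : L2) ξ) = ∫ x, 𝓕⁻ (φ : R2 → ℂ) x * f x := by
    have h := congrArg (fun T : 𝓢'(R2, ℂ) => T φ)
      (Lp.fourierInv_toTemperedDistribution_eq (h2.toLp f))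
    simp only [TemperedDistribution.fourierInv_apply, Lp.toTemperedDistribution_apply,
      smul_eq_mul] at h
    rw [← h, SchwartzMap.fourierInv_coe]
    refine integral_congr_ae ?_
    filter_upwards [h2.coeFn_toLp] with x hx
    rw [hx]
  have h6 : (∫ x, 𝓕⁻ (φ : R2 → ℂ) x * f x) = ∫ x, φ x * 𝓕⁻ f x := by
    have e1 : (∫ x, 𝓕⁻ (φ : R2 → ℂ) x * f x) = ∫ x, 𝓕 (fun y => φ (-y)) x * f x := by
      congr 1; ext x
      rw [Real.fourierInv_eq_fourier_comp_neg]
    have h7 := VectorFourier.integral_fourierIntegral_smul_eq_flip (μ := volume) (ν := volume)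
      (L := innerₗ R2) (f := fun y => φ (-y)) (g := f) Real.continuous_fourierChar
      (by exact continuous_inner) φ.integrable.comp_neg h1
    rw [flip_innerₗ] at h7
    refine e1.trans (h7.trans ?_)
    rw [← integral_neg_eq_self]
    congr 1; ext x
    rw [neg_neg, Real.fourierInv_eq_fourier_neg]
    rfl
  exact h3.trans h6

/-! ### The group velocity and its Jacobian -/

lemma bracket_pos {V : Type*} [NormedAddCommGroup V] (v : V) : 0 < bracket v :=
  Real.sqrt_pos.2 (by positivity)

lemma bracket_sq {V : Type*} [NormedAddCommGroup V] (v : V) : bracket v ^ 2 = 1 + ‖v‖ ^ 2 :=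
  Real.sq_sqrt (by positivity)

lemma one_le_bracket {V : Type*} [NormedAddCommGroup V] (v : V) : 1 ≤ bracket v :=
  Real.one_le_sqrt.2 (by nlinarith [sq_nonneg ‖v‖])

lemma contDiff_bracket : ContDiff ℝ ∞ (bracket : R2 → ℝ) :=
  (contDiff_const.add (contDiff_id.norm_sq ℝ)).sqrt fun x => by positivity

/-- The group velocity `∇⟨ξ⟩ = ξ/⟨ξ⟩`. -/
noncomputable def velocity (ξ : R2) : R2 := (bracket ξ)⁻¹ • ξ

lemma norm_velocity_sq (ξ : R2) : ‖velocity ξ‖ ^ 2 = 1 - ((bracket ξ)⁻¹) ^ 2 := by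
  have h := bracket_sq ξ
  have h0 := bracket_pos ξ
  rw [velocity, norm_smul, norm_inv, Real.norm_eq_abs, abs_of_pos h0]
  field_simp
  linarith

lemma contDiff_velocity : ContDiff ℝ ∞ velocity :=
  (contDiff_bracket.inv fun ξ => (bracket_pos ξ).ne').smul contDiff_id

section Lines

variable (ξ u : R2)

lemma hasDerivAt_line : HasDerivAt (fun s : ℝ => ξ + s • u) u 0 := by
  simpa using ((hasDerivAt_id (0 : ℝ)).smul_const u).const_add ξ

lemma fderiv_apply_eq_of_line {E : Type*} [NormedAddCommGroup E] [NormedSpace ℝ E] {f : R2 → E}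
    {d : E} (hf : DifferentiableAt ℝ f ξ) (h : HasDerivAt (fun s : ℝ => f (ξ + s • u)) d 0) :
    fderiv ℝ f ξ u = d := by
  rw [← hf.lineDeriv_eq_fderiv]
  exact h.deriv

lemma hasDerivAt_bracket_line :
    HasDerivAt (fun s : ℝ => bracket (ξ + s • u)) (inner ℝ (velocity ξ) u) 0 := by
  have h1 := ((hasDerivAt_line ξ u).norm_sq.const_add 1).sqrt (by positivity)
  refine h1.congr_deriv ?_
  have := bracket_pos ξ
  simp only [zero_smul, add_zero, velocity, real_inner_smul_left]
  change _ / (2 * bracket ξ) = _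
  field_simp

lemma hasDerivAt_invBracket_line : HasDerivAt (fun s : ℝ => (bracket (ξ + s • u))⁻¹)
    (-((bracket ξ)⁻¹ ^ 2 * inner ℝ (velocity ξ) u)) 0 := by
  have h1 := (hasDerivAt_bracket_line ξ u).fun_inv (by simpa using (bracket_pos ξ).ne')
  refine h1.congr_deriv ?_
  simp only [zero_smul, add_zero]
  field_simp

lemma hasDerivAt_velocity_line : HasDerivAt (fun s : ℝ => velocity (ξ + s • u))
    ((bracket ξ)⁻¹ • (u - inner ℝ (velocity ξ) u • velocity ξ)) 0 := by
  have h := (hasDerivAt_invBracket_line ξ u).fun_smul (hasDerivAt_line ξ u)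
  unfold velocity at h ⊢
  refine h.congr_deriv ?_
  simp only [zero_smul, add_zero]
  module

end Lines

/-- The derivative of the group velocity, as a linear map. -/
noncomputable def velocityDeriv (ξ : R2) : R2 →L[ℝ] R2 :=
  (bracket ξ)⁻¹ • (ContinuousLinearMap.id ℝ R2 -
    (innerSL ℝ (velocity ξ)).smulRight (velocity ξ))

lemma hasFDerivAt_velocity (ξ : R2) : HasFDerivAt velocity (velocityDeriv ξ) ξ := by
  have hd := contDiff_velocity.differentiable (by simp) ξ
  have h : fderiv ℝ velocity ξ = velocityDeriv ξ := by
    refine ContinuousLinearMap.ext fun u => ?_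
    rw [fderiv_apply_eq_of_line ξ u hd (hasDerivAt_velocity_line ξ u)]
    simp [velocityDeriv]
  rw [← h]
  exact hd.hasFDerivAt

lemma det_velocityDeriv (ξ : R2) : (velocityDeriv ξ).det = ((bracket ξ)⁻¹) ^ 4 := by
  have h1 : ((velocityDeriv ξ : R2 →L[ℝ] R2) : R2 →ₗ[ℝ] R2) = (bracket ξ)⁻¹ •
      LinearMap.transvection (-(innerSL ℝ (velocity ξ) : R2 →ₗ[ℝ] ℝ)) (velocity ξ) := by
    ext1 u
    simp [velocityDeriv, LinearMap.transvection, sub_eq_add_neg]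
  rw [ContinuousLinearMap.det, h1, LinearMap.det_smul, LinearMap.transvection.det]
  simp [norm_velocity_sq]
  ring

lemma velocity_injective : Function.Injective velocity := by
  intro a b h
  have h1 := norm_velocity_sq a
  rw [h, norm_velocity_sq] at h1
  have h2 : (bracket a)⁻¹ = (bracket b)⁻¹ := by
    have ha := inv_pos.2 (bracket_pos a)
    have hb := inv_pos.2 (bracket_pos b)
    exact (pow_left_inj₀ ha.le hb.le two_ne_zero).1 (by linarith)
  unfold velocity at h
  rw [h2] at h
  exact smul_right_injective R2 (inv_pos.2 (bracket_pos b)).ne' h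

/-- The uniform bound `∫ ⟨ξ⟩⁻⁴ (1 + t|v - ξ/⟨ξ⟩|²)⁻² dξ ≤ C/t`: the Jacobian determinant of the
group velocity is `⟨ξ⟩⁻⁴`, so the left side is an integral of `(1 + t|v - q|²)⁻²` over the unit
disc. -/
lemma exists_lintegral_weight_le : ∃ C : ℝ, 0 < C ∧ ∀ t : ℝ, 0 < t → ∀ v : R2,
    ∫⁻ ξ : R2, ENNReal.ofReal (((bracket ξ)⁻¹) ^ 4 * ((1 + t * ‖v - velocity ξ‖ ^ 2)⁻¹) ^ 2) ≤
      ENNReal.ofReal (C / t) := by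
  have hint : Integrable (fun x : R2 => ((1 + ‖x‖ ^ 2)⁻¹) ^ 2) := by
    have := integrable_rpow_neg_one_add_norm_sq (E := R2) (μ := volume) (r := 4) (by simp; norm_num)
    refine this.congr (Eventually.of_forall fun x => ?_)
    have : (0:ℝ) < 1 + ‖x‖ ^ 2 := by positivity
    simp only
    rw [show (-4 / 2 : ℝ) = -((2 : ℕ) : ℝ) by norm_num, Real.rpow_neg this.le, Real.rpow_natCast,
      inv_pow]
  have hpos : 0 ≤ ∫ x : R2, ((1 + ‖x‖ ^ 2)⁻¹) ^ 2 := integral_nonneg fun x => by positivity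
  refine ⟨(∫ x : R2, ((1 + ‖x‖ ^ 2)⁻¹) ^ 2) + 1, by positivity, fun t ht v => ?_⟩
  let g : R2 → ℝ≥0∞ := fun q => ENNReal.ofReal (((1 + t * ‖v - q‖ ^ 2)⁻¹) ^ 2)
  have h1 := lintegral_image_eq_lintegral_abs_det_fderiv_mul (volume : Measure R2)
    MeasurableSet.univ (fun ξ _ => (hasFDerivAt_velocity ξ).hasFDerivWithinAt)
    velocity_injective.injOn g
  have h2 : (∫⁻ ξ : R2, ENNReal.ofReal
      (((bracket ξ)⁻¹) ^ 4 * ((1 + t * ‖v - velocity ξ‖ ^ 2)⁻¹) ^ 2)) =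
      ∫⁻ ξ in Set.univ, ENNReal.ofReal |(velocityDeriv ξ).det| * g (velocity ξ) := by
    rw [Measure.restrict_univ]
    congr 1; ext ξ
    have := bracket_pos ξ
    rw [det_velocityDeriv, abs_of_pos (by positivity), ENNReal.ofReal_mul (by positivity)]
  rw [h2, ← h1]
  refine (setLIntegral_le_lintegral _ _).trans ?_
  have h3 : (∫⁻ q, g q) = ENNReal.ofReal (∫ q : R2, ((1 + t * ‖v - q‖ ^ 2)⁻¹) ^ 2) := by
    have hi : Integrable (fun q : R2 => ((1 + t * ‖v - q‖ ^ 2)⁻¹) ^ 2) := by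
      have := (hint.comp_smul (Real.sqrt_pos.2 ht).ne').comp_sub_left v
      refine this.congr (Eventually.of_forall fun x => ?_)
      simp only [norm_smul, mul_pow, Real.norm_eq_abs, sq_abs, Real.sq_sqrt ht.le]
    rw [ofReal_integral_eq_lintegral_ofReal hi]
    exact Eventually.of_forall fun x => by positivity
  rw [h3]
  refine ENNReal.ofReal_le_ofReal ?_
  have h4 : (∫ q : R2, ((1 + t * ‖v - q‖ ^ 2)⁻¹) ^ 2) = ∫ q : R2, ((1 + t * ‖q‖ ^ 2)⁻¹) ^ 2 :=
    integral_sub_left_eq_self (fun q : R2 => ((1 + t * ‖q‖ ^ 2)⁻¹) ^ 2) volume v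
  have h5 := Measure.integral_comp_smul (volume : Measure R2)
    (fun x : R2 => ((1 + ‖x‖ ^ 2)⁻¹) ^ 2) (Real.sqrt t)
  simp only [norm_smul, mul_pow, Real.norm_eq_abs, sq_abs, Real.sq_sqrt ht.le, smul_eq_mul,
    finrank_euclideanSpace, Fintype.card_fin] at h5
  rw [h4, h5, abs_of_pos (by positivity), ← div_eq_inv_mul]
  gcongr
  linarith

/-! ### Integration by parts along the gradient of the phase -/

lemma inv_bracket_le_one {V : Type*} [NormedAddCommGroup V] (ξ : V) : (bracket ξ)⁻¹ ≤ 1 :=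
  inv_le_one_of_one_le₀ (one_le_bracket ξ)

lemma norm_velocity_le_one (ξ : R2) : ‖velocity ξ‖ ≤ 1 := by
  have := norm_velocity_sq ξ
  have h : ‖velocity ξ‖ ^ 2 ≤ 1 := by nlinarith [sq_nonneg ((bracket ξ)⁻¹)]
  exact (sq_le_one_iff₀ (norm_nonneg _)).1 h

/-- Smooth functions which, together with their first derivatives, are `O(⟨ξ⟩⁻ⁿ)`. -/
structure DecayC1 (n : ℕ) (h : R2 → ℂ) : Prop where
  smooth : ContDiff ℝ ∞ h
  bound : ∃ C : ℝ, ∀ ξ, ‖h ξ‖ ≤ C * (bracket ξ)⁻¹ ^ n ∧ ‖fderiv ℝ h ξ‖ ≤ C * (bracket ξ)⁻¹ ^ n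

namespace DecayC1

/-- The derivative is bounded through the derivatives along lines, which are computed in closed form. -/
lemma of_line {n : ℕ} {h : R2 → ℂ} (hs : ContDiff ℝ ∞ h) {d : R2 → R2 → ℂ} {C : ℝ}
    (hd : ∀ ξ u, HasDerivAt (fun s : ℝ => h (ξ + s • u)) (d ξ u) 0)
    (h1 : ∀ ξ, ‖h ξ‖ ≤ C * (bracket ξ)⁻¹ ^ n)
    (h2 : ∀ ξ u, ‖d ξ u‖ ≤ C * (bracket ξ)⁻¹ ^ n * ‖u‖) : DecayC1 n h := by
  refine ⟨hs, C, fun ξ => ⟨h1 ξ, ?_⟩⟩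
  refine ContinuousLinearMap.opNorm_le_bound _ ((norm_nonneg _).trans (h1 ξ)) fun u => ?_
  rw [fderiv_apply_eq_of_line ξ u (hs.differentiable (by simp) ξ) (hd ξ u)]
  exact h2 ξ u

lemma const (c : ℂ) : DecayC1 0 fun _ => c :=
  ⟨contDiff_const, ‖c‖, fun ξ => by simp⟩

lemma add {n : ℕ} {g h : R2 → ℂ} (hg : DecayC1 n g) (hh : DecayC1 n h) :
    DecayC1 n fun ξ => g ξ + h ξ := by
  obtain ⟨C, hC⟩ := hg.bound
  obtain ⟨D, hD⟩ := hh.bound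
  refine ⟨hg.smooth.add hh.smooth, C + D, fun ξ => ?_⟩
  rw [add_mul]
  refine ⟨(norm_add_le _ _).trans (add_le_add (hC ξ).1 (hD ξ).1), ?_⟩
  rw [fderiv_fun_add (hg.smooth.differentiable (by simp) ξ) (hh.smooth.differentiable (by simp) ξ)]
  exact (norm_add_le _ _).trans (add_le_add (hC ξ).2 (hD ξ).2)

lemma mul {m n : ℕ} {g h : R2 → ℂ} (hg : DecayC1 m g) (hh : DecayC1 n h) :
    DecayC1 (m + n) fun ξ => g ξ * h ξ := by
  obtain ⟨C, hC⟩ := hg.bound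
  obtain ⟨D, hD⟩ := hh.bound
  refine ⟨hg.smooth.mul hh.smooth, 2 * (C * D), fun ξ => ?_⟩
  have hb := inv_pos.2 (bracket_pos ξ)
  have e : C * D * (bracket ξ)⁻¹ ^ (m + n) =
      (C * (bracket ξ)⁻¹ ^ m) * (D * (bracket ξ)⁻¹ ^ n) := by ring
  have c1 := (norm_nonneg _).trans (hC ξ).1
  have d1 := (norm_nonneg _).trans (hD ξ).1
  rw [mul_assoc, e]
  constructor
  · rw [norm_mul]
    have := mul_le_mul (hC ξ).1 (hD ξ).1 (norm_nonneg _) c1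
    nlinarith [mul_nonneg c1 d1]
  · rw [fderiv_fun_mul (hg.smooth.differentiable (by simp) ξ)
      (hh.smooth.differentiable (by simp) ξ)]
    refine (norm_add_le _ _).trans ?_
    rw [norm_smul, norm_smul]
    have h1 := mul_le_mul (hC ξ).1 (hD ξ).2 (norm_nonneg _) c1
    have h2 := mul_le_mul (hC ξ).2 (hD ξ).1 (norm_nonneg _) c1
    linarith

lemma invBracket : DecayC1 1 fun ξ => (((bracket ξ)⁻¹ : ℝ) : ℂ) := by
  refine of_line (C := 1) (Complex.ofRealCLM.contDiff.comp
    (contDiff_bracket.inv fun ξ => (bracket_pos ξ).ne'))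
    (fun ξ u => (hasDerivAt_invBracket_line ξ u).ofReal_comp) (fun ξ => ?_) (fun ξ u => ?_)
  · simp [abs_of_pos (bracket_pos ξ)]
  · rw [Complex.norm_real, norm_neg, norm_mul, Real.norm_eq_abs, abs_of_nonneg (by positivity)]
    have h1 := inv_pos.2 (bracket_pos ξ)
    have h2 := inv_bracket_le_one ξ
    have h3 : ‖inner ℝ (velocity ξ) u‖ ≤ 1 * ‖u‖ :=
      (norm_inner_le_norm _ _).trans (by gcongr; exact norm_velocity_le_one ξ)
    have h4 : (bracket ξ)⁻¹ ^ 2 ≤ 1 * (bracket ξ)⁻¹ ^ 1 := by nlinarith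
    calc _ ≤ 1 * (bracket ξ)⁻¹ ^ 1 * (1 * ‖u‖) := by gcongr
      _ = _ := by ring

lemma velocity_apply (k : Fin 2) : DecayC1 0 fun ξ => ((velocity ξ k : ℝ) : ℂ) := by
  have hc : ∀ x : R2, ‖x k‖ ≤ ‖x‖ := fun x => PiLp.norm_apply_le x k
  have hl : ∀ ξ u, HasDerivAt (fun s : ℝ => velocity (ξ + s • u) k)
      (((bracket ξ)⁻¹ • (u - inner ℝ (velocity ξ) u • velocity ξ)) k) 0 := fun ξ u =>
    ((EuclideanSpace.proj (𝕜 := ℝ) k : R2 →L[ℝ] ℝ).hasFDerivAt.comp_hasDerivAt (0 : ℝ)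
      (hasDerivAt_velocity_line ξ u))
  refine of_line (C := 2) (Complex.ofRealCLM.contDiff.comp
    ((EuclideanSpace.proj (𝕜 := ℝ) k : R2 →L[ℝ] ℝ).contDiff.comp contDiff_velocity))
    (fun ξ u => (hl ξ u).ofReal_comp) (fun ξ => ?_) (fun ξ u => ?_)
  · rw [Complex.norm_real]
    have := (hc (velocity ξ)).trans (norm_velocity_le_one ξ)
    simp only [pow_zero]; linarith
  · rw [Complex.norm_real]
    refine (hc _).trans ?_
    have h2 := inv_bracket_le_one ξ
    have h3 : ‖inner ℝ (velocity ξ) u‖ ≤ ‖velocity ξ‖ * ‖u‖ := norm_inner_le_norm _ _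
    have h4 := norm_velocity_le_one ξ
    rw [norm_smul, norm_inv, Real.norm_eq_abs, abs_of_pos (bracket_pos ξ)]
    calc (bracket ξ)⁻¹ * ‖u - inner ℝ (velocity ξ) u • velocity ξ‖
        ≤ 1 * (‖u‖ + (1 * ‖u‖) * 1) := by
          gcongr
          refine (norm_sub_le _ _).trans ?_
          rw [norm_smul]
          gcongr
          exact h3.trans (by gcongr)
      _ = _ := by ring

end DecayC1

/-- The plane wave `e^{i(x·ξ - t⟨ξ⟩)}`. -/
noncomputable def phase (t : ℝ) (x ξ : R2) : ℂ :=
  Complex.exp (Complex.I * ((inner ℝ x ξ - t * bracket ξ : ℝ) : ℂ))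

lemma norm_phase (t : ℝ) (x ξ : R2) : ‖phase t x ξ‖ = 1 := by
  rw [phase, mul_comm, Complex.norm_exp_ofReal_mul_I]

lemma hasDerivAt_phase_line (t : ℝ) (x ξ u : R2) :
    HasDerivAt (fun s : ℝ => phase t x (ξ + s • u))
      (phase t x ξ * (Complex.I * ((inner ℝ x u - t * inner ℝ (velocity ξ) u : ℝ) : ℂ))) 0 := by
  have h1 : HasDerivAt (fun s : ℝ => inner ℝ x (ξ + s • u)) (inner ℝ x u) 0 := by
    simpa using (hasDerivAt_const (0 : ℝ) x).inner ℝ (hasDerivAt_line ξ u)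
  have h := (((h1.sub ((hasDerivAt_bracket_line ξ u).const_mul t)).ofReal_comp).const_mul
    Complex.I).cexp
  refine h.congr_deriv ?_
  simp [phase]

lemma contDiff_phase (t : ℝ) (x : R2) : ContDiff ℝ ∞ (phase t x) := by
  unfold phase
  refine (contDiff_const.mul (Complex.ofRealCLM.contDiff.comp ?_)).cexp
  exact (contDiff_const.inner ℝ contDiff_id).sub (contDiff_const.mul contDiff_bracket)

lemma DecayC1.phase (t : ℝ) (x : R2) : DecayC1 0 (phase t x) := by
  refine DecayC1.of_line (C := 1 + ‖x‖ + |t|) (contDiff_phase t x)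
    (hasDerivAt_phase_line t x) (fun ξ => ?_) (fun ξ u => ?_)
  · rw [norm_phase]; simp only [pow_zero]
    linarith [norm_nonneg x, abs_nonneg t]
  · rw [norm_mul, norm_phase, norm_mul, Complex.norm_I, Complex.norm_real, one_mul, one_mul,
      pow_zero, mul_one]
    have h1 : ‖inner ℝ x u‖ ≤ ‖x‖ * ‖u‖ := norm_inner_le_norm _ _
    have h2 : ‖inner ℝ (velocity ξ) u‖ ≤ ‖velocity ξ‖ * ‖u‖ := norm_inner_le_norm _ _
    have h3 : ‖velocity ξ‖ * ‖u‖ ≤ 1 * ‖u‖ := by gcongr; exact norm_velocity_le_one ξ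
    calc _ ≤ ‖inner ℝ x u‖ + ‖t * inner ℝ (velocity ξ) u‖ := norm_sub_le _ _
      _ ≤ ‖x‖ * ‖u‖ + |t| * (1 * ‖u‖) := by
        rw [norm_mul, Real.norm_eq_abs t]
        gcongr
        exact h2.trans h3
      _ ≤ _ := by nlinarith [norm_nonneg u]

lemma integrable_invBracket_pow : Integrable fun ξ : R2 => (bracket ξ)⁻¹ ^ 4 := by
  have := integrable_rpow_neg_one_add_norm_sq (E := R2) (μ := volume) (r := 4) (by simp; norm_num)
  refine this.congr (Eventually.of_forall fun x => ?_)
  have h : (0:ℝ) < 1 + ‖x‖ ^ 2 := by positivity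
  simp only
  rw [show (-4 / 2 : ℝ) = -((2 : ℕ) : ℝ) by norm_num, Real.rpow_neg h.le, Real.rpow_natCast,
    inv_pow, ← bracket_sq, ← pow_mul]

lemma DecayC1.integrable {h : R2 → ℂ} (hh : DecayC1 4 h) : Integrable h := by
  obtain ⟨C, hC⟩ := hh.bound
  exact (integrable_invBracket_pow.const_mul C).mono' hh.smooth.continuous.aestronglyMeasurable
    (Eventually.of_forall fun ξ => (hC ξ).1)

lemma DecayC1.integrable_fderiv {h : R2 → ℂ} (hh : DecayC1 4 h) (u : R2) :
    Integrable fun ξ => fderiv ℝ h ξ u := by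
  obtain ⟨C, hC⟩ := hh.bound
  refine ((integrable_invBracket_pow.const_mul C).mul_const ‖u‖).mono'
    ((hh.smooth.continuous_fderiv (by simp)).clm_apply
      continuous_const).aestronglyMeasurable (Eventually.of_forall fun ξ => ?_)
  exact (ContinuousLinearMap.le_opNorm _ _).trans
    (mul_le_mul_of_nonneg_right (hC ξ).2 (norm_nonneg _))

lemma DecayC1.integral_fderiv_eq_zero {h : R2 → ℂ} (hh : DecayC1 4 h) (u : R2) :
    ∫ ξ, fderiv ℝ h ξ u = 0 := by
  have := integral_mul_fderiv_eq_neg_fderiv_mul_of_integrable (μ := volume) (𝕜 := ℂ)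
    (f := fun _ : R2 => (1 : ℂ)) (g := h) (v := u) (by simp)
    (by simpa using hh.integrable_fderiv u) (by simpa using hh.integrable)
    (fun x _ => differentiableAt_const _) (fun x _ => hh.smooth.differentiable (by simp) x)
  simpa using this

/-- Integration by parts against `e^{it(v·ξ - ⟨ξ⟩)}` along the gradient `v - ξ/⟨ξ⟩` of the phase.
The divergence of that field is `-(⟨ξ⟩⁻¹ + ⟨ξ⟩⁻³)`. -/
lemma integral_phase_mul_normSq (t : ℝ) (v : R2) {h : R2 → ℂ} (hh : DecayC1 4 h) :
    ∫ ξ, phase t (t • v) ξ * ((t * ‖v - velocity ξ‖ ^ 2 : ℝ) * h ξ) =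
      Complex.I * ∫ ξ, phase t (t • v) ξ * (fderiv ℝ h ξ (v - velocity ξ)
        - (((bracket ξ)⁻¹ + (bracket ξ)⁻¹ ^ 3 : ℝ) : ℂ) * h ξ) := by
  let w : Fin 2 → R2 → ℂ := fun k ξ => ((v k - velocity ξ k : ℝ) : ℂ)
  have hw : ∀ k, DecayC1 0 (w k) := fun k => by
    have := (DecayC1.const (v k : ℂ)).add
      ((DecayC1.const (-1)).mul (DecayC1.velocity_apply k))
    refine (congrArg (DecayC1 0) ?_).mp this
    ext ξ; simp [w]; ring
  -- the integral of the divergence of `g` vanishes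
  let g : Fin 2 → R2 → ℂ := fun k ξ => phase t (t • v) ξ * h ξ * w k ξ
  have hg : ∀ k, DecayC1 4 (g k) := fun k => ((DecayC1.phase t (t • v)).mul hh).mul (hw k)
  have hwl : ∀ k ξ, HasDerivAt (fun s : ℝ => w k (ξ + s • e k))
      (((-((bracket ξ)⁻¹ * (1 - velocity ξ k ^ 2)) : ℝ)) : ℂ) 0 := fun k ξ => by
    have h1 := ((EuclideanSpace.proj (𝕜 := ℝ) k : R2 →L[ℝ] ℝ).hasFDerivAt.comp_hasDerivAt (0 : ℝ)
      (hasDerivAt_velocity_line ξ (e k)))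
    refine ((h1.const_sub (v k)).ofReal_comp).congr_deriv ?_
    simp [e, EuclideanSpace.inner_single_right]
    left; ring
  have hhl : ∀ k ξ, HasDerivAt (fun s : ℝ => h (ξ + s • e k)) (fderiv ℝ h ξ (e k)) 0 := by
    intro k ξ
    have h1 : HasFDerivAt h (fderiv ℝ h ξ) (ξ + (0 : ℝ) • e k) := by
      simpa using (hh.smooth.differentiable (by simp) ξ).hasFDerivAt
    exact h1.comp_hasDerivAt (0 : ℝ) (hasDerivAt_line ξ (e k))
  have hfd : ∀ k ξ, fderiv ℝ (g k) ξ (e k) = phase t (t • v) ξ *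
      (Complex.I * (t * (v k - velocity ξ k) ^ 2 : ℝ) * h ξ +
        fderiv ℝ h ξ (e k) * (v k - velocity ξ k : ℝ) -
        ((bracket ξ)⁻¹ * (1 - velocity ξ k ^ 2) : ℝ) * h ξ) := by
    intro k ξ
    rw [fderiv_apply_eq_of_line ξ (e k) ((hg k).smooth.differentiable (by simp) ξ)
      (((hasDerivAt_phase_line t (t • v) ξ (e k)).mul (hhl k ξ)).mul (hwl k ξ))]
    simp only [zero_smul, add_zero, inner_e, PiLp.smul_apply, smul_eq_mul, w,
      Pi.mul_apply]
    push_cast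
    ring
  have hsum : (∫ ξ, (fderiv ℝ (g 0) ξ (e 0) + fderiv ℝ (g 1) ξ (e 1))) = 0 := by
    rw [integral_add ((hg 0).integrable_fderiv _) ((hg 1).integrable_fderiv _),
      (hg 0).integral_fderiv_eq_zero, (hg 1).integral_fderiv_eq_zero, add_zero]
  have hpt : ∀ ξ, fderiv ℝ (g 0) ξ (e 0) + fderiv ℝ (g 1) ξ (e 1) =
      Complex.I * (phase t (t • v) ξ * ((t * ‖v - velocity ξ‖ ^ 2 : ℝ) * h ξ)) +
      phase t (t • v) ξ * (fderiv ℝ h ξ (v - velocity ξ)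
        - (((bracket ξ)⁻¹ + (bracket ξ)⁻¹ ^ 3 : ℝ) : ℂ) * h ξ) := by
    intro ξ
    have e1 : ‖v - velocity ξ‖ ^ 2 = (v 0 - velocity ξ 0) ^ 2 + (v 1 - velocity ξ 1) ^ 2 := by
      rw [EuclideanSpace.norm_sq_eq]; simp [Fin.sum_univ_two]
    have e2 : fderiv ℝ h ξ (v - velocity ξ) = fderiv ℝ h ξ (e 0) * (v 0 - velocity ξ 0 : ℝ) +
        fderiv ℝ h ξ (e 1) * (v 1 - velocity ξ 1 : ℝ) := by
      have : v - velocity ξ = (v 0 - velocity ξ 0) • e 0 + (v 1 - velocity ξ 1) • e 1 := by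
        ext i; fin_cases i <;> simp [e]
      conv_lhs => rw [this]
      rw [map_add, map_smul, map_smul, Complex.real_smul, Complex.real_smul]
      ring
    -- the divergence of the velocity
    have e3 : (bracket ξ)⁻¹ * (1 - velocity ξ 0 ^ 2) + (bracket ξ)⁻¹ * (1 - velocity ξ 1 ^ 2) =
        (bracket ξ)⁻¹ + (bracket ξ)⁻¹ ^ 3 := by
      have := norm_velocity_sq ξ
      rw [EuclideanSpace.norm_sq_eq] at this
      simp only [Fin.sum_univ_two, Real.norm_eq_abs, sq_abs] at this
      linear_combination -(bracket ξ)⁻¹ * this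
    rw [hfd, hfd, e1, e2, ← e3]
    push_cast
    ring
  have hz : DecayC1 0 fun ξ => ((t * ‖v - velocity ξ‖ ^ 2 : ℝ) : ℂ) := by
    have := (DecayC1.const (t : ℂ)).mul (((hw 0).mul (hw 0)).add ((hw 1).mul (hw 1)))
    refine (congrArg (DecayC1 0) ?_).mp this
    ext ξ
    rw [EuclideanSpace.norm_sq_eq]
    simp [Fin.sum_univ_two, w]
    left; ring
  have i1 : Integrable fun ξ => Complex.I *
      (phase t (t • v) ξ * ((t * ‖v - velocity ξ‖ ^ 2 : ℝ) * h ξ)) :=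
    ((DecayC1.phase t (t • v)).mul (hz.mul hh)).integrable.const_mul _
  have i2 : Integrable fun ξ => phase t (t • v) ξ * (fderiv ℝ h ξ (v - velocity ξ)
        - (((bracket ξ)⁻¹ + (bracket ξ)⁻¹ ^ 3 : ℝ) : ℂ) * h ξ) := by
    refine ((((hg 0).integrable_fderiv (e 0)).add ((hg 1).integrable_fderiv (e 1))).sub
      i1).congr (Eventually.of_forall fun ξ => ?_)
    simp only [Pi.sub_apply, Pi.add_apply]
    rw [hpt]; ring
  simp only [hpt] at hsum
  rw [integral_add i1 i2, integral_const_mul] at hsum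
  linear_combination (-Complex.I) * hsum +
    (∫ ξ, phase t (t • v) ξ * ((t * ‖v - velocity ξ‖ ^ 2 : ℝ) * h ξ)) * Complex.I_sq

/-! ### The regularised amplitudes -/

lemma DecayC1.inv_one_add {f : R2 → ℝ} (hf : DecayC1 0 fun ξ => (f ξ : ℂ)) (h0 : ∀ ξ, 0 ≤ f ξ) :
    DecayC1 0 fun ξ => (((1 + f ξ)⁻¹ : ℝ) : ℂ) := by
  obtain ⟨C, hC⟩ := hf.bound
  have hne : ∀ ξ, (1 + (f ξ : ℂ)) ≠ 0 := fun ξ => by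
    have : (1 + f ξ) ≠ 0 := by linarith [h0 ξ]
    exact_mod_cast this
  have hn : ∀ ξ, ‖(1 + (f ξ : ℂ))⁻¹‖ ≤ 1 := fun ξ => by
    have : (1 + (f ξ : ℂ)) = ((1 + f ξ : ℝ) : ℂ) := by push_cast; ring
    rw [this, norm_inv, Complex.norm_real, Real.norm_eq_abs, abs_of_pos (by linarith [h0 ξ])]
    exact inv_le_one_of_one_le₀ (by linarith [h0 ξ])
  have heq : (fun ξ => (((1 + f ξ)⁻¹ : ℝ) : ℂ)) = fun ξ => (1 + (f ξ : ℂ))⁻¹ := by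
    ext ξ; push_cast; ring
  have hs : ContDiff ℝ ∞ fun ξ => 1 + (f ξ : ℂ) := contDiff_const.add hf.smooth
  rw [heq]
  refine ⟨hs.inv hne, max 1 C, fun ξ => ⟨?_, ?_⟩⟩
  · simpa using Or.inl (hn ξ)
  · have hd := (hs.differentiable (by simp) ξ).hasFDerivAt
    have h1 : HasFDerivAt (fun ξ => (1 + (f ξ : ℂ))⁻¹)
        (-((1 + (f ξ : ℂ)) ^ 2)⁻¹ • fderiv ℝ (fun ξ => 1 + (f ξ : ℂ)) ξ) ξ :=
      ((hasDerivAt_inv (hne ξ)).hasFDerivAt.restrictScalars ℝ).comp ξ hd |>.congr_fderiv (by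
        ext u; simp [mul_comm])
    rw [h1.fderiv, norm_smul, norm_neg, norm_inv, norm_pow, ← inv_pow, ← norm_inv,
      fderiv_const_add]
    have h2 := (hC ξ).2
    simp only [pow_zero, mul_one] at h2 ⊢
    calc _ ≤ 1 ^ 2 * C := by gcongr; exact hn ξ
      _ ≤ max 1 C := by simp

/-- The pointwise bound on the amplitude left by two integrations by parts. Here `α = ⟨ξ⟩⁻¹`,
`y = p·w`, `z = |w|²` and `θ = (1 + tz)⁻¹`, with `p` the group velocity and `w = v - p`. -/
lemma amplitude_bound {α y z t θ : ℝ} (hα : 0 < α) (hα1 : α ≤ 1) (hy : y ^ 2 ≤ z) (ht : 0 < t)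
    (hθ : θ * (1 + t * z) = 1) :
    (1 + |(4 * t * θ * α * (z - y ^ 2) - 4 * α * y) - (α + α ^ 3)|) *
      (1 + |2 * t * θ * α * (z - y ^ 2) - 4 * α * y - (α + α ^ 3)|) +
      |2 * t * ((2 * t * θ ^ 2 * α * (z - y ^ 2)) * α * (z - y ^ 2)
          + θ * (-(α ^ 2 * y)) * (z - y ^ 2)
          + θ * α * (-(2 * α * (z - y ^ 2)) - 2 * y * (α * (z - y ^ 2) - α ^ 3 * y)))
        - 4 * (-(α ^ 2 * y) * y + α * (α * (z - y ^ 2) - α ^ 3 * y))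
        - (-(α ^ 2 * y) + 3 * α ^ 2 * (-(α ^ 2 * y)))| ≤ 100 * (1 + z) := by
  have hz : 0 ≤ z := (sq_nonneg y).trans hy
  have hθ0 : 0 < θ := pos_of_mul_pos_left (hθ ▸ one_pos) (by positivity)
  have hs0 : 0 ≤ t * θ * (z - y ^ 2) := mul_nonneg (by positivity) (by linarith)
  have hs1 : t * θ * (z - y ^ 2) ≤ 1 := by
    nlinarith [mul_nonneg (mul_pos ht hθ0).le (sq_nonneg y)]
  have hr0 : 0 ≤ t * θ * y ^ 2 := by positivity
  have hr1 : t * θ * y ^ 2 ≤ 1 := by nlinarith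
  obtain ⟨s, hs⟩ : ∃ s, s = t * θ * (z - y ^ 2) := ⟨_, rfl⟩
  obtain ⟨r, hr⟩ : ∃ r, r = t * θ * y ^ 2 := ⟨_, rfl⟩
  rw [← hs] at hs0 hs1
  rw [← hr] at hr0 hr1
  have hya : |y| ≤ (1 + z) / 2 := by
    rw [abs_le]; constructor <;> nlinarith [sq_nonneg (y - 1), sq_nonneg (y + 1)]
  have hy0 := abs_nonneg y
  have hsq : |y| ^ 2 ≤ z := by rwa [sq_abs]
  have a2 : α ^ 2 ≤ 1 := pow_le_one₀ hα.le hα1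
  have a3 : α ^ 3 ≤ 1 := pow_le_one₀ hα.le hα1
  have a4 : α ^ 4 ≤ 1 := pow_le_one₀ hα.le hα1
  have hb : ∀ c x : ℝ, 0 ≤ c → c ≤ 1 → |c * x| ≤ |x| := fun c x h0 h1 => by
    rw [abs_mul, abs_of_nonneg h0]
    exact mul_le_of_le_one_left (abs_nonneg _) h1
  have e1 : (4 * t * θ * α * (z - y ^ 2) - 4 * α * y) - (α + α ^ 3) =
      4 * (α * s) - 4 * (α * y) - (α + α ^ 3) := by rw [hs]; ring
  have e2 : 2 * t * θ * α * (z - y ^ 2) - 4 * α * y - (α + α ^ 3) =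
      2 * (α * s) - 4 * (α * y) - (α + α ^ 3) := by rw [hs]; ring
  have e3 : 2 * t * ((2 * t * θ ^ 2 * α * (z - y ^ 2)) * α * (z - y ^ 2)
          + θ * (-(α ^ 2 * y)) * (z - y ^ 2)
          + θ * α * (-(2 * α * (z - y ^ 2)) - 2 * y * (α * (z - y ^ 2) - α ^ 3 * y)))
        - 4 * (-(α ^ 2 * y) * y + α * (α * (z - y ^ 2) - α ^ 3 * y))
        - (-(α ^ 2 * y) + 3 * α ^ 2 * (-(α ^ 2 * y))) =
      4 * ((α ^ 2 * s) * s) - 6 * ((α ^ 2 * s) * y) - 4 * (α ^ 2 * s) + 4 * (α ^ 4 * r)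
        + 4 * (α ^ 2 * y ^ 2) - 4 * (α ^ 2 * (z - y ^ 2)) + 4 * (α ^ 4 * y) + α ^ 2 * y
        + 3 * (α ^ 4 * y) := by rw [hs, hr]; ring
  have b1 := abs_le.1 (hb α y hα.le hα1)
  have b2 := abs_le.1 (hb (α ^ 2) y (by positivity) a2)
  have b4 := abs_le.1 (hb (α ^ 4) y (by positivity) a4)
  have c1 : 0 ≤ α * s := by positivity
  have c1' : α * s ≤ 1 := mul_le_one₀ hα1 hs0 hs1
  have c2 : 0 ≤ α ^ 2 * s := by positivity
  have c2' : α ^ 2 * s ≤ 1 := mul_le_one₀ a2 hs0 hs1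
  have c3 : 0 ≤ (α ^ 2 * s) * s := by positivity
  have c3' : (α ^ 2 * s) * s ≤ 1 := mul_le_one₀ c2' hs0 hs1
  have b5 := abs_le.1 (hb (α ^ 2 * s) y c2 c2')
  have c4 : 0 ≤ α ^ 4 * r := by positivity
  have c4' : α ^ 4 * r ≤ 1 := mul_le_one₀ a4 hr0 hr1
  have c5 : 0 ≤ α ^ 2 * y ^ 2 := by positivity
  have c5' : α ^ 2 * y ^ 2 ≤ z := (mul_le_of_le_one_left (sq_nonneg y) a2).trans hy
  have c6 : 0 ≤ α ^ 2 * (z - y ^ 2) := mul_nonneg (by positivity) (by linarith)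
  have c6' : α ^ 2 * (z - y ^ 2) ≤ z :=
    (mul_le_of_le_one_left (by linarith) a2).trans (by linarith [sq_nonneg y])
  have d3 : 0 < α ^ 3 := by positivity
  have f1 : |4 * (α * s) - 4 * (α * y) - (α + α ^ 3)| ≤ 6 + 4 * |y| := by
    rw [abs_le]; constructor <;> linarith
  have f2 : |2 * (α * s) - 4 * (α * y) - (α + α ^ 3)| ≤ 4 + 4 * |y| := by
    rw [abs_le]; constructor <;> linarith
  rw [e1, e2, e3]
  have f3 : |4 * ((α ^ 2 * s) * s) - 6 * ((α ^ 2 * s) * y) - 4 * (α ^ 2 * s) + 4 * (α ^ 4 * r)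
        + 4 * (α ^ 2 * y ^ 2) - 4 * (α ^ 2 * (z - y ^ 2)) + 4 * (α ^ 4 * y) + α ^ 2 * y
        + 3 * (α ^ 4 * y)| ≤ 12 + 14 * |y| + 8 * z := by
    rw [abs_le]; constructor <;> linarith
  have f4 : (1 + |4 * (α * s) - 4 * (α * y) - (α + α ^ 3)|) *
      (1 + |2 * (α * s) - 4 * (α * y) - (α + α ^ 3)|) ≤ (7 + 4 * |y|) * (5 + 4 * |y|) := by
    apply mul_le_mul <;> linarith [abs_nonneg (2 * (α * s) - 4 * (α * y) - (α + α ^ 3))]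
  have f5 : (7 + 4 * |y|) * (5 + 4 * |y|) = 35 + 48 * |y| + 16 * |y| ^ 2 := by ring
  linarith

section Amplitude

variable (t : ℝ) (v : R2)

/-- `z = |v - ξ/⟨ξ⟩|²`, the square of the gradient of the phase `v·ξ - ⟨ξ⟩`. -/
noncomputable def gradSq (ξ : R2) : ℝ := ‖v - velocity ξ‖ ^ 2

/-- `y = (ξ/⟨ξ⟩)·(v - ξ/⟨ξ⟩)`. -/
noncomputable def gradDot (ξ : R2) : ℝ := inner ℝ (velocity ξ) (v - velocity ξ)

/-- `θ = (1 + t|v - ξ/⟨ξ⟩|²)⁻¹`. It is of size one only within `t^{-1/2}` of the stationary point. -/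
noncomputable def damp (ξ : R2) : ℝ := (1 + t * gradSq v ξ)⁻¹

/-- The function `β` for which one integration by parts turns the amplitude `⟨ξ⟩⁻⁴` into
`θ⟨ξ⟩⁻⁴(1 + iβ)`. -/
noncomputable def corr (ξ : R2) : ℝ :=
  2 * t * (damp t v ξ * (bracket ξ)⁻¹ * (gradSq v ξ - gradDot v ξ ^ 2))
    - 4 * ((bracket ξ)⁻¹ * gradDot v ξ) - ((bracket ξ)⁻¹ + (bracket ξ)⁻¹ ^ 3)

lemma gradDot_sq_le (ξ : R2) : gradDot v ξ ^ 2 ≤ gradSq v ξ := by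
  have h := abs_real_inner_le_norm (velocity ξ) (v - velocity ξ)
  have h2 : ‖velocity ξ‖ * ‖v - velocity ξ‖ ≤ 1 * ‖v - velocity ξ‖ := by
    gcongr; exact norm_velocity_le_one ξ
  rw [gradDot, gradSq, ← sq_abs]
  rw [one_mul] at h2
  exact pow_le_pow_left₀ (abs_nonneg _) (h.trans h2) 2

lemma decayC1_coord (k : Fin 2) : DecayC1 0 fun ξ => ((v k - velocity ξ k : ℝ) : ℂ) := by
  have := (DecayC1.const (v k : ℂ)).add
      ((DecayC1.const (-1)).mul (DecayC1.velocity_apply k))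
  refine (congrArg (DecayC1 0) ?_).mp this
  ext ξ; simp; ring

lemma decayC1_gradSq : DecayC1 0 fun ξ => ((gradSq v ξ : ℝ) : ℂ) := by
  have := ((decayC1_coord v 0).mul (decayC1_coord v 0)).add
    ((decayC1_coord v 1).mul (decayC1_coord v 1))
  refine (congrArg (DecayC1 0) ?_).mp this
  ext ξ
  rw [gradSq, EuclideanSpace.norm_sq_eq]
  simp [Fin.sum_univ_two]
  ring

lemma decayC1_gradDot : DecayC1 0 fun ξ => ((gradDot v ξ : ℝ) : ℂ) := by
  have := ((DecayC1.velocity_apply 0).mul (decayC1_coord v 0)).add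
    ((DecayC1.velocity_apply 1).mul (decayC1_coord v 1))
  refine (congrArg (DecayC1 0) ?_).mp this
  ext ξ
  simp [gradDot, PiLp.inner_apply, Fin.sum_univ_two]
  ring

lemma decayC1_damp (ht : 0 < t) : DecayC1 0 fun ξ => ((damp t v ξ : ℝ) : ℂ) := by
  refine DecayC1.inv_one_add (f := fun ξ => t * gradSq v ξ) ?_ fun ξ => ?_
  · have := (DecayC1.const (t : ℂ)).mul (decayC1_gradSq v)
    refine (congrArg (DecayC1 0) ?_).mp this
    ext ξ; simp
  · exact mul_nonneg ht.le (sq_nonneg _)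

end Amplitude

lemma DecayC1.mono {m n : ℕ} (hmn : m ≤ n) {h : R2 → ℂ} (hh : DecayC1 n h) : DecayC1 m h := by
  obtain ⟨C, hC⟩ := hh.bound
  have key : ∀ ξ : R2, C * (bracket ξ)⁻¹ ^ n ≤ |C| * (bracket ξ)⁻¹ ^ m := fun ξ => by
    have h0 := inv_pos.2 (bracket_pos ξ)
    exact mul_le_mul (le_abs_self C) (pow_le_pow_of_le_one h0.le (inv_bracket_le_one ξ) hmn)
      (by positivity) (abs_nonneg _)
  exact ⟨hh.smooth, |C|, fun ξ => ⟨(hC ξ).1.trans (key ξ), (hC ξ).2.trans (key ξ)⟩⟩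

lemma DecayC1.pow {n : ℕ} {h : R2 → ℂ} (hh : DecayC1 n h) (k : ℕ) :
    DecayC1 (k * n) fun ξ => h ξ ^ k := by
  induction k with
  | zero => simpa using DecayC1.const 1
  | succ k ih => simpa [pow_succ, add_mul] using ih.mul hh

lemma decayC1_corr (t : ℝ) (ht : 0 < t) (v : R2) : DecayC1 0 fun ξ => ((corr t v ξ : ℝ) : ℂ) := by
  have a := DecayC1.invBracket.mono zero_le_one
  have h1 := (DecayC1.const (2 * t)).mul (((decayC1_damp t v ht).mul a).mul
    ((decayC1_gradSq v).add ((DecayC1.const (-1)).mul ((decayC1_gradDot v).pow 2))))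
  have h2 := (DecayC1.const (-4)).mul (a.mul (decayC1_gradDot v))
  have h3 := (DecayC1.const (-1)).mul (a.add (a.pow 3))
  refine (congrArg (DecayC1 0) ?_).mp ((h1.add h2).add h3)
  ext ξ
  simp [corr]
  ring

/-! The derivatives of `z`, `y`, `θ` and `⟨ξ⟩⁻¹` along the gradient `v - ξ/⟨ξ⟩` of the phase are again
polynomials in these functions. -/

section Derivatives

variable (t : ℝ) (v ξ : R2)

lemma hasDerivAt_gradSq_line : HasDerivAt (fun s : ℝ => gradSq v (ξ + s • (v - velocity ξ)))
    (-(2 * (bracket ξ)⁻¹ * (gradSq v ξ - gradDot v ξ ^ 2))) 0 := by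
  have h := ((hasDerivAt_velocity_line ξ (v - velocity ξ)).const_sub v).norm_sq
  refine h.congr_deriv ?_
  simp only [zero_smul, add_zero, inner_neg_right, inner_smul_right, inner_sub_right, gradSq,
    gradDot]
  rw [← inner_sub_right, ← inner_sub_right, real_inner_self_eq_norm_sq,
    real_inner_comm (velocity ξ)]
  ring

lemma hasDerivAt_gradDot_line : HasDerivAt (fun s : ℝ => gradDot v (ξ + s • (v - velocity ξ)))
    ((bracket ξ)⁻¹ * (gradSq v ξ - gradDot v ξ ^ 2) - (bracket ξ)⁻¹ ^ 3 * gradDot v ξ) 0 := by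
  have h0 := hasDerivAt_velocity_line ξ (v - velocity ξ)
  have h := h0.inner ℝ (h0.const_sub v)
  refine h.congr_deriv ?_
  have hn := norm_velocity_sq ξ
  rw [gradSq, gradDot]
  obtain ⟨w, hw⟩ : ∃ w, w = v - velocity ξ := ⟨_, rfl⟩
  simp only [zero_smul, add_zero, ← hw]
  simp only [inner_neg_right, inner_smul_right, inner_sub_right, inner_smul_left, inner_sub_left,
    real_inner_self_eq_norm_sq, RCLike.conj_to_real]
  rw [hn]
  ring

lemma hasDerivAt_damp_line (ht : 0 < t) :
    HasDerivAt (fun s : ℝ => damp t v (ξ + s • (v - velocity ξ)))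
    (2 * t * damp t v ξ ^ 2 * (bracket ξ)⁻¹ * (gradSq v ξ - gradDot v ξ ^ 2)) 0 := by
  have hz : 0 ≤ gradSq v ξ := sq_nonneg _
  have h := (((hasDerivAt_gradSq_line v ξ).const_mul t).const_add 1).fun_inv
    (by simp only [zero_smul, add_zero]; positivity)
  refine h.congr_deriv ?_
  simp only [zero_smul, add_zero, damp]
  field_simp

lemma hasDerivAt_invBracket_grad :
    HasDerivAt (fun s : ℝ => (bracket (ξ + s • (v - velocity ξ)))⁻¹)
      (-((bracket ξ)⁻¹ ^ 2 * gradDot v ξ)) 0 :=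
  hasDerivAt_invBracket_line ξ (v - velocity ξ)

end Derivatives

/-- One integration by parts, in the form used twice: an amplitude `(1 + t|w|²)h` is replaced with
`h + i(w·∇h + h div w)`. -/
lemma integral_phase_ibp (t : ℝ) (v : R2) {h : R2 → ℂ} (hh : DecayC1 4 h) :
    ∫ ξ, phase t (t • v) ξ * ((1 + t * gradSq v ξ : ℝ) * h ξ) =
      ∫ ξ, phase t (t • v) ξ * (h ξ + Complex.I * (fderiv ℝ h ξ (v - velocity ξ)
        - (((bracket ξ)⁻¹ + (bracket ξ)⁻¹ ^ 3 : ℝ) : ℂ) * h ξ)) := by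
  have i0 : Integrable fun ξ => phase t (t • v) ξ * h ξ :=
    ((DecayC1.phase t (t • v)).mul hh).integrable
  have i1 : Integrable fun ξ => phase t (t • v) ξ * ((t * gradSq v ξ : ℝ) * h ξ) := by
    have hz : DecayC1 0 fun ξ => ((t * gradSq v ξ : ℝ) : ℂ) := by
      have := (DecayC1.const (t : ℂ)).mul (decayC1_gradSq v)
      refine (congrArg (DecayC1 0) ?_).mp this
      ext ξ; simp
    exact ((DecayC1.phase t (t • v)).mul (hz.mul hh)).integrable
  have i2 : Integrable fun ξ => phase t (t • v) ξ * (Complex.I *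
      (fderiv ℝ h ξ (v - velocity ξ)
        - (((bracket ξ)⁻¹ + (bracket ξ)⁻¹ ^ 3 : ℝ) : ℂ) * h ξ)) := by
    have hk : ∀ k, Integrable fun ξ => phase t (t • v) ξ *
        (((v k - velocity ξ k : ℝ) : ℂ) * fderiv ℝ h ξ (e k)) := fun k => by
      obtain ⟨C, hC⟩ := (decayC1_coord v k).bound
      have hm := ((contDiff_phase t (t • v)).continuous).aestronglyMeasurable (μ := volume)
      refine ((hh.integrable_fderiv (e k)).norm.const_mul C).mono'
        (hm.mul ((decayC1_coord v k).smooth.continuous.aestronglyMeasurable.mul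
          (hh.integrable_fderiv (e k)).1)) (Eventually.of_forall fun ξ => ?_)
      rw [norm_mul, norm_phase, one_mul, norm_mul]
      have := (hC ξ).1
      simp only [pow_zero, mul_one] at this
      gcongr
    have i3 : Integrable fun ξ => phase t (t • v) ξ *
        ((((bracket ξ)⁻¹ + (bracket ξ)⁻¹ ^ 3 : ℝ) : ℂ) * h ξ) := by
      have a := DecayC1.invBracket.mono zero_le_one
      have := ((DecayC1.phase t (t • v)).mul ((a.add (a.pow 3)).mul hh)).integrable
      refine this.congr (Eventually.of_forall fun ξ => ?_)
      simp
    refine (((hk 0).add (hk 1)).sub i3).const_mul Complex.I |>.congr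
      (Eventually.of_forall fun ξ => ?_)
    have e2 : fderiv ℝ h ξ (v - velocity ξ) = fderiv ℝ h ξ (e 0) * (v 0 - velocity ξ 0 : ℝ) +
        fderiv ℝ h ξ (e 1) * (v 1 - velocity ξ 1 : ℝ) := by
      have : v - velocity ξ = (v 0 - velocity ξ 0) • e 0 + (v 1 - velocity ξ 1) • e 1 := by
        ext i; fin_cases i <;> simp [e]
      conv_lhs => rw [this]
      rw [map_add, map_smul, map_smul, Complex.real_smul, Complex.real_smul]
      ring
    simp only [Pi.sub_apply, Pi.add_apply]
    rw [e2]; ring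
  have key := integral_phase_mul_normSq t v hh
  rw [← integral_const_mul] at key
  have l : ∀ ξ, phase t (t • v) ξ * ((1 + t * gradSq v ξ : ℝ) * h ξ) =
      phase t (t • v) ξ * h ξ + phase t (t • v) ξ * ((t * gradSq v ξ : ℝ) * h ξ) := fun ξ => by
    push_cast; ring
  have r : ∀ ξ, phase t (t • v) ξ * (h ξ + Complex.I * (fderiv ℝ h ξ (v - velocity ξ)
        - (((bracket ξ)⁻¹ + (bracket ξ)⁻¹ ^ 3 : ℝ) : ℂ) * h ξ)) =
      phase t (t • v) ξ * h ξ + phase t (t • v) ξ * (Complex.I *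
      (fderiv ℝ h ξ (v - velocity ξ)
        - (((bracket ξ)⁻¹ + (bracket ξ)⁻¹ ^ 3 : ℝ) : ℂ) * h ξ)) := fun ξ => by ring
  simp only [l, r]
  rw [integral_add i0 i1, integral_add i0 i2]
  congr 1
  refine Eq.trans key ?_
  congr 1; ext ξ; ring

/-! ### The dispersive estimate for the kernel -/

lemma damp_mul {t : ℝ} (ht : 0 < t) (v ξ : R2) : damp t v ξ * (1 + t * gradSq v ξ) = 1 := by
  have hz : 0 ≤ gradSq v ξ := sq_nonneg _
  exact inv_mul_cancel₀ (by positivity)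

/-- The dispersive estimate for the kernel: `∫ e^{i(x·ξ - t⟨ξ⟩)} ⟨ξ⟩⁻⁴ dξ = O(1/t)`, uniformly in
`x`. -/
theorem exists_kernel_bound : ∃ C : ℝ, 0 < C ∧ ∀ t : ℝ, 0 < t → ∀ x : R2,
    ‖∫ ξ, phase t x ξ * (((bracket ξ)⁻¹ ^ 4 : ℝ) : ℂ)‖ ≤ C / t := by
  obtain ⟨C₀, hC₀, hW⟩ := exists_lintegral_weight_le
  set C₁ := ∫ ξ : R2, (bracket ξ)⁻¹ ^ 4 with hC₁
  have hC₁0 : 0 ≤ C₁ := integral_nonneg fun ξ => by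
    have := bracket_pos ξ
    positivity
  refine ⟨100 * (C₀ + C₁), by positivity, fun t ht x => ?_⟩
  obtain ⟨v, rfl⟩ : ∃ v : R2, x = t • v := ⟨t⁻¹ • x, by rw [smul_inv_smul₀ ht.ne']⟩
  -- `h0` and `h1` are the amplitudes to which the first and the second integration by parts apply:
  -- dividing `⟨ξ⟩⁻⁴` by `1 + tz` gives `h0`, and dividing the result of the first one gives `h1`
  let h0 : R2 → ℂ := fun ξ => ((damp t v ξ * (bracket ξ)⁻¹ ^ 4 : ℝ) : ℂ)
  let h1 : R2 → ℂ := fun ξ => ((damp t v ξ ^ 2 * (bracket ξ)⁻¹ ^ 4 : ℝ) : ℂ) *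
    (1 + Complex.I * (corr t v ξ : ℂ))
  have d0 : DecayC1 4 h0 := by
    have := (decayC1_damp t v ht).mul (DecayC1.invBracket.pow 4)
    refine (congrArg (DecayC1 4) ?_).mp this
    ext ξ; simp [h0]
  have d1 : DecayC1 4 h1 := by
    have := (((decayC1_damp t v ht).pow 2).mul (DecayC1.invBracket.pow 4)).mul
      ((DecayC1.const 1).add ((DecayC1.const Complex.I).mul (decayC1_corr t ht v)))
    refine (congrArg (DecayC1 4) ?_).mp this
    ext ξ; simp [h1]
  have f0 : ∀ ξ, fderiv ℝ h0 ξ (v - velocity ξ) = ((damp t v ξ * (bracket ξ)⁻¹ ^ 4 *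
      (2 * t * (damp t v ξ * (bracket ξ)⁻¹ * (gradSq v ξ - gradDot v ξ ^ 2))
        - 4 * ((bracket ξ)⁻¹ * gradDot v ξ)) : ℝ) : ℂ) := by
    intro ξ
    rw [fderiv_apply_eq_of_line ξ _ (d0.smooth.differentiable (by simp) ξ)
      (((hasDerivAt_damp_line t v ξ ht).mul ((hasDerivAt_invBracket_grad v ξ).pow 4)).ofReal_comp)]
    congr 1
    simp only [zero_smul, add_zero, Pi.pow_apply]
    push_cast
    ring
  have s0 : (∫ ξ, phase t (t • v) ξ * (((bracket ξ)⁻¹ ^ 4 : ℝ) : ℂ)) =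
      ∫ ξ, phase t (t • v) ξ * ((1 + t * gradSq v ξ : ℝ) * h0 ξ) := by
    congr 1; ext ξ
    rw [← Complex.ofReal_mul]
    congr 2
    linear_combination -(bracket ξ)⁻¹ ^ 4 * damp_mul ht v ξ
  have s1 : (∫ ξ, phase t (t • v) ξ * (h0 ξ + Complex.I * (fderiv ℝ h0 ξ (v - velocity ξ)
        - (((bracket ξ)⁻¹ + (bracket ξ)⁻¹ ^ 3 : ℝ) : ℂ) * h0 ξ))) =
      ∫ ξ, phase t (t • v) ξ * ((1 + t * gradSq v ξ : ℝ) * h1 ξ) := by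
    congr 1; ext ξ
    congr 1
    have hd : (damp t v ξ : ℂ) * ((1 + t * gradSq v ξ : ℝ) : ℂ) = 1 := by
      exact_mod_cast damp_mul ht v ξ
    rw [f0]
    simp only [h0, h1, corr]
    push_cast at hd ⊢
    linear_combination (-(damp t v ξ * ((bracket ξ : ℂ)⁻¹ ^ 4)) *
      (1 + Complex.I * (2 * t * (damp t v ξ * (bracket ξ : ℂ)⁻¹ *
        (gradSq v ξ - gradDot v ξ ^ 2)) - 4 * ((bracket ξ : ℂ)⁻¹ * gradDot v ξ) -
        ((bracket ξ : ℂ)⁻¹ + (bracket ξ : ℂ)⁻¹ ^ 3)))) * hd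
  rw [s0, integral_phase_ibp t v d0, s1, integral_phase_ibp t v d1]
  have bound : ∀ ξ, ‖phase t (t • v) ξ * (h1 ξ + Complex.I * (fderiv ℝ h1 ξ (v - velocity ξ)
        - (((bracket ξ)⁻¹ + (bracket ξ)⁻¹ ^ 3 : ℝ) : ℂ) * h1 ξ))‖ ≤
      100 * ((bracket ξ)⁻¹ ^ 4 * damp t v ξ ^ 2 + (bracket ξ)⁻¹ ^ 4 * t⁻¹) := by
    intro ξ
    have hα := inv_pos.2 (bracket_pos ξ)
    have hα1 := inv_bracket_le_one ξ
    have hA := amplitude_bound hα hα1 (gradDot_sq_le v ξ) ht (damp_mul ht v ξ)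
    have hz : 0 ≤ gradSq v ξ := sq_nonneg _
    have hθ : 0 < damp t v ξ := inv_pos.2 (by positivity)
    have hcorr := ((((((hasDerivAt_damp_line t v ξ ht).mul (hasDerivAt_invBracket_grad v ξ)).mul
      ((hasDerivAt_gradSq_line v ξ).sub ((hasDerivAt_gradDot_line v ξ).pow 2))).const_mul
      (2 * t)).sub (((hasDerivAt_invBracket_grad v ξ).mul
      (hasDerivAt_gradDot_line v ξ)).const_mul 4)).sub ((hasDerivAt_invBracket_grad v ξ).add
      ((hasDerivAt_invBracket_grad v ξ).pow 3)))
    have hpow := ((hasDerivAt_damp_line t v ξ ht).pow 2).mul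
      ((hasDerivAt_invBracket_grad v ξ).pow 4)
    have f1 := fderiv_apply_eq_of_line ξ (v - velocity ξ)
      (d1.smooth.differentiable (by simp) ξ) (hpow.ofReal_comp.mul
        ((hcorr.ofReal_comp.const_mul Complex.I).const_add 1))
    rw [norm_mul, norm_phase, one_mul, f1]
    simp only [zero_smul, add_zero, Pi.pow_apply, Pi.mul_apply, Pi.sub_apply]
    simp only [h1, corr]
    have hdm := damp_mul ht v ξ
    generalize (bracket ξ)⁻¹ = α at *
    generalize gradSq v ξ = z at *
    generalize gradDot v ξ = y at *
    generalize damp t v ξ = θ at *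
    set m := (4 * t * θ * α * (z - y ^ 2) - 4 * α * y) - (α + α ^ 3) with hm
    set b := 2 * t * θ * α * (z - y ^ 2) - 4 * α * y - (α + α ^ 3) with hb
    set c := 2 * t * ((2 * t * θ ^ 2 * α * (z - y ^ 2)) * α * (z - y ^ 2)
          + θ * (-(α ^ 2 * y)) * (z - y ^ 2)
          + θ * α * (-(2 * α * (z - y ^ 2)) - 2 * y * (α * (z - y ^ 2) - α ^ 3 * y)))
        - 4 * (-(α ^ 2 * y) * y + α * (α * (z - y ^ 2) - α ^ 3 * y))
        - (-(α ^ 2 * y) + 3 * α ^ 2 * (-(α ^ 2 * y))) with hc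
    have hn : ‖((θ ^ 2 * α ^ 4 : ℝ) : ℂ) * ((1 + Complex.I * (m : ℂ)) * (1 + Complex.I * (b : ℂ))
        - (c : ℂ))‖ ≤ θ ^ 2 * α ^ 4 * (100 * (1 + z)) := by
      rw [norm_mul, Complex.norm_real, Real.norm_eq_abs, abs_of_nonneg (by positivity)]
      refine mul_le_mul_of_nonneg_left (le_trans ?_ hA) (by positivity)
      have hI : ∀ r : ℝ, ‖1 + Complex.I * (r : ℂ)‖ ≤ 1 + |r| := fun r => by
        refine (norm_add_le _ _).trans ?_
        rw [norm_one, norm_mul, Complex.norm_I, one_mul, Complex.norm_real, Real.norm_eq_abs]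
      refine (norm_sub_le _ _).trans ?_
      rw [norm_mul, Complex.norm_real, Real.norm_eq_abs]
      gcongr
      · exact hI m
      · exact hI b
    refine le_trans (le_of_eq ?_) (hn.trans ?_)
    · congr 1
      have hcC := congrArg Complex.ofReal hc
      simp only [hm, hb, hc]
      push_cast at hcC ⊢
      linear_combination (((θ : ℂ) ^ 2 * (α : ℂ) ^ 4) * (c : ℂ)) * Complex.I_sq
        - ((θ : ℂ) ^ 2 * (α : ℂ) ^ 4) * (Complex.I ^ 2 + 1) * hcC
    -- `θ²(1 + z) ≤ θ² + t⁻¹`, as `θ t z ≤ 1` and `θ ≤ 1`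
    · have h4 : θ * (θ * (t * z)) ≤ 1 := by nlinarith
      have h5 : θ ^ 2 * z ≤ t⁻¹ := by
        rw [← one_div, le_div_iff₀ ht]; nlinarith
      have h6 : 0 ≤ α ^ 4 := by positivity
      nlinarith
  have hdc : Continuous fun ξ => damp t v ξ := by
    have := Complex.continuous_re.comp (decayC1_damp t v ht).smooth.continuous
    exact this
  have hbc : Continuous fun ξ : R2 => (bracket ξ)⁻¹ :=
    contDiff_bracket.continuous.inv₀ fun ξ => (bracket_pos ξ).ne'
  have hpos : ∀ ξ : R2, 0 ≤ (bracket ξ)⁻¹ ^ 4 * damp t v ξ ^ 2 := fun ξ => by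
    have := bracket_pos ξ
    positivity
  have hi : Integrable fun ξ : R2 => (bracket ξ)⁻¹ ^ 4 * damp t v ξ ^ 2 := by
    refine ⟨((hbc.pow 4).mul (hdc.pow 2)).aestronglyMeasurable, ?_⟩
    rw [hasFiniteIntegral_iff_ofReal (Eventually.of_forall hpos)]
    exact (hW t ht v).trans_lt ENNReal.ofReal_lt_top
  have hle : ∫ ξ : R2, (bracket ξ)⁻¹ ^ 4 * damp t v ξ ^ 2 ≤ C₀ / t := by
    rw [integral_eq_lintegral_of_nonneg_ae (Eventually.of_forall hpos) hi.1]
    exact ENNReal.toReal_le_of_le_ofReal (by positivity) (hW t ht v)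
  have hi2 := integrable_invBracket_pow.mul_const t⁻¹
  refine (norm_integral_le_of_norm_le ((hi.add hi2).const_mul 100)
    (Eventually.of_forall bound)).trans ?_
  rw [integral_const_mul]
  simp only [Pi.add_apply]
  rw [integral_add hi hi2, integral_mul_const, ← hC₁, mul_div_assoc, add_div]
  have : C₁ * t⁻¹ = C₁ / t := (div_eq_mul_inv _ _).symm
  linarith

/-! ### Symbols -/

/-- The symbol `⟨2πξ⟩` of `⟨D⟩` for the Fourier transform with kernel `e^{-2πi x·ξ}`. -/
noncomputable def jap (ξ : R2) : ℝ := bracket ((2 * Real.pi) • ξ)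

/-- The group velocity at the frequency `2πξ`. -/
noncomputable def vel (ξ : R2) : R2 := velocity ((2 * Real.pi) • ξ)

lemma jap_pos (ξ : R2) : 0 < jap ξ := bracket_pos _

lemma one_le_jap (ξ : R2) : 1 ≤ jap ξ := one_le_bracket _

lemma contDiff_jap : ContDiff ℝ ∞ jap := contDiff_bracket.comp (contDiff_const_smul _)

lemma continuous_jap : Continuous jap := contDiff_jap.continuous

lemma contDiff_vel : ContDiff ℝ ∞ vel := contDiff_velocity.comp (contDiff_const_smul _)

lemma hasDerivAt_jap_line (ξ u : R2) :
    HasDerivAt (fun s : ℝ => jap (ξ + s • u)) (2 * Real.pi * inner ℝ (vel ξ) u) 0 := by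
  have h := hasDerivAt_bracket_line ((2 * Real.pi) • ξ) ((2 * Real.pi) • u)
  rw [inner_smul_right] at h
  refine h.congr_of_eventuallyEq (Eventually.of_forall fun s => ?_)
  simp only [jap, smul_add, smul_comm s]

lemma hasDerivAt_vel_line (ξ u : R2) :
    HasDerivAt (fun s : ℝ => vel (ξ + s • u))
      ((2 * Real.pi * (jap ξ)⁻¹) • (u - inner ℝ (vel ξ) u • vel ξ)) 0 := by
  have h := hasDerivAt_velocity_line ((2 * Real.pi) • ξ) ((2 * Real.pi) • u)
  refine (h.congr_of_eventuallyEq (Eventually.of_forall fun s => ?_)).congr_deriv ?_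
  · simp only [vel, smul_add, smul_comm s]
  · simp only [vel, jap, inner_smul_right, smul_sub, smul_smul]
    congr 1 <;> congr 1 <;> ring

/-- Smooth functions whose partial derivatives up to order `m` are bounded by `C⟨2πξ⟩ʳ`. -/
def Symb : ℕ → ℕ → ℝ → (R2 → ℂ) → Prop
  | 0, r, C, n => ContDiff ℝ ∞ n ∧ ∀ ξ, ‖n ξ‖ ≤ C * jap ξ ^ r
  | m + 1, r, C, n => (ContDiff ℝ ∞ n ∧ ∀ ξ, ‖n ξ‖ ≤ C * jap ξ ^ r) ∧
      ∀ k, Symb m r C fun ξ => fderiv ℝ n ξ (e k)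

namespace Symb

lemma base : ∀ {m r : ℕ} {C : ℝ} {n : R2 → ℂ}, Symb m r C n →
    ContDiff ℝ ∞ n ∧ ∀ ξ, ‖n ξ‖ ≤ C * jap ξ ^ r
  | 0, _, _, _, h => h
  | _ + 1, _, _, _, h => h.1

lemma smooth {m r : ℕ} {C : ℝ} {n : R2 → ℂ} (h : Symb m r C n) : ContDiff ℝ ∞ n := h.base.1

lemma bound {m r : ℕ} {C : ℝ} {n : R2 → ℂ} (h : Symb m r C n) (ξ : R2) :
    ‖n ξ‖ ≤ C * jap ξ ^ r := h.base.2 ξ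

lemma nonneg {m r : ℕ} {C : ℝ} {n : R2 → ℂ} (h : Symb m r C n) : 0 ≤ C := by
  have := (norm_nonneg _).trans (h.bound 0)
  exact nonneg_of_mul_nonneg_left this (pow_pos (jap_pos 0) r)

lemma pred {m r : ℕ} {C : ℝ} {n : R2 → ℂ} (h : Symb (m + 1) r C n) : Symb m r C n := by
  induction m generalizing n with
  | zero => exact h.1
  | succ m ih => exact ⟨h.1, fun k => ih (h.2 k)⟩

lemma mono {m r r' : ℕ} {C C' : ℝ} {n : R2 → ℂ} (h : Symb m r C n) (hr : r ≤ r') (hC : C ≤ C') :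
    Symb m r' C' n := by
  have key : ∀ ξ, C * jap ξ ^ r ≤ C' * jap ξ ^ r' := fun ξ =>
    mul_le_mul hC (pow_le_pow_right₀ (one_le_jap ξ) hr) (pow_nonneg (jap_pos ξ).le _)
      (h.nonneg.trans hC)
  induction m generalizing n with
  | zero => exact ⟨h.1, fun ξ => (h.2 ξ).trans (key ξ)⟩
  | succ m ih => exact ⟨⟨h.1.1, fun ξ => (h.1.2 ξ).trans (key ξ)⟩, fun k => ih (h.2 k)⟩

lemma add {m r : ℕ} {C C' : ℝ} {n n' : R2 → ℂ} (h : Symb m r C n) (h' : Symb m r C' n') :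
    Symb m r (C + C') fun ξ => n ξ + n' ξ := by
  have key : ∀ {n n' : R2 → ℂ}, (ContDiff ℝ ∞ n ∧ ∀ ξ, ‖n ξ‖ ≤ C * jap ξ ^ r) →
      (ContDiff ℝ ∞ n' ∧ ∀ ξ, ‖n' ξ‖ ≤ C' * jap ξ ^ r) →
      (ContDiff ℝ ∞ fun ξ => n ξ + n' ξ) ∧ ∀ ξ, ‖n ξ + n' ξ‖ ≤ (C + C') * jap ξ ^ r := by
    intro n n' h h'
    refine ⟨h.1.add h'.1, fun ξ => (norm_add_le _ _).trans ?_⟩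
    rw [add_mul]
    exact add_le_add (h.2 ξ) (h'.2 ξ)
  induction m generalizing n n' with
  | zero => exact key h h'
  | succ m ih =>
    refine ⟨key h.1 h'.1, fun k => ?_⟩
    have := ih (h.2 k) (h'.2 k)
    refine (congrArg (Symb m r (C + C')) ?_).mp this
    ext ξ
    rw [fderiv_fun_add (h.1.1.differentiable (by simp) ξ) (h'.1.1.differentiable (by simp) ξ)]
    rfl

lemma mul {m r r' : ℕ} {C C' : ℝ} {n n' : R2 → ℂ} (h : Symb m r C n) (h' : Symb m r' C' n') :
    Symb m (r + r') (2 ^ m * (C * C')) fun ξ => n ξ * n' ξ := by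
  have hC := h.nonneg
  have hC' := h'.nonneg
  have key : ∀ {n n' : R2 → ℂ} {m : ℕ}, (ContDiff ℝ ∞ n ∧ ∀ ξ, ‖n ξ‖ ≤ C * jap ξ ^ r) →
      (ContDiff ℝ ∞ n' ∧ ∀ ξ, ‖n' ξ‖ ≤ C' * jap ξ ^ r') →
      (ContDiff ℝ ∞ fun ξ => n ξ * n' ξ) ∧
        ∀ ξ, ‖n ξ * n' ξ‖ ≤ 2 ^ m * (C * C') * jap ξ ^ (r + r') := by
    intro n n' m h h'
    refine ⟨h.1.mul h'.1, fun ξ => ?_⟩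
    have hp := pow_nonneg (jap_pos ξ).le r
    have hp' := pow_nonneg (jap_pos ξ).le r'
    rw [norm_mul, pow_add]
    calc _ ≤ (C * jap ξ ^ r) * (C' * jap ξ ^ r') :=
          mul_le_mul (h.2 ξ) (h'.2 ξ) (norm_nonneg _) (by positivity)
      _ = 1 * (C * C') * (jap ξ ^ r * jap ξ ^ r') := by ring
      _ ≤ _ := by gcongr; exact one_le_pow₀ one_le_two
  induction m generalizing n n' with
  | zero => exact key h h'
  | succ m ih =>
    refine ⟨key h.1 h'.1, fun k => ?_⟩
    have := (ih (h.2 k) h'.pred).add (ih h.pred (h'.2 k))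
    rw [← two_mul, ← mul_assoc, ← pow_succ'] at this
    refine (congrArg (Symb m (r + r') (2 ^ (m + 1) * (C * C'))) ?_).mp this
    ext ξ
    rw [fderiv_fun_mul (h.1.1.differentiable (by simp) ξ) (h'.1.1.differentiable (by simp) ξ)]
    simp
    ring

lemma const (m : ℕ) (c : ℂ) : Symb m 0 ‖c‖ fun _ => c := by
  have hz : ∀ m, ∀ C ≥ 0, Symb m 0 C fun _ => (0 : ℂ) := fun m => by
    induction m with
    | zero => exact fun C hC => ⟨contDiff_const, by simpa⟩
    | succ m ih => exact fun C hC => ⟨⟨contDiff_const, by simpa⟩, fun k => by simpa using ih C hC⟩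
  cases m with
  | zero => exact ⟨contDiff_const, by simp⟩
  | succ m =>
    exact ⟨⟨contDiff_const, by simp⟩, fun k => by simpa using hz m _ (norm_nonneg c)⟩

lemma succ_of {m r : ℕ} {C : ℝ} {n : R2 → ℂ} {d : Fin 2 → R2 → ℂ} {D : Fin 2 → ℝ}
    (hn : ContDiff ℝ ∞ n) (hb : ∀ ξ, ‖n ξ‖ ≤ C * jap ξ ^ r)
    (hd : ∀ k ξ, HasDerivAt (fun s : ℝ => n (ξ + s • e k)) (d k ξ) 0)
    (h : ∀ k, Symb m r (D k) (d k)) : Symb (m + 1) r (C + D 0 + D 1) n := by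
  have h0 := (h 0).nonneg
  have h1 := (h 1).nonneg
  have hC : 0 ≤ C := by
    have := (norm_nonneg _).trans (hb 0)
    exact nonneg_of_mul_nonneg_left this (pow_pos (jap_pos 0) r)
  refine ⟨⟨hn, fun ξ => (hb ξ).trans ?_⟩, fun k => ?_⟩
  · have := pow_pos (jap_pos ξ) r
    gcongr; linarith
  · have : (fun ξ => fderiv ℝ n ξ (e k)) = d k := by
      ext ξ
      exact fderiv_apply_eq_of_line ξ (e k) (hn.differentiable (by simp) ξ) (hd k ξ)
    rw [this]
    refine (h k).mono le_rfl ?_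
    fin_cases k <;> simp <;> linarith

end Symb

lemma norm_vel_apply_le (ξ : R2) (k : Fin 2) : ‖((vel ξ k : ℝ) : ℂ)‖ ≤ 1 := by
  rw [Complex.norm_real]
  exact (PiLp.norm_apply_le (vel ξ) k).trans (norm_velocity_le_one _)

lemma norm_inv_jap_le (ξ : R2) : ‖(((jap ξ)⁻¹ : ℝ) : ℂ)‖ ≤ 1 := by
  rw [Complex.norm_real, norm_inv, Real.norm_eq_abs, abs_of_pos (jap_pos ξ)]
  exact inv_le_one_of_one_le₀ (one_le_jap ξ)

lemma hasDerivAt_vel_apply_line (ξ : R2) (j k : Fin 2) :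
    HasDerivAt (fun s : ℝ => ((vel (ξ + s • e k) j : ℝ) : ℂ))
      ((2 * Real.pi : ℝ) * (((if j = k then 1 else 0 : ℝ) : ℂ) * (((jap ξ)⁻¹ : ℝ) : ℂ)
        + (-1) * ((((jap ξ)⁻¹ : ℝ) : ℂ) * (((vel ξ k : ℝ) : ℂ) * ((vel ξ j : ℝ) : ℂ))))) 0 := by
  have h1 := ((EuclideanSpace.proj (𝕜 := ℝ) j : R2 →L[ℝ] ℝ).hasFDerivAt.comp_hasDerivAt (0 : ℝ)
      (hasDerivAt_vel_line ξ (e k))).ofReal_comp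
  refine h1.congr_deriv ?_
  simp [e, EuclideanSpace.inner_single_right]
  split_ifs <;> simp <;> ring

lemma hasDerivAt_inv_jap_line (ξ : R2) (k : Fin 2) :
    HasDerivAt (fun s : ℝ => (((jap (ξ + s • e k))⁻¹ : ℝ) : ℂ))
      ((-(2 * Real.pi) : ℝ) * ((((jap ξ)⁻¹ : ℝ) : ℂ) *
        ((((jap ξ)⁻¹ : ℝ) : ℂ) * ((vel ξ k : ℝ) : ℂ)))) 0 := by
  have h1 := ((hasDerivAt_jap_line ξ (e k)).fun_inv
    (by simpa using (jap_pos ξ).ne')).ofReal_comp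
  refine h1.congr_deriv ?_
  have := jap_pos ξ
  simp [inner_e]
  field_simp

lemma contDiff_vel_apply (j : Fin 2) : ContDiff ℝ ∞ fun ξ => ((vel ξ j : ℝ) : ℂ) :=
  Complex.ofRealCLM.contDiff.comp
    ((EuclideanSpace.proj (𝕜 := ℝ) j : R2 →L[ℝ] ℝ).contDiff.comp contDiff_vel)

lemma contDiff_inv_jap : ContDiff ℝ ∞ fun ξ => (((jap ξ)⁻¹ : ℝ) : ℂ) :=
  Complex.ofRealCLM.contDiff.comp (contDiff_jap.inv fun ξ => (jap_pos ξ).ne')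

/-- The components of the group velocity, and `⟨2πξ⟩⁻¹`, are symbols of order zero: the algebra
they generate is closed under differentiation. -/
lemma exists_symb_vel (m : ℕ) : (∀ j, ∃ C, Symb m 0 C fun ξ => ((vel ξ j : ℝ) : ℂ)) ∧
    ∃ C, Symb m 0 C fun ξ => (((jap ξ)⁻¹ : ℝ) : ℂ) := by
  induction m with
  | zero =>
    exact ⟨fun j => ⟨1, contDiff_vel_apply j, fun ξ => by simpa using norm_vel_apply_le ξ j⟩,
      1, contDiff_inv_jap, fun ξ => by simpa using norm_inv_jap_le ξ⟩
  | succ m ih =>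
    obtain ⟨h1, C, hC⟩ := ih
    choose D hD using h1
    refine ⟨fun j => ⟨_, Symb.succ_of (C := 1) (contDiff_vel_apply j)
      (fun ξ => by simpa using norm_vel_apply_le ξ j)
      (fun k ξ => hasDerivAt_vel_apply_line ξ j k) (fun k =>
        (Symb.const m _).mul (((Symb.const m _).mul hC).add ((Symb.const m (-1)).mul
          (hC.mul ((hD k).mul (hD j))))))⟩, ⟨_, Symb.succ_of (C := 1) contDiff_inv_jap
      (fun ξ => by simpa using norm_inv_jap_le ξ)
      (fun k ξ => hasDerivAt_inv_jap_line ξ k) (fun k => (Symb.const m _).mul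
        (hC.mul (hC.mul (hD k))))⟩⟩

lemma exists_symb_jap (m : ℕ) : ∃ C, Symb m 1 C fun ξ => ((jap ξ : ℝ) : ℂ) := by
  have hs : ContDiff ℝ ∞ fun ξ => ((jap ξ : ℝ) : ℂ) := Complex.ofRealCLM.contDiff.comp contDiff_jap
  have hb : ∀ ξ, ‖((jap ξ : ℝ) : ℂ)‖ ≤ 1 * jap ξ ^ 1 := fun ξ => by
    simp [abs_of_pos (jap_pos ξ)]
  cases m with
  | zero => exact ⟨1, hs, hb⟩
  | succ m =>
    choose D hD using (exists_symb_vel m).1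
    exact ⟨_, Symb.succ_of hs hb (fun k ξ => (hasDerivAt_jap_line ξ (e k)).ofReal_comp) fun k => by
      have := ((Symb.const m ((2 * Real.pi : ℝ) : ℂ)).mul (hD k)).mono zero_le_one le_rfl
      refine (congrArg (Symb m 1 _) ?_).mp this
      ext ξ; simp [inner_e]⟩

lemma exists_symb_jap_pow (m r : ℕ) : ∃ C, Symb m r C fun ξ => ((jap ξ ^ r : ℝ) : ℂ) := by
  induction r with
  | zero => exact ⟨_, by simpa using Symb.const m 1⟩
  | succ r ih =>
    obtain ⟨C, hC⟩ := ih
    obtain ⟨D, hD⟩ := exists_symb_jap m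
    exact ⟨_, by simpa [pow_succ] using hC.mul hD⟩

/-- `2πξ_k = ⟨2πξ⟩ · p_k` is a symbol of order one. -/
lemma exists_symb_coord (m : ℕ) (k : Fin 2) :
    ∃ C, Symb m 1 C fun ξ => ((2 * Real.pi * ξ k : ℝ) : ℂ) := by
  obtain ⟨C, hC⟩ := exists_symb_jap m
  obtain ⟨D, hD⟩ := (exists_symb_vel m).1 k
  refine ⟨_, (congrArg (Symb m 1 _) ?_).mp (hC.mul hD)⟩
  ext ξ
  have := jap_pos ξ
  have h : jap ξ * vel ξ k = 2 * Real.pi * ξ k := by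
    simp only [vel, velocity, PiLp.smul_apply, smul_eq_mul]
    change jap ξ * ((jap ξ)⁻¹ * _) = _
    field_simp
  rw [← h]; push_cast; ring

/-- The symbols `σʲ e^{-σ⟨2πξ⟩}` are of order zero, uniformly in `σ ≥ 0`. -/
lemma exists_symb_exp (m j : ℕ) : ∃ C, ∀ σ : ℝ, 0 ≤ σ →
    Symb m 0 C fun ξ => ((σ ^ j * Real.exp (-(σ * jap ξ)) : ℝ) : ℂ) := by
  have hs : ∀ (j : ℕ) (σ : ℝ), ContDiff ℝ ∞ fun ξ => ((σ ^ j * Real.exp (-(σ * jap ξ)) : ℝ) : ℂ) :=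
    fun j σ => Complex.ofRealCLM.contDiff.comp
      (contDiff_const.mul (contDiff_const.mul contDiff_jap).neg.exp)
  have hb : ∀ (j : ℕ) (σ : ℝ), 0 ≤ σ → ∀ ξ,
      ‖((σ ^ j * Real.exp (-(σ * jap ξ)) : ℝ) : ℂ)‖ ≤ j.factorial * jap ξ ^ 0 := by
    intro j σ hσ ξ
    rw [Complex.norm_real, Real.norm_eq_abs, abs_of_nonneg (by positivity), pow_zero, mul_one]
    have h1 : σ ^ j ≤ (σ * jap ξ) ^ j :=
      pow_le_pow_left₀ hσ (le_mul_of_one_le_right hσ (one_le_jap ξ)) j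
    have h2 := Real.pow_div_factorial_le_exp (σ * jap ξ) (mul_nonneg hσ (jap_pos ξ).le) j
    rw [div_le_iff₀ (by positivity)] at h2
    rw [Real.exp_neg, ← div_eq_mul_inv, div_le_iff₀ (Real.exp_pos _)]
    linarith
  induction m generalizing j with
  | zero => exact ⟨_, fun σ hσ => ⟨hs j σ, hb j σ hσ⟩⟩
  | succ m ih =>
    obtain ⟨C, hC⟩ := ih (j + 1)
    choose D hD using (exists_symb_vel m).1
    let K : Fin 2 → ℝ := fun k => 2 ^ m * (2 ^ m * (‖((-(2 * Real.pi) : ℝ) : ℂ)‖ * D k) * C)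
    refine ⟨j.factorial + K 0 + K 1, fun σ hσ => Symb.succ_of (D := K) (hs j σ) (hb j σ hσ)
      (fun k ξ => ((((hasDerivAt_jap_line ξ (e k)).const_mul σ).neg.exp).const_mul
        (σ ^ j)).ofReal_comp) fun k => ?_⟩
    have := ((Symb.const m ((-(2 * Real.pi) : ℝ) : ℂ)).mul (hD k)).mul (hC σ hσ)
    refine (congrArg (Symb m 0 _) ?_).mp this
    ext ξ
    simp [inner_e]
    ring

/-! ### Weighted Sobolev classes in frequency -/

/-- The weighted bound `‖⟨2πξ⟩ʷ F‖_{L²} ≤ c`. -/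
structure WBound (w : ℕ) (c : ℝ) (F : R2 → ℂ) : Prop where
  nonneg : 0 ≤ c
  memLp : MemLp F 2 volume
  le : eLpNorm (fun ξ => ((jap ξ ^ w : ℝ) : ℂ) * F ξ) 2 volume ≤ ENNReal.ofReal c

lemma continuous_jap_pow (w : ℕ) : Continuous fun ξ => ((jap ξ ^ w : ℝ) : ℂ) :=
  Complex.continuous_ofReal.comp (continuous_jap.pow w)

lemma norm_jap_pow (w : ℕ) (ξ : R2) : ‖((jap ξ ^ w : ℝ) : ℂ)‖ = jap ξ ^ w := by
  rw [Complex.norm_real, Real.norm_eq_abs, abs_of_pos (pow_pos (jap_pos ξ) w)]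

namespace WBound

variable {w : ℕ} {c c' : ℝ} {F G : R2 → ℂ}

lemma memLp_weight (h : WBound w c F) : MemLp (fun ξ => ((jap ξ ^ w : ℝ) : ℂ) * F ξ) 2 volume :=
  ⟨(continuous_jap_pow w).aestronglyMeasurable.mul h.memLp.1,
    h.le.trans_lt ENNReal.ofReal_lt_top⟩

/-- A function that is dominated pointwise by a weighted one. -/
lemma of_le {w' : ℕ} {C : ℝ} (h : WBound w' c F) (hC : 0 ≤ C) (hG : AEStronglyMeasurable G volume)
    (hle : ∀ᵐ ξ, jap ξ ^ w * ‖G ξ‖ ≤ C * (jap ξ ^ w' * ‖F ξ‖)) : WBound w (C * c) G := by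
  have h1 : ∀ᵐ ξ, ‖((jap ξ ^ w : ℝ) : ℂ) * G ξ‖ ≤ C * ‖((jap ξ ^ w' : ℝ) : ℂ) * F ξ‖ := by
    filter_upwards [hle] with ξ hξ
    rwa [norm_mul, norm_mul, norm_jap_pow, norm_jap_pow]
  have h2 : eLpNorm (fun ξ => ((jap ξ ^ w : ℝ) : ℂ) * G ξ) 2 volume ≤ ENNReal.ofReal (C * c) := by
    rw [ENNReal.ofReal_mul hC]
    refine (eLpNorm_le_mul_eLpNorm_of_ae_le_mul h1 2).trans ?_
    gcongr
    exact h.le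
  refine ⟨mul_nonneg hC h.nonneg, ⟨hG, ?_⟩, h2⟩
  refine (eLpNorm_mono_ae ?_).trans_lt (h2.trans_lt ENNReal.ofReal_lt_top)
  refine Eventually.of_forall fun ξ => ?_
  rw [norm_mul, norm_jap_pow]
  exact le_mul_of_one_le_left (norm_nonneg _) (one_le_pow₀ (one_le_jap ξ))

lemma mono {w' : ℕ} (h : WBound w c F) (hw : w' ≤ w) (hc : c ≤ c') : WBound w' c' F := by
  have h1 : WBound w' (1 * c) F := h.of_le zero_le_one h.memLp.1 <|
    Eventually.of_forall fun ξ => by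
      rw [one_mul]
      gcongr
      exact one_le_jap ξ
  exact ⟨h.nonneg.trans hc, h.memLp, h1.le.trans (ENNReal.ofReal_le_ofReal (by linarith))⟩

lemma add (hF : WBound w c F) (hG : WBound w c' G) : WBound w (c + c') fun ξ => F ξ + G ξ := by
  refine ⟨add_nonneg hF.nonneg hG.nonneg, hF.memLp.add hG.memLp, ?_⟩
  rw [ENNReal.ofReal_add hF.nonneg hG.nonneg]
  refine le_trans (le_of_eq ?_) ((eLpNorm_add_le hF.memLp_weight.1 hG.memLp_weight.1
    (by norm_num)).trans (add_le_add hF.le hG.le))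
  congr 1; ext ξ; simp [mul_add]

lemma eLpNorm_le (h : WBound w c F) : eLpNorm F 2 volume ≤ ENNReal.ofReal c := by
  have := (h.mono (Nat.zero_le w) le_rfl).le
  simpa using this

/-- Multiplication by a function of size `⟨2πξ⟩ʳ` costs `r` powers of the weight. -/
lemma symb_mul {r : ℕ} {C : ℝ} {n : R2 → ℂ} (h : WBound (w + r) c F) (hC : 0 ≤ C)
    (hn : Continuous n) (hb : ∀ ξ, ‖n ξ‖ ≤ C * jap ξ ^ r) :
    WBound w (C * c) fun ξ => n ξ * F ξ := by
  refine h.of_le hC (hn.aestronglyMeasurable.mul h.memLp.1) (Eventually.of_forall fun ξ => ?_)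
  have hp := pow_pos (jap_pos ξ) w
  rw [norm_mul, pow_add]
  calc jap ξ ^ w * (‖n ξ‖ * ‖F ξ‖) ≤ jap ξ ^ w * ((C * jap ξ ^ r) * ‖F ξ‖) := by
        gcongr; exact hb ξ
    _ = _ := by ring

end WBound

/-- Functions with `m` weak derivatives whose derivatives up to order `m` satisfy the bound
`WBound w c`. -/
def Reg : ℕ → ℕ → ℝ → (R2 → ℂ) → Prop
  | 0, w, c, F => WBound w c F
  | m + 1, w, c, F => WBound w c F ∧ ∀ k, ∃ G, HasWeakDeriv k F G ∧ Reg m w c G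

lemma HasWeakDeriv.add {k : Fin 2} {F G F' G' : R2 → ℂ} (h : HasWeakDeriv k F G)
    (h' : HasWeakDeriv k F' G') (hF : LocallyIntegrable F) (hG : LocallyIntegrable G)
    (hF' : LocallyIntegrable F') (hG' : LocallyIntegrable G') :
    HasWeakDeriv k (fun x => F x + F' x) (fun x => G x + G' x) := by
  intro φ h1 h2
  have hd : Continuous fun x => fderiv ℝ φ x (e k) :=
    (h1.continuous_fderiv (by simp)).clm_apply continuous_const
  have c1 : HasCompactSupport fun x => fderiv ℝ φ x (e k) := h2.fderiv_apply ℝ (e k)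
  simp only [add_mul]
  rw [integral_add (integrable_mul_of_compactSupport hF hd c1)
    (integrable_mul_of_compactSupport hF' hd c1),
    integral_add (integrable_mul_of_compactSupport hG h1.continuous h2)
    (integrable_mul_of_compactSupport hG' h1.continuous h2), h φ h1 h2, h' φ h1 h2]
  ring

namespace Reg

lemma base : ∀ {m w : ℕ} {c : ℝ} {F : R2 → ℂ}, Reg m w c F → WBound w c F
  | 0, _, _, _, h => h
  | _ + 1, _, _, _, h => h.1

lemma pred {m w : ℕ} {c : ℝ} {F : R2 → ℂ} (h : Reg (m + 1) w c F) : Reg m w c F := by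
  induction m generalizing F with
  | zero => exact h.1
  | succ m ih =>
    refine ⟨h.1, fun k => ?_⟩
    obtain ⟨G, h1, h2⟩ := h.2 k
    exact ⟨G, h1, ih h2⟩

lemma mono {m w w' : ℕ} {c c' : ℝ} {F : R2 → ℂ} (h : Reg m w c F) (hw : w' ≤ w) (hc : c ≤ c') :
    Reg m w' c' F := by
  induction m generalizing F with
  | zero => exact WBound.mono h hw hc
  | succ m ih =>
    refine ⟨h.1.mono hw hc, fun k => ?_⟩
    obtain ⟨G, h1, h2⟩ := h.2 k
    exact ⟨G, h1, ih h2⟩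

lemma locallyIntegrable {m w : ℕ} {c : ℝ} {F : R2 → ℂ} (h : Reg m w c F) : LocallyIntegrable F :=
  memLp_locallyIntegrable h.base.memLp

lemma add {m w : ℕ} {c c' : ℝ} {F F' : R2 → ℂ} (h : Reg m w c F) (h' : Reg m w c' F') :
    Reg m w (c + c') fun ξ => F ξ + F' ξ := by
  induction m generalizing F F' with
  | zero => exact WBound.add h h'
  | succ m ih =>
    refine ⟨h.1.add h'.1, fun k => ?_⟩
    obtain ⟨G, h1, h2⟩ := h.2 k
    obtain ⟨G', h1', h2'⟩ := h'.2 k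
    exact ⟨_, h1.add h1' h.locallyIntegrable h2.locallyIntegrable h'.locallyIntegrable
      h2'.locallyIntegrable, ih h2 h2'⟩

lemma symb_mul {m w r : ℕ} {c C : ℝ} {F n : R2 → ℂ} (h : Reg m (w + r) c F)
    (hn : Symb m r C n) : Reg m w (2 ^ m * (C * c)) fun ξ => n ξ * F ξ := by
  have h0 := mul_nonneg hn.nonneg h.base.nonneg
  have key : ∀ m : ℕ, C * c ≤ 2 ^ m * (C * c) := fun m =>
    le_mul_of_one_le_left h0 (one_le_pow₀ one_le_two)
  induction m generalizing F n with
  | zero => exact (WBound.symb_mul h hn.nonneg hn.smooth.continuous hn.bound).mono le_rfl (key 0)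
  | succ m ih =>
    refine ⟨(WBound.symb_mul h.1 hn.nonneg hn.smooth.continuous hn.bound).mono le_rfl (key _),
      fun k => ?_⟩
    obtain ⟨G, h1, h2⟩ := h.2 k
    refine ⟨_, h1.smooth_mul h.locallyIntegrable h2.locallyIntegrable hn.smooth, ?_⟩
    have := (ih h.pred (hn.2 k)).add (ih h2 hn.pred)
    rwa [← two_mul, ← mul_assoc, ← pow_succ'] at this

end Reg

/-! ### The dispersive estimate -/

/-- The Cauchy-Schwarz inequality. -/
lemma integral_norm_mul_le {f g : R2 → ℂ} (hf : MemLp f 2 volume) (hg : MemLp g 2 volume) {a b : ℝ}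
    (ha : 0 ≤ a) (hb : 0 ≤ b) (hfa : eLpNorm f 2 volume ≤ ENNReal.ofReal a)
    (hgb : eLpNorm g 2 volume ≤ ENNReal.ofReal b) :
    ∫ x, ‖f x * g x‖ ≤ a * b := by
  have h := eLpNorm_smul_le_mul_eLpNorm (p := 2) (q := 2) (r := 1) hg.1 hf.1
  have h1 : eLpNorm (fun x => f x * g x) 1 volume ≤ ENNReal.ofReal (a * b) := by
    rw [ENNReal.ofReal_mul ha]
    exact h.trans (mul_le_mul' hfa hgb)
  rw [eLpNorm_one_eq_lintegral_enorm] at h1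
  rw [integral_norm_eq_lintegral_enorm (memLp_mul_integrable hf hg).1]
  exact ENNReal.toReal_le_of_le_ofReal (mul_nonneg ha hb) h1

lemma norm_fourierInv_eq (f : L2) : ‖(𝓕⁻ f : L2)‖ = ‖f‖ := by
  rw [← Lp.norm_fourier_eq (𝓕⁻ f), FourierTransform.fourier_fourierInv_eq]

lemma eLpNorm_coe (f : L2) : eLpNorm f 2 volume = ENNReal.ofReal ‖f‖ := by
  rw [Lp.norm_def, ENNReal.ofReal_toReal (Lp.eLpNorm_ne_top f)]

lemma eLpNorm_fourierInv (f : L2) :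
    eLpNorm ((𝓕⁻ f : L2) : R2 → ℂ) 2 volume = eLpNorm f 2 volume := by
  rw [eLpNorm_coe, eLpNorm_coe, norm_fourierInv_eq]

lemma eLpNorm_fourier (f : L2) :
    eLpNorm ((𝓕 f : L2) : R2 → ℂ) 2 volume = eLpNorm f 2 volume := by
  rw [eLpNorm_coe, eLpNorm_coe, Lp.norm_fourier_eq]

lemma memLp_inv_one_add_sq : MemLp (fun x : R2 => (((1 + ‖x‖ ^ 2)⁻¹ : ℝ) : ℂ)) 2 volume := by
  have hc : Continuous fun x : R2 => (((1 + ‖x‖ ^ 2)⁻¹ : ℝ) : ℂ) :=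
    Complex.continuous_ofReal.comp
      ((continuous_const.add (continuous_norm.pow 2)).inv₀ fun x =>
        (show (0 : ℝ) < 1 + ‖x‖ ^ 2 by positivity).ne')
  rw [memLp_two_iff_integrable_sq_norm hc.aestronglyMeasurable]
  refine integrable_invBracket_pow.congr (Eventually.of_forall fun x => ?_)
  simp only [Complex.norm_real, Real.norm_eq_abs, sq_abs]
  rw [← bracket_sq]
  ring

/-- A function of `x` whose Fourier transform has two weak derivatives in `L²` is integrable, since
`⟨x⟩⁻²` is square integrable on the plane. -/
lemma exists_integrable_fourierInv : ∃ C : ℝ, 0 < C ∧ ∀ (c : ℝ) (F : R2 → ℂ), Reg 2 0 c F →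
    ∀ h : MemLp F 2 volume, Integrable ((𝓕⁻ (h.toLp F) : L2) : R2 → ℂ) ∧
      ∫ x, ‖(𝓕⁻ (h.toLp F) : L2) x‖ ≤ C * c := by
  set a := (eLpNorm (fun x : R2 => (((1 + ‖x‖ ^ 2)⁻¹ : ℝ) : ℂ)) 2 volume).toReal with ha
  refine ⟨a * 3 + 1, by positivity, fun c F hF h => ?_⟩
  have hc := hF.base.nonneg
  -- `-4π² x_k²` times the function is the inverse Fourier transform of a second derivative of `F`
  have hk : ∀ k, ∃ V : L2, eLpNorm V 2 volume ≤ ENNReal.ofReal c ∧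
      ∀ᵐ x, V x = -(4 * Real.pi ^ 2) * (x k : ℂ) ^ 2 * (𝓕⁻ (h.toLp F) : L2) x := by
    intro k
    obtain ⟨G, h1, h2⟩ := hF.2 k
    obtain ⟨G', h1', h2'⟩ := h2.2 k
    have m := h2.base.memLp
    have m' := h2'.base.memLp
    have e1 := (hasWeakDeriv_iff_fourierInv (h.toLp F) (m.toLp G)).1
      (h1.congr h.coeFn_toLp.symm m.coeFn_toLp.symm)
    have e2 := (hasWeakDeriv_iff_fourierInv (m.toLp G) (m'.toLp G')).1
      (h1'.congr m.coeFn_toLp.symm m'.coeFn_toLp.symm)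
    refine ⟨𝓕⁻ (m'.toLp G'), ?_, ?_⟩
    · rw [eLpNorm_fourierInv, eLpNorm_congr_ae m'.coeFn_toLp]
      exact h2'.base.eLpNorm_le
    · filter_upwards [e1, e2] with x h3 h4
      rw [h4, h3]
      linear_combination (4 * Real.pi ^ 2 * (x k : ℂ) ^ 2 * (𝓕⁻ (h.toLp F) : L2) x) *
        Complex.I_sq
  obtain ⟨V0, n0, e0⟩ := hk 0
  obtain ⟨V1, n1, e1⟩ := hk 1
  set W : L2 := 𝓕⁻ (h.toLp F) with hW
  have nW : eLpNorm W 2 volume ≤ ENNReal.ofReal c := by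
    rw [hW, eLpNorm_fourierInv, eLpNorm_congr_ae h.coeFn_toLp]
    exact hF.base.eLpNorm_le
  let g : R2 → ℂ := fun x => ((‖W x‖ + ‖V0 x‖ + ‖V1 x‖ : ℝ) : ℂ)
  have m0 : ∀ V : L2, MemLp (fun x => ((‖V x‖ : ℝ) : ℂ)) 2 volume := fun V =>
    (Lp.memLp V).norm.ofReal
  have q0 : ∀ V : L2, eLpNorm (fun x => ((‖V x‖ : ℝ) : ℂ)) 2 volume = eLpNorm V 2 volume :=
    fun V => eLpNorm_congr_norm_ae (Eventually.of_forall fun x => by simp)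
  have hg : g = (fun x => ((‖W x‖ : ℝ) : ℂ)) + (fun x => ((‖V0 x‖ : ℝ) : ℂ)) +
      (fun x => ((‖V1 x‖ : ℝ) : ℂ)) := by
    ext x; simp [g]
  have mg : MemLp g 2 volume := by
    rw [hg]; exact ((m0 W).add (m0 V0)).add (m0 V1)
  have ng : eLpNorm g 2 volume ≤ ENNReal.ofReal (3 * c) := by
    rw [hg, show 3 * c = c + c + c by ring, ENNReal.ofReal_add (by positivity) hc,
      ENNReal.ofReal_add hc hc]
    refine (eLpNorm_add_le ((m0 W).add (m0 V0)).1 (m0 V1).1 (by norm_num)).trans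
      (add_le_add ((eLpNorm_add_le (m0 W).1 (m0 V0).1 (by norm_num)).trans
        (add_le_add ?_ ?_)) ?_)
    · rwa [q0]
    · rwa [q0]
    · rwa [q0]
  have hle : ∀ᵐ x, ‖W x‖ ≤ ‖(((1 + ‖x‖ ^ 2)⁻¹ : ℝ) : ℂ) * g x‖ := by
    filter_upwards [e0, e1] with x h0 h1
    have hx : ‖x‖ ^ 2 = x 0 ^ 2 + x 1 ^ 2 := by
      rw [EuclideanSpace.norm_sq_eq]; simp [Fin.sum_univ_two]
    have hv : ∀ k, ‖-(4 * (Real.pi : ℂ) ^ 2) * (x k : ℂ) ^ 2 * W x‖ =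
        4 * Real.pi ^ 2 * x k ^ 2 * ‖W x‖ := fun k => by
      rw [norm_mul, norm_mul, norm_neg, norm_mul, norm_pow, norm_pow, Complex.norm_real,
        Complex.norm_real, Real.norm_eq_abs, Real.norm_eq_abs, sq_abs, sq_abs]
      simp
    have hpi : 1 ≤ 4 * Real.pi ^ 2 := by nlinarith [Real.pi_gt_three]
    have g1 : (1 + ‖x‖ ^ 2) * ‖W x‖ ≤ ‖W x‖ + ‖V0 x‖ + ‖V1 x‖ := by
      rw [h0, h1, hv, hv, hx]
      have := mul_nonneg (sq_nonneg (x 0)) (norm_nonneg (W x))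
      have := mul_nonneg (sq_nonneg (x 1)) (norm_nonneg (W x))
      nlinarith
    rw [norm_mul, Complex.norm_real, Complex.norm_real, Real.norm_eq_abs, Real.norm_eq_abs,
      abs_of_nonneg (by positivity), abs_of_nonneg (by positivity), ← div_eq_inv_mul,
      le_div_iff₀ (by positivity)]
    linarith
  have hint := (memLp_mul_integrable memLp_inv_one_add_sq mg).norm
  have hWi : Integrable (W : R2 → ℂ) := hint.mono' (Lp.memLp W).1 hle
  refine ⟨hWi, (integral_mono_ae hWi.norm hint hle).trans
    ((integral_norm_mul_le memLp_inv_one_add_sq mg (a := a) (b := 3 * c) ENNReal.toReal_nonneg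
      (by positivity) ?_ ng).trans (by nlinarith))⟩
  rw [ENNReal.ofReal_toReal memLp_inv_one_add_sq.2.ne]

/-- The symbol of `e^{-it⟨D⟩}`. -/
noncomputable def evo (t : ℝ) (ξ : R2) : ℂ := Complex.exp (-(Complex.I * ((t * jap ξ : ℝ) : ℂ)))

lemma norm_evo (t : ℝ) (ξ : R2) : ‖evo t ξ‖ = 1 := by
  rw [evo, ← mul_neg, ← Complex.ofReal_neg, mul_comm, Complex.norm_exp_ofReal_mul_I]

lemma contDiff_evo (t : ℝ) : ContDiff ℝ ∞ (evo t) :=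
  (contDiff_const.mul (Complex.ofRealCLM.contDiff.comp (contDiff_const.mul contDiff_jap))).neg.cexp

lemma memLp_evo_mul (t : ℝ) {F : R2 → ℂ} (hF : MemLp F 2 volume) :
    MemLp (fun ξ => evo t ξ * F ξ) 2 volume :=
  hF.of_le ((contDiff_evo t).continuous.aestronglyMeasurable.mul hF.1)
    (Eventually.of_forall fun ξ => by rw [norm_mul, norm_evo, one_mul])

lemma integrable_inv_jap_pow : Integrable fun ξ : R2 => (jap ξ)⁻¹ ^ 4 := by
  exact integrable_invBracket_pow.comp_smul (R := 2 * Real.pi) (by positivity)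

/-- The kernel bound in the normalisation of `𝓕`. -/
lemma exists_kernel_bound_jap : ∃ C : ℝ, 0 < C ∧ ∀ t : ℝ, 0 < t → ∀ x : R2,
    ‖𝓕⁻ (fun ξ => evo t ξ * (((jap ξ)⁻¹ ^ 4 : ℝ) : ℂ)) x‖ ≤ C / t := by
  obtain ⟨C, hC, hK⟩ := exists_kernel_bound
  refine ⟨((2 * Real.pi) ^ 2)⁻¹ * C, by positivity, fun t ht x => ?_⟩
  have h := Measure.integral_comp_smul (volume : Measure R2)
    (fun ξ => phase t x ξ * (((bracket ξ)⁻¹ ^ 4 : ℝ) : ℂ)) (2 * Real.pi)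
  have e1 : 𝓕⁻ (fun ξ => evo t ξ * (((jap ξ)⁻¹ ^ 4 : ℝ) : ℂ)) x =
      ∫ ξ : R2, phase t x ((2 * Real.pi) • ξ) *
        (((bracket ((2 * Real.pi) • ξ))⁻¹ ^ 4 : ℝ) : ℂ) := by
    rw [Real.fourierInv_eq']
    congr 1; ext ξ
    rw [smul_eq_mul, ← mul_assoc]
    congr 1
    rw [evo, phase, ← Complex.exp_add, inner_smul_right, real_inner_comm x ξ]
    congr 1
    simp only [jap]
    push_cast
    ring
  rw [e1, h, norm_smul, Real.norm_eq_abs, abs_abs, finrank_euclideanSpace, Fintype.card_fin,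
    abs_of_pos (by positivity), mul_div_assoc]
  gcongr
  exact hK t ht x

/-- The dispersive decay `‖e^{-it⟨D⟩} h‖_{L^∞} = O(1/t)` for data `h = 𝓕⁻ F` with `⟨ξ⟩⁴F ∈ H²`. -/
theorem exists_dispersive : ∃ C : ℝ, 0 < C ∧ ∀ (t : ℝ), 0 < t → ∀ (c : ℝ) (F : R2 → ℂ),
    Reg 2 4 c F → ∀ h : MemLp (fun ξ => evo t ξ * F ξ) 2 volume,
      ∀ᵐ x, ‖(𝓕⁻ (h.toLp _) : L2) x‖ ≤ C * c / t := by
  obtain ⟨C₁, hC₁, hL⟩ := exists_integrable_fourierInv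
  obtain ⟨C₂, hC₂, hK⟩ := exists_kernel_bound_jap
  obtain ⟨C₃, hS⟩ := exists_symb_jap_pow 2 4
  have hC₃ := hS.nonneg
  refine ⟨C₂ * (C₁ * (2 ^ 2 * C₃)) + 1, by positivity, fun t ht c F hF h => ?_⟩
  have hc := hF.base.nonneg
  have hR : Reg 2 0 (2 ^ 2 * (C₃ * c)) fun ξ => ((jap ξ ^ 4 : ℝ) : ℂ) * F ξ :=
    Reg.symb_mul (w := 0) (by simpa using hF) hS
  have m := hR.base.memLp
  obtain ⟨hi, hb⟩ := hL _ _ hR m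
  set W : L2 := 𝓕⁻ (m.toLp _) with hW
  have hFW : (fun ξ => ((jap ξ ^ 4 : ℝ) : ℂ) * F ξ) =ᵐ[volume] 𝓕 (W : R2 → ℂ) := by
    have h1 := fourier_toLp_ae_eq hi (Lp.memLp W)
    rw [Lp.toLp_coeFn, hW, FourierTransform.fourier_fourierInv_eq] at h1
    exact m.coeFn_toLp.symm.trans h1
  -- the evolution of `h` is the convolution of `W = 𝓕⁻(⟨2πξ⟩⁴F) ∈ L¹` with the kernel `𝓕⁻ M`
  let M : R2 → ℂ := fun ξ => evo t ξ * (((jap ξ)⁻¹ ^ 4 : ℝ) : ℂ)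
  have hMc : Continuous M := (contDiff_evo t).continuous.mul
    (Complex.continuous_ofReal.comp ((continuous_jap.inv₀ fun ξ => (jap_pos ξ).ne').pow 4))
  have hMi : Integrable M := by
    refine integrable_inv_jap_pow.mono' hMc.aestronglyMeasurable (Eventually.of_forall fun ξ => ?_)
    have := jap_pos ξ
    rw [norm_mul, norm_evo, one_mul, Complex.norm_real, Real.norm_eq_abs,
      abs_of_pos (by positivity)]
  have hcont : Continuous (𝓕 (W : R2 → ℂ)) :=
    VectorFourier.fourierIntegral_continuous Real.continuous_fourierChar
      (by exact continuous_inner) hi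
  have hMF : (fun ξ => evo t ξ * F ξ) =ᵐ[volume] fun ξ => 𝓕 (W : R2 → ℂ) ξ * M ξ := by
    filter_upwards [hFW] with ξ hξ
    have := (jap_pos ξ).ne'
    rw [← hξ]
    simp only [M]
    have h1 : ((jap ξ : ℝ) : ℂ) ≠ 0 := by exact_mod_cast this
    push_cast
    field_simp
  have hint : Integrable fun ξ => 𝓕 (W : R2 → ℂ) ξ * M ξ := by
    refine (hMi.bdd_mul hcont.aestronglyMeasurable
      (c := ∫ x, ‖W x‖) (Eventually.of_forall fun ξ => ?_))
    exact VectorFourier.norm_fourierIntegral_le_integral_norm _ _ _ _ _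
  have hu := fourierInv_toLp_ae_eq (hint.congr hMF.symm) h
  filter_upwards [hu] with x hx
  rw [hx, Real.fourierInv_congr_ae hMF, Real.fourierInv_eq']
  let gx : R2 → ℂ := fun ξ => Complex.exp (↑(2 * Real.pi * inner ℝ ξ x) * Complex.I) * M ξ
  have hgx : Integrable gx := by
    refine hMi.norm.mono' ((Continuous.mul (by fun_prop) hMc).aestronglyMeasurable)
      (Eventually.of_forall fun ξ => ?_)
    rw [norm_mul, Complex.norm_exp_ofReal_mul_I, one_mul]
  have hflip := VectorFourier.integral_fourierIntegral_smul_eq_flip (μ := volume) (ν := volume)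
    (L := innerₗ R2) (f := (W : R2 → ℂ)) (g := gx) Real.continuous_fourierChar
    (by exact continuous_inner) hi hgx
  rw [flip_innerₗ] at hflip
  have e1 : (∫ ξ, Complex.exp (↑(2 * Real.pi * inner ℝ ξ x) * Complex.I) •
      (𝓕 (W : R2 → ℂ) ξ * M ξ)) = ∫ y, W y * 𝓕 gx y := by
    refine Eq.trans ?_ hflip
    congr 1; ext ξ
    simp only [gx, smul_eq_mul]
    change _ = 𝓕 (W : R2 → ℂ) ξ * _
    ring
  have hg : ∀ y, 𝓕 gx y = 𝓕⁻ M (x - y) := by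
    intro y
    rw [Real.fourier_eq', Real.fourierInv_eq']
    congr 1; ext ξ
    simp only [gx, smul_eq_mul]
    rw [← mul_assoc, ← Complex.exp_add, inner_sub_right]
    congr 2
    push_cast
    ring
  rw [e1]
  have hbd : ∀ y, ‖W y * 𝓕 gx y‖ ≤ ‖W y‖ * (C₂ / t) := fun y => by
    rw [norm_mul, hg]
    gcongr
    exact hK t ht _
  refine (norm_integral_le_of_norm_le (hi.norm.mul_const _) (Eventually.of_forall hbd)).trans ?_
  rw [integral_mul_const]
  calc (∫ x, ‖W x‖) * (C₂ / t) ≤ (C₁ * (2 ^ 2 * (C₃ * c))) * (C₂ / t) := by gcongr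
    _ = (C₂ * (C₁ * (2 ^ 2 * C₃))) * c / t := by ring
    _ ≤ _ := by gcongr; linarith

/-! ### Frequency regularity of the profile -/

/-- `⟨x⟩⁻²` -/
noncomputable def invSq (x : R2) : ℝ := (1 + ‖x‖ ^ 2)⁻¹

lemma invSq_den_pos (x : R2) : 0 < 1 + ‖x‖ ^ 2 := by positivity

lemma invSq_pos (x : R2) : 0 < invSq x := inv_pos.2 (invSq_den_pos x)

lemma bracket_sq_mul_invSq (x : R2) : bracket x ^ 2 * invSq x = 1 := by
  rw [bracket_sq, invSq, mul_inv_cancel₀ (invSq_den_pos x).ne']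

lemma contDiff_invSq : ContDiff ℝ ∞ invSq :=
  (contDiff_const.add (contDiff_norm_sq ℝ)).inv fun x => (invSq_den_pos x).ne'

lemma contDiff_coord (j : Fin 2) : ContDiff ℝ ∞ fun x : R2 => x j :=
  (EuclideanSpace.proj (𝕜 := ℝ) j : R2 →L[ℝ] ℝ).contDiff

lemma hasDerivAt_coord_line (x : R2) (j k : Fin 2) :
    HasDerivAt (fun s : ℝ => (x + s • e k) j) (if j = k then 1 else 0) 0 := by
  refine ((EuclideanSpace.proj (𝕜 := ℝ) j : R2 →L[ℝ] ℝ).hasFDerivAt.comp_hasDerivAt (0 : ℝ)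
    (hasDerivAt_line x (e k))).congr_deriv ?_
  simp [e]

lemma hasDerivAt_invSq_line (x : R2) (k : Fin 2) :
    HasDerivAt (fun s : ℝ => invSq (x + s • e k)) (-(2 * (invSq x * (x k * invSq x)))) 0 := by
  have h := ((hasDerivAt_line x (e k)).norm_sq.const_add 1).fun_inv
    (by simpa using (invSq_den_pos x).ne')
  refine h.congr_deriv ?_
  have := invSq_den_pos x
  simp only [zero_smul, add_zero, inner_e, invSq]
  field_simp

lemma coord_sq_le (x : R2) (j : Fin 2) : x j ^ 2 ≤ ‖x‖ ^ 2 := by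
  rw [EuclideanSpace.norm_sq_eq, Fin.sum_univ_two]
  fin_cases j <;> simp <;> positivity

/-- The functions `⟨x⟩⁻²`, `x_j⟨x⟩⁻²` and `x_ix_j⟨x⟩⁻²` are bounded together with their
derivatives: the algebra they generate is closed under differentiation. -/
lemma exists_symb_invSq (m : ℕ) : (∃ C, Symb m 0 C fun x => ((invSq x : ℝ) : ℂ)) ∧
    (∀ j, ∃ C, Symb m 0 C fun x => ((x j * invSq x : ℝ) : ℂ)) ∧
    ∀ i j, ∃ C, Symb m 0 C fun x => ((x i * x j * invSq x : ℝ) : ℂ) := by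
  have s0 : ContDiff ℝ ∞ fun x => ((invSq x : ℝ) : ℂ) :=
    Complex.ofRealCLM.contDiff.comp contDiff_invSq
  have s1 : ∀ j, ContDiff ℝ ∞ fun x => ((x j * invSq x : ℝ) : ℂ) := fun j =>
    Complex.ofRealCLM.contDiff.comp ((contDiff_coord j).mul contDiff_invSq)
  have s2 : ∀ i j, ContDiff ℝ ∞ fun x => ((x i * x j * invSq x : ℝ) : ℂ) := fun i j =>
    Complex.ofRealCLM.contDiff.comp (((contDiff_coord i).mul (contDiff_coord j)).mul contDiff_invSq)
  have b : ∀ (x : R2) (a : ℝ), |a| ≤ 1 + ‖x‖ ^ 2 →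
      ‖((a * invSq x : ℝ) : ℂ)‖ ≤ 1 * jap x ^ 0 := fun x a h => by
    rw [Complex.norm_real, norm_mul, Real.norm_eq_abs, Real.norm_eq_abs,
      abs_of_pos (invSq_pos x), invSq, ← div_eq_mul_inv, div_le_iff₀ (invSq_den_pos x)]
    simpa using h
  have b0 : ∀ x, ‖((invSq x : ℝ) : ℂ)‖ ≤ 1 * jap x ^ 0 := fun x => by
    simpa using b x 1 (by simp)
  have b1 : ∀ j x, ‖((x j * invSq x : ℝ) : ℂ)‖ ≤ 1 * jap x ^ 0 := fun j x => b x _ <| by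
    have := coord_sq_le x j
    exact abs_le.2 ⟨by nlinarith [sq_nonneg (x j + 1)], by nlinarith [sq_nonneg (x j - 1)]⟩
  have b2 : ∀ i j x, ‖((x i * x j * invSq x : ℝ) : ℂ)‖ ≤ 1 * jap x ^ 0 := fun i j x => b x _ <| by
    have h1 := coord_sq_le x j
    have h2 := coord_sq_le x i
    exact abs_le.2 ⟨by nlinarith [sq_nonneg (x i + x j)], by nlinarith [sq_nonneg (x i - x j)]⟩
  induction m with
  | zero => exact ⟨⟨1, s0, b0⟩, fun j => ⟨1, s1 j, b1 j⟩, fun i j => ⟨1, s2 i j, b2 i j⟩⟩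
  | succ m ih =>
    obtain ⟨⟨C, hC⟩, h1, h2⟩ := ih
    choose D hD using h1
    choose E hE using h2
    refine ⟨⟨_, Symb.succ_of s0 b0 (fun k x => (hasDerivAt_invSq_line x k).ofReal_comp)
      fun k => (congrArg (Symb m 0 _) ?_).mp ((Symb.const m (-2)).mul (hC.mul (hD k)))⟩,
      fun j => ⟨_, Symb.succ_of (s1 j) (b1 j) (fun k x =>
        ((hasDerivAt_coord_line x j k).fun_mul (hasDerivAt_invSq_line x k)).ofReal_comp)
      fun k => (congrArg (Symb m 0 _) ?_).mp (((Symb.const m (if j = k then 1 else 0)).mul hC).add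
        ((Symb.const m (-2)).mul ((hD j).mul (hD k))))⟩,
      fun i j => ⟨_, Symb.succ_of (s2 i j) (b2 i j) (fun k x =>
        (((hasDerivAt_coord_line x i k).fun_mul (hasDerivAt_coord_line x j k)).fun_mul
          (hasDerivAt_invSq_line x k)).ofReal_comp)
      fun k => (congrArg (Symb m 0 _) ?_).mp (((Symb.const m (if i = k then 1 else 0)).mul
        (hD j)).add (((Symb.const m (if j = k then 1 else 0)).mul (hD i)).add
        ((Symb.const m (-2)).mul ((hE i j).mul (hD k)))))⟩⟩
    · ext x; push_cast; ring
    · ext x; simp; split_ifs <;> simp <;> ring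
    · ext x; simp; split_ifs <;> push_cast <;> ring

lemma norm_coord_le_jap (ξ : R2) : jap ξ ≤ 1 + ‖((2 * Real.pi * ξ 0 : ℝ) : ℂ)‖ +
    ‖((2 * Real.pi * ξ 1 : ℝ) : ℂ)‖ := by
  rw [Complex.norm_real, Complex.norm_real, Real.norm_eq_abs, Real.norm_eq_abs, jap, bracket]
  refine Real.sqrt_le_iff.2 ⟨by positivity, ?_⟩
  rw [EuclideanSpace.norm_sq_eq, Fin.sum_univ_two]
  simp only [PiLp.smul_apply, smul_eq_mul, Real.norm_eq_abs]
  nlinarith [abs_nonneg (2 * Real.pi * ξ 0), abs_nonneg (2 * Real.pi * ξ 1),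
    mul_nonneg (abs_nonneg (2 * Real.pi * ξ 0)) (abs_nonneg (2 * Real.pi * ξ 1))]

lemma coord_le_jap (ξ : R2) (k : Fin 2) : ‖((2 * Real.pi * ξ k : ℝ) : ℂ)‖ ≤ jap ξ := by
  rw [Complex.norm_real, Real.norm_eq_abs, jap, bracket]
  refine Real.le_sqrt_of_sq_le ?_
  have := coord_sq_le ((2 * Real.pi) • ξ) k
  simp only [PiLp.smul_apply, smul_eq_mul] at this
  rw [sq_abs]
  linarith

/-- Multiplication by a function with bounded derivatives is bounded on `Hⁿ`. -/
lemma exists_mul_bound (n : ℕ) (C : ℝ) : ∃ K : ℝ, 0 ≤ K ∧ ∀ (ψ : R2 → ℂ), Symb n 0 C ψ →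
    ∀ (c : ℝ) (h g : L2), WBound n c (𝓕 h : L2) → g =ᵐ[volume] (fun x => ψ x * h x) →
      WBound n (K * c) (𝓕 g : L2) := by
  induction n with
  | zero =>
    refine ⟨|C|, abs_nonneg C, fun ψ hψ c h g hh hg => ?_⟩
    refine ⟨mul_nonneg (abs_nonneg C) hh.nonneg, Lp.memLp _, ?_⟩
    simp only [pow_zero, Complex.ofReal_one, one_mul]
    rw [eLpNorm_fourier, ENNReal.ofReal_mul (abs_nonneg C)]
    have := hh.eLpNorm_le
    rw [eLpNorm_fourier] at this
    refine (eLpNorm_le_mul_eLpNorm_of_ae_le_mul (g := h) (c := |C|) ?_ 2).trans (by gcongr)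
    filter_upwards [hg] with x hx
    rw [hx, norm_mul]
    gcongr
    simpa using (hψ.2 x).trans (by simpa using le_abs_self C)
  | succ n ih =>
    obtain ⟨K, hK, ih⟩ := ih
    refine ⟨5 * K, by positivity, fun ψ hψ c h g hh hg => ?_⟩
    have hc := hh.nonneg
    have hbase := ih ψ hψ.pred c h g (hh.mono (Nat.le_succ n) le_rfl) hg
    -- the weak derivatives of `ψ h` are products of the same kind
    have key : ∀ k, ∃ V : L2, WBound n (2 * (K * c)) (𝓕 V : L2) ∧
        ∀ᵐ ξ, (𝓕 V : L2) ξ = 2 * Real.pi * Complex.I * (ξ k : ℂ) * (𝓕 g : L2) ξ := by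
      intro k
      have hcont : Continuous fun ξ : R2 => 2 * Real.pi * Complex.I * (ξ k : ℂ) := by fun_prop
      have hB : WBound n (1 * c) fun ξ => 2 * Real.pi * Complex.I * (ξ k : ℂ) * (𝓕 h : L2) ξ := by
        refine hh.symb_mul zero_le_one hcont fun ξ => ?_
        have := coord_le_jap ξ k
        simpa [mul_assoc] using this
      rw [one_mul] at hB
      set h' : L2 := 𝓕⁻ (hB.memLp.toLp _) with hh'
      have ef : (𝓕 h' : L2) = hB.memLp.toLp _ := by
        rw [hh', FourierTransform.fourier_fourierInv_eq]
      have hw : HasWeakDeriv k h h' := by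
        rw [hasWeakDeriv_iff_fourier, ef]
        exact hB.memLp.coeFn_toLp
      have hB' : WBound n c (𝓕 h' : L2) := by
        rw [ef]
        have e1 := hB.memLp.coeFn_toLp
        have := hB.of_le (w := n) (G := (hB.memLp.toLp _ : L2)) zero_le_one (Lp.memLp _).1
          (by filter_upwards [e1] with ξ hξ; rw [hξ, one_mul])
        rwa [one_mul] at this
      have hprod := (hw.smooth_mul (memLp_locallyIntegrable (Lp.memLp _))
        (memLp_locallyIntegrable (Lp.memLp _)) hψ.smooth)
      have m1 : ∀ {ψ : R2 → ℂ} (_ : Symb n 0 C ψ) (v : L2), MemLp (fun x => ψ x * v x) 2 volume :=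
        fun {ψ} hψ v => (Lp.memLp v).of_le_mul (c := C)
          (hψ.smooth.continuous.aestronglyMeasurable.mul (Lp.memLp v).1)
          (Eventually.of_forall fun x => by
            rw [norm_mul]; gcongr; simpa using hψ.bound x)
      have a1 := m1 (hψ.2 k) h
      have a2 := m1 hψ.pred h'
      refine ⟨a1.toLp _ + a2.toLp _, ?_, ?_⟩
      · have b1 := ih _ (hψ.2 k) c h (a1.toLp _) (hh.mono (Nat.le_succ n) le_rfl) a1.coeFn_toLp
        have b2 := ih _ hψ.pred c h' (a2.toLp _) hB' a2.coeFn_toLp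
        have e1 : ((𝓕 (a1.toLp _ + a2.toLp _) : L2) : R2 → ℂ) =ᵐ[volume]
            fun ξ => (𝓕 (a1.toLp _) : L2) ξ + (𝓕 (a2.toLp _) : L2) ξ := by
          rw [FourierTransform.fourier_add]
          exact Lp.coeFn_add _ _
        rw [two_mul]
        have := (b1.add b2).of_le (w := n) (G := (𝓕 (a1.toLp _ + a2.toLp _) : L2)) zero_le_one
          (Lp.memLp _).1 (by filter_upwards [e1] with ξ hξ; rw [hξ, one_mul])
        rwa [one_mul] at this
      · refine (hasWeakDeriv_iff_fourier g _).1 (hprod.congr hg.symm ?_)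
        filter_upwards [Lp.coeFn_add (a1.toLp _) (a2.toLp _), a1.coeFn_toLp, a2.coeFn_toLp]
          with x h1 h2 h3
        rw [h1, Pi.add_apply, h2, h3]
    obtain ⟨V0, n0, e0⟩ := key 0
    obtain ⟨V1, n1, e1⟩ := key 1
    have nn : ∀ {c : ℝ} {F : R2 → ℂ}, WBound n c F → WBound n c fun ξ => ((‖F ξ‖ : ℝ) : ℂ) := by
      intro c F hF
      have := hF.of_le (w := n) (G := fun ξ => ((‖F ξ‖ : ℝ) : ℂ)) zero_le_one
        (Complex.continuous_ofReal.comp_aestronglyMeasurable hF.memLp.1.norm)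
        (Eventually.of_forall fun ξ => by simp)
      rwa [one_mul] at this
    have hsum := ((nn hbase).add (nn n0)).add (nn n1)
    have := hsum.memLp_weight
    have hle : ∀ᵐ ξ, ‖((jap ξ ^ (n + 1) : ℝ) : ℂ) * (𝓕 g : L2) ξ‖ ≤
        ‖((jap ξ ^ n : ℝ) : ℂ) * (((‖(𝓕 g : L2) ξ‖ : ℝ) : ℂ) + ((‖(𝓕 V0 : L2) ξ‖ : ℝ) : ℂ) +
          ((‖(𝓕 V1 : L2) ξ‖ : ℝ) : ℂ))‖ := by
      filter_upwards [e0, e1] with ξ h0 h1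
      rw [h0, h1, norm_mul, norm_mul, norm_jap_pow, norm_jap_pow, ← Complex.ofReal_add,
        ← Complex.ofReal_add, Complex.norm_real, Real.norm_eq_abs, abs_of_nonneg (by positivity),
        pow_succ, mul_assoc]
      have hk : ∀ k, ‖2 * (Real.pi : ℂ) * Complex.I * (ξ k : ℂ) * (𝓕 g : L2) ξ‖ =
          ‖((2 * Real.pi * ξ k : ℝ) : ℂ)‖ * ‖(𝓕 g : L2) ξ‖ := fun k => by
        rw [norm_mul]; congr 1; simp
      rw [hk, hk]
      have hj := pow_pos (jap_pos ξ) n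
      gcongr
      have := mul_le_mul_of_nonneg_right (norm_coord_le_jap ξ) (norm_nonneg ((𝓕 g : L2) ξ))
      linarith
    refine ⟨by positivity, Lp.memLp _, (eLpNorm_mono_ae hle).trans (hsum.le.trans ?_)⟩
    exact ENNReal.ofReal_le_ofReal (by linarith)

/-- A finite Sobolev norm includes square integrability, since `sobolevNorm` is `∞` otherwise. -/
lemma WBound.of_sobolevNorm {n : ℕ} {c : ℝ} (hc : 0 ≤ c) {g : R2 → ℂ}
    (h : sobolevNorm n g ≤ ENNReal.ofReal c) : ∃ hg : MemLp g 2 volume,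
      WBound n c (𝓕 (hg.toLp g) : L2) := by
  unfold sobolevNorm at h
  split_ifs at h with hg
  · refine ⟨hg, hc, Lp.memLp _, ?_⟩
    simpa only [Real.rpow_natCast, jap] using h
  · exact absurd h (by simp)

/-- A bound on `‖⟨x⟩²f‖_{H^{10}}` gives two weak derivatives of `𝓕 f` in a weighted `L²` space: they are
the Fourier transforms of the products of `⟨x⟩²f` with `x_j⟨x⟩⁻²` and `x_ix_j⟨x⟩⁻²`, up to constants. -/
theorem exists_reg_fourier : ∃ C : ℝ, 0 < C ∧ ∀ (c : ℝ), 0 ≤ c → ∀ f : L2,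
    sobolevNorm 10 (fun x : R2 => ((bracket x ^ 2 : ℝ) : ℂ) * f x) ≤ ENNReal.ofReal c →
    Reg 2 10 (C * c) (𝓕 f : L2) := by
  obtain ⟨⟨C0, s0⟩, s1, s2⟩ := exists_symb_invSq 10
  choose C1 s1 using s1
  choose C2 s2 using s2
  obtain ⟨K0, hK0, p0⟩ := exists_mul_bound 10 C0
  have p1 := fun j => exists_mul_bound 10 (2 ^ 10 * (‖-(2 * Real.pi * Complex.I)‖ * C1 j))
  choose K1 hK1 p1 using p1
  have p2 := fun i j => exists_mul_bound 10 (2 ^ 10 * (‖-(2 * Real.pi * Complex.I)‖ *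
    (2 ^ 10 * (‖-(2 * Real.pi * Complex.I)‖ * C2 i j))))
  choose K2 hK2 p2 using p2
  have hS1 : 0 ≤ ∑ j, K1 j := Finset.sum_nonneg fun j _ => hK1 j
  have hS2 : 0 ≤ ∑ i, ∑ j, K2 i j :=
    Finset.sum_nonneg fun i _ => Finset.sum_nonneg fun j _ => hK2 i j
  refine ⟨1 + K0 + ∑ j, K1 j + ∑ i, ∑ j, K2 i j, by linarith, fun c hc f hf => ?_⟩
  obtain ⟨hg, hW⟩ := WBound.of_sobolevNorm (n := 10) hc (by exact_mod_cast hf)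
  set h : L2 := hg.toLp _ with hh
  have hfh : ∀ᵐ x, (invSq x : ℂ) * h x = f x := by
    filter_upwards [hg.coeFn_toLp] with x hx
    rw [hh, hx, ← mul_assoc, ← Complex.ofReal_mul, mul_comm (invSq x), bracket_sq_mul_invSq,
      Complex.ofReal_one, one_mul]
  have mk : ∀ {ψ : R2 → ℂ} {C : ℝ}, Symb 10 0 C ψ → ∃ v : L2, v =ᵐ[volume] fun x => ψ x * h x :=
    fun {ψ C} hψ => ⟨MemLp.toLp (fun x => ψ x * h x) ((Lp.memLp h).of_le_mul (c := C)
      (hψ.smooth.continuous.aestronglyMeasurable.mul (Lp.memLp h).1)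
      (Eventually.of_forall fun x => by
        rw [norm_mul]; gcongr; simpa using hψ.bound x)), MemLp.coeFn_toLp _⟩
  have q1 := fun j => (Symb.const 10 (-(2 * Real.pi * Complex.I))).mul (s1 j)
  have q2 := fun i j => (Symb.const 10 (-(2 * Real.pi * Complex.I))).mul
    ((Symb.const 10 (-(2 * Real.pi * Complex.I))).mul (s2 i j))
  have v1 := fun j => mk (q1 j)
  have v2 := fun i j => mk (q2 i j)
  choose v1 hv1 using v1
  choose v2 hv2 using v2
  have w0 := p0 _ s0 c h f hW (by filter_upwards [hfh] with x hx; rw [hx])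
  have w1 := fun j => p1 j _ (q1 j) c h (v1 j) hW (hv1 j)
  have w2 := fun i j => p2 i j _ (q2 i j) c h (v2 i j) hW (hv2 i j)
  have hle0 : K0 * c ≤ (1 + K0 + ∑ j, K1 j + ∑ i, ∑ j, K2 i j) * c := by gcongr; linarith
  have hle1 : ∀ j, K1 j * c ≤ (1 + K0 + ∑ j, K1 j + ∑ i, ∑ j, K2 i j) * c := fun j => by
    gcongr
    have := Finset.single_le_sum (f := K1) (fun j _ => hK1 j) (Finset.mem_univ j)
    linarith
  have hle2 : ∀ i j, K2 i j * c ≤ (1 + K0 + ∑ j, K1 j + ∑ i, ∑ j, K2 i j) * c := fun i j => by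
    gcongr
    have h1 := Finset.single_le_sum (f := K2 i) (fun j _ => hK2 i j) (Finset.mem_univ j)
    have h2 := Finset.single_le_sum (f := fun i => ∑ j, K2 i j)
      (fun i _ => Finset.sum_nonneg fun j _ => hK2 i j) (Finset.mem_univ i)
    linarith
  refine ⟨w0.mono le_rfl hle0, fun i => ⟨(𝓕 (v1 i) : L2), ?_, (w1 i).mono le_rfl (hle1 i),
    fun j => ⟨(𝓕 (v2 i j) : L2), ?_, (w2 i j).mono le_rfl (hle2 i j)⟩⟩⟩
  · rw [hasWeakDeriv_iff_fourierInv, FourierTransform.fourierInv_fourier_eq,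
      FourierTransform.fourierInv_fourier_eq]
    filter_upwards [hv1 i, hfh] with x h1 h2
    rw [h1, ← h2]; push_cast; ring
  · rw [hasWeakDeriv_iff_fourierInv, FourierTransform.fourierInv_fourier_eq,
      FourierTransform.fourierInv_fourier_eq]
    filter_upwards [hv1 i, hv2 i j] with x h1 h2
    rw [h1, h2]; push_cast; ring

/-- In frequency, the function is the free evolution of its profile. -/
lemma fourier_eq_evo_mul (t : ℝ) (u : L2) :
    ∀ᵐ ξ, (𝓕 u : L2) ξ = evo t ξ * (𝓕 (propagator t u) : L2) ξ := by
  unfold propagator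
  rw [FourierTransform.fourier_fourierInv_eq]
  filter_upwards [(memLp_phase_mul t (𝓕 u)).coeFn_toLp] with ξ hξ
  rw [hξ, ← mul_assoc, evo, jap, ← Complex.exp_add]
  simp

/-! ### Bilinear forms with an oscillating kernel -/

/-- `⟨2πa⟩ + ⟨2πb⟩` at `a = ζ + η`, `b = η`, inverted. -/
noncomputable def invSum (ζ η : R2) : ℝ := (jap (ζ + η) + jap η)⁻¹

/-- The kernel `(⟨a⟩ + ⟨b⟩)⁻ʳ e^{-it(⟨a⟩ - ⟨b⟩)}` at `a = 2π(ζ + η)`, `b = 2πη`. -/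
noncomputable def formKernel (t : ℝ) (r : ℕ) (ζ η : R2) : ℂ :=
  ((invSum ζ η ^ r : ℝ) : ℂ) * (evo t (ζ + η) * conj (evo t η))

/-- The bilinear form `∫ (⟨a⟩ + ⟨b⟩)⁻ʳ e^{-it(⟨a⟩ - ⟨b⟩)} F(ζ + η) conj H(η) dη`. For `r = 0` and the
profile `F = H` it is the Fourier transform of the density `|u|²`. -/
noncomputable def form (t : ℝ) (r : ℕ) (F H : R2 → ℂ) (ζ : R2) : ℂ :=
  ∫ η, formKernel t r ζ η * (F (ζ + η) * conj (H η))

lemma jap_add_pos (ζ η : R2) : 0 < jap (ζ + η) + jap η := add_pos (jap_pos _) (jap_pos _)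

lemma invSum_pos (ζ η : R2) : 0 < invSum ζ η := inv_pos.2 (jap_add_pos ζ η)

lemma invSum_le_one (ζ η : R2) : invSum ζ η ≤ 1 :=
  inv_le_one_of_one_le₀ (by linarith [one_le_jap (ζ + η), jap_pos η])

lemma norm_invSum_pow_le (r : ℕ) (ζ η : R2) : ‖((invSum ζ η ^ r : ℝ) : ℂ)‖ ≤ 1 := by
  rw [Complex.norm_real, Real.norm_eq_abs, abs_of_pos (pow_pos (invSum_pos ζ η) r)]
  exact pow_le_one₀ (invSum_pos ζ η).le (invSum_le_one ζ η)

lemma contDiff_shift (ζ : R2) : ContDiff ℝ ∞ fun η : R2 => ζ + η := contDiff_const.add contDiff_id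

lemma contDiff_invSum (ζ : R2) : ContDiff ℝ ∞ (invSum ζ) :=
  ((contDiff_jap.comp (contDiff_shift ζ)).add contDiff_jap).inv fun η => (jap_add_pos ζ η).ne'

lemma contDiff_formKernel (t : ℝ) (r : ℕ) (ζ : R2) : ContDiff ℝ ∞ (formKernel t r ζ) :=
  (Complex.ofRealCLM.contDiff.comp ((contDiff_invSum ζ).pow r)).mul
    (((contDiff_evo t).comp (contDiff_shift ζ)).mul
      (Complex.conjCLE.contDiff.comp (contDiff_evo t)))

lemma norm_formKernel_le (t : ℝ) (r : ℕ) (ζ η : R2) : ‖formKernel t r ζ η‖ ≤ 1 := by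
  rw [formKernel, norm_mul, norm_mul, RCLike.norm_conj, norm_evo, norm_evo, mul_one, mul_one]
  exact norm_invSum_pow_le r ζ η

lemma hasDerivAt_evo_line (t : ℝ) (ξ : R2) (k : Fin 2) :
    HasDerivAt (fun s : ℝ => evo t (ξ + s • e k))
      (-(2 * Real.pi * Complex.I * t * (vel ξ k : ℂ)) * evo t ξ) 0 := by
  have h := ((((hasDerivAt_jap_line ξ (e k)).const_mul t).ofReal_comp.const_mul
    Complex.I).fun_neg).cexp
  refine h.congr_deriv ?_
  simp only [zero_smul, add_zero, inner_e, evo]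
  push_cast
  ring

lemma hasDerivAt_invSum_pow_line (r : ℕ) (ζ η : R2) (k : Fin 2) :
    HasDerivAt (fun s : ℝ => invSum ζ (η + s • e k) ^ r)
      (-(2 * Real.pi * r * (vel (ζ + η) k + vel η k) * invSum ζ η ^ (r + 1))) 0 := by
  have h1 := hasDerivAt_jap_line (ζ + η) (e k)
  have h2 := hasDerivAt_jap_line η (e k)
  have h := ((h1.fun_add h2).fun_inv (by simpa using (jap_add_pos ζ η).ne')).fun_pow r
  simp only [add_assoc] at h
  refine h.congr_deriv ?_
  simp only [zero_smul, add_zero, inner_e, invSum]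
  have := (jap_add_pos ζ η).ne'
  cases r with
  | zero => simp
  | succ r =>
    rw [div_eq_mul_inv, ← inv_pow, Nat.add_sub_cancel]
    push_cast
    ring

/-- The phase contributes the difference of the velocities, with a factor `t`, and the weight
contributes their sum, with a gain of one power of `⟨a⟩ + ⟨b⟩`. -/
lemma fderiv_formKernel (t : ℝ) (r : ℕ) (ζ η : R2) (k : Fin 2) :
    fderiv ℝ (formKernel t r ζ) η (e k) =
      -(2 * Real.pi * Complex.I * t) * ((vel (ζ + η) k : ℂ) - vel η k) * formKernel t r ζ η
      - 2 * Real.pi * r * ((vel (ζ + η) k : ℂ) + vel η k) * formKernel t (r + 1) ζ η := by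
  refine fderiv_apply_eq_of_line η (e k) ((contDiff_formKernel t r ζ).differentiable (by simp) η) ?_
  have h1 := (hasDerivAt_invSum_pow_line r ζ η k).ofReal_comp
  have h2 := hasDerivAt_evo_line t (ζ + η) k
  have h3 := (hasDerivAt_evo_line t η k).star
  simp only [add_assoc] at h2
  refine (h1.fun_mul (h2.fun_mul h3)).congr_deriv ?_
  simp only [zero_smul, add_zero, formKernel, starRingEnd_apply]
  simp
  ring

lemma integrable_fun_sub {f g : R2 → ℂ} (hf : Integrable f) (hg : Integrable g) :
    Integrable fun x => f x - g x := hf.sub hg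

section Basic

variable {F H F' H' : R2 → ℂ}

lemma memLp_shift (hF : MemLp F 2 volume) (ζ : R2) : MemLp (fun η => F (ζ + η)) 2 volume :=
  hF.comp_measurePreserving (measurePreserving_add_left volume ζ)

lemma memLp_conj (hH : MemLp H 2 volume) : MemLp (fun η => conj (H η)) 2 volume :=
  hH.of_le (Complex.continuous_conj.comp_aestronglyMeasurable hH.1)
    (Eventually.of_forall fun η => by simp)

lemma memLp_bounded_mul {ψ : R2 → ℂ} {C : ℝ} (hψ : Continuous ψ) (hb : ∀ η, ‖ψ η‖ ≤ C)
    (hF : MemLp F 2 volume) : MemLp (fun η => ψ η * F η) 2 volume :=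
  hF.of_le_mul (c := C) (hψ.aestronglyMeasurable.mul hF.1) (Eventually.of_forall fun η => by
    rw [norm_mul]; gcongr; exact hb η)

lemma integrable_form (t : ℝ) (r : ℕ) (hF : MemLp F 2 volume) (hH : MemLp H 2 volume) (ζ : R2) :
    Integrable fun η => formKernel t r ζ η * (F (ζ + η) * conj (H η)) :=
  (memLp_mul_integrable (memLp_shift hF ζ) (memLp_conj hH)).bdd_mul (c := 1)
    (contDiff_formKernel t r ζ).continuous.aestronglyMeasurable
    (Eventually.of_forall fun η => norm_formKernel_le t r ζ η)

/-- The pointwise bound of a form by Cauchy-Schwarz. -/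
lemma norm_form_le (t : ℝ) (r : ℕ) {w w' : ℕ} {c c' : ℝ} (hF : WBound w c F) (hH : WBound w' c' H)
    (ζ : R2) : ‖form t r F H ζ‖ ≤ c * c' := by
  refine (norm_integral_le_integral_norm _).trans ?_
  refine le_trans ?_ (integral_norm_mul_le (memLp_shift hF.memLp ζ) (memLp_conj hH.memLp)
    hF.nonneg hH.nonneg ?_ ?_)
  · refine integral_mono (integrable_form t r hF.memLp hH.memLp ζ).norm
      (memLp_mul_integrable (memLp_shift hF.memLp ζ) (memLp_conj hH.memLp)).norm fun η => ?_
    simp only [norm_mul (formKernel _ _ _ _)]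
    exact mul_le_of_le_one_left (norm_nonneg _) (norm_formKernel_le t r ζ η)
  · exact (eLpNorm_comp_measurePreserving hF.memLp.1
      (measurePreserving_add_left volume ζ)).le.trans hF.eLpNorm_le
  · rw [eLpNorm_congr_norm_ae (g := H) (Eventually.of_forall fun η => by simp)]
    exact hH.eLpNorm_le

lemma form_congr (t : ℝ) (r : ℕ) (hF : F =ᵐ[volume] F') (hH : H =ᵐ[volume] H') :
    form t r F H = form t r F' H' := by
  ext ζ
  refine integral_congr_ae ?_
  filter_upwards [(measurePreserving_add_left volume ζ).quasiMeasurePreserving.ae_eq hF, hH]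
    with η h1 h2
  simp only [Function.comp] at h1
  rw [h1, h2]

/-- The two arguments of a form play symmetric roles. -/
lemma form_conj_swap (t : ℝ) (r : ℕ) (F H : R2 → ℂ) (ζ : R2) :
    form t r F H ζ = conj (form t r H F (-ζ)) := by
  rw [form, form, ← integral_conj]
  refine Eq.trans ?_ (integral_add_left_eq_self _ ζ)
  refine integral_congr_ae (Eventually.of_forall fun η => ?_)
  simp only [formKernel, invSum, neg_add_cancel_left, map_mul, Complex.conj_conj,
    Complex.conj_ofReal, add_comm (jap η)]
  ring

/-- Integration by parts in a form: the derivative of the phase produces the difference of the two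
velocities. -/
lemma form_vel_sub (t : ℝ) (r : ℕ) {k : Fin 2} {w w' : ℕ} {c c' : ℝ} {G G' : R2 → ℂ}
    (hF : WBound w c F) (hH : WBound w' c' H) (hG : WBound w c G) (hG' : WBound w' c' G')
    (h1 : HasWeakDeriv k F G) (h2 : HasWeakDeriv k H G') (ζ : R2) :
    2 * Real.pi * Complex.I * t * (form t r (fun ξ => (vel ξ k : ℂ) * F ξ) H ζ -
      form t r F (fun ξ => (vel ξ k : ℂ) * H ξ) ζ) =
    form t r G H ζ + form t r F G' ζ - 2 * Real.pi * r *
      (form t (r + 1) (fun ξ => (vel ξ k : ℂ) * F ξ) H ζ +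
        form t (r + 1) F (fun ξ => (vel ξ k : ℂ) * H ξ) ζ) := by
  have hshift : HasWeakDeriv k (fun η => F (ζ + η)) fun η => G (ζ + η) := by
    intro φ hφ hφc
    have h := h1 (fun x => φ (x - ζ)) (hφ.comp (contDiff_id.sub contDiff_const))
      (hφc.comp_homeomorph (Homeomorph.subRight ζ))
    rw [← integral_add_left_eq_self _ ζ, ← integral_add_left_eq_self (fun x => G x * _) ζ] at h
    simp only [fderiv_comp_sub, add_sub_cancel_left] at h
    exact h
  have lF := memLp_shift hF.memLp ζ
  have lG := memLp_shift hG.memLp ζ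
  have hψ := contDiff_formKernel t r ζ
  have hprod := hshift.smooth_mul (memLp_locallyIntegrable lF) (memLp_locallyIntegrable lG) hψ
  have velc : Continuous fun ξ : R2 => ((vel ξ k : ℝ) : ℂ) := (contDiff_vel_apply k).continuous
  have mv : ∀ {E : R2 → ℂ}, MemLp E 2 volume → MemLp (fun ξ => (vel ξ k : ℂ) * E ξ) 2 volume :=
    fun hE => memLp_bounded_mul velc (fun η => norm_vel_apply_le η k) hE
  have mk : ∀ {E : R2 → ℂ} (r : ℕ), MemLp E 2 volume →
      MemLp (fun η => formKernel t r ζ η * E η) 2 volume := fun r hE =>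
    memLp_bounded_mul (contDiff_formKernel t r ζ).continuous (norm_formKernel_le t r ζ) hE
  have mvs : ∀ {E : R2 → ℂ}, MemLp E 2 volume →
      MemLp (fun η => (vel (ζ + η) k : ℂ) * E η) 2 volume :=
    fun hE => memLp_bounded_mul (velc.comp (contDiff_shift ζ).continuous)
      (fun η => norm_vel_apply_le (ζ + η) k) hE
  have hD : MemLp (fun η => fderiv ℝ (formKernel t r ζ) η (e k) * F (ζ + η) +
      formKernel t r ζ η * G (ζ + η)) 2 volume := by
    refine MemLp.add ?_ (mk r lG)
    have a1 := (((mk r (mvs lF)).sub (mk r (mv lF))).const_mul (-(2 * Real.pi * Complex.I * t))).sub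
      (((mk (r + 1) (mvs lF)).add (mk (r + 1) (mv lF))).const_mul (2 * Real.pi * (r : ℂ)))
    refine (memLp_congr_ae (Eventually.of_forall fun η => ?_)).1 a1
    simp only [fderiv_formKernel, Pi.sub_apply, Pi.add_apply]
    ring
  have key := h2.integral_conj_mul hprod hH.memLp hG'.memLp (mk r lF) hD
  have iH := integrable_form t r hG.memLp hH.memLp ζ
  have i1 := integrable_form t r (mv hF.memLp) hH.memLp ζ
  have i2 := integrable_form t r hF.memLp (mv hH.memLp) ζ
  have i3 := integrable_form t (r + 1) (mv hF.memLp) hH.memLp ζ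
  have i4 := integrable_form t (r + 1) hF.memLp (mv hH.memLp) ζ
  have i5 : Integrable fun η => -(2 * Real.pi * Complex.I * t) *
      (formKernel t r ζ η * ((vel (ζ + η) k : ℂ) * F (ζ + η) * conj (H η)) -
        formKernel t r ζ η * (F (ζ + η) * conj ((vel η k : ℂ) * H η))) := (i1.sub i2).const_mul _
  have i6 : Integrable fun η => 2 * Real.pi * r *
      (formKernel t (r + 1) ζ η * ((vel (ζ + η) k : ℂ) * F (ζ + η) * conj (H η)) +
        formKernel t (r + 1) ζ η * (F (ζ + η) * conj ((vel η k : ℂ) * H η))) :=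
    (i3.add i4).const_mul _
  have e1 : ∫ η, conj (H η) * (fderiv ℝ (formKernel t r ζ) η (e k) * F (ζ + η) +
      formKernel t r ζ η * G (ζ + η)) =
      -(2 * Real.pi * Complex.I * t) * (form t r (fun ξ => (vel ξ k : ℂ) * F ξ) H ζ -
      form t r F (fun ξ => (vel ξ k : ℂ) * H ξ) ζ) - 2 * Real.pi * r *
      (form t (r + 1) (fun ξ => (vel ξ k : ℂ) * F ξ) H ζ +
        form t (r + 1) F (fun ξ => (vel ξ k : ℂ) * H ξ) ζ) + form t r G H ζ := by
    simp only [form]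
    rw [← integral_sub i1 i2, ← integral_add i3 i4, ← integral_const_mul, ← integral_const_mul,
      ← integral_sub i5 i6, ← integral_add (integrable_fun_sub i5 i6) iH]
    refine integral_congr_ae (Eventually.of_forall fun η => ?_)
    simp only [fderiv_formKernel, map_mul, Complex.conj_ofReal]
    ring
  have e2 : ∫ η, conj (G' η) * (formKernel t r ζ η * F (ζ + η)) = form t r F G' ζ := by
    refine integral_congr_ae (Eventually.of_forall fun η => ?_)
    simp only
    ring
  rw [e1, e2] at key
  linear_combination -key

end Basic

/-! ### The frequency difference in terms of the velocity difference -/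

lemma Symb.ofReal_mul {M r r' : ℕ} {f g : R2 → ℝ} (hf : ∃ C, Symb M r C fun ξ => (f ξ : ℂ))
    (hg : ∃ C, Symb M r' C fun ξ => (g ξ : ℂ)) :
    ∃ C, Symb M (r + r') C fun ξ => ((f ξ * g ξ : ℝ) : ℂ) := by
  obtain ⟨C, hC⟩ := hf
  obtain ⟨D, hD⟩ := hg
  exact ⟨_, (congrArg (Symb M (r + r') _) (by ext ξ; push_cast; rfl)).mp (hC.mul hD)⟩

lemma jap_sq (ξ : R2) : jap ξ ^ 2 = 1 + (2 * Real.pi * ξ 0) ^ 2 + (2 * Real.pi * ξ 1) ^ 2 := by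
  rw [jap, bracket_sq, EuclideanSpace.norm_sq_eq, Fin.sum_univ_two]
  simp only [PiLp.smul_apply, smul_eq_mul, Real.norm_eq_abs, sq_abs]
  ring

lemma jap_mul_vel (ξ : R2) (k : Fin 2) : jap ξ * vel ξ k = 2 * Real.pi * ξ k := by
  have := (jap_pos ξ).ne'
  simp only [vel, velocity, PiLp.smul_apply, smul_eq_mul]
  change jap ξ * ((jap ξ)⁻¹ * _) = _
  field_simp

/-- The frequency difference, multiplied by `⟨a⟩ + ⟨b⟩`, is a sum of products of functions of `a`, of
functions of `b`, and of components of the difference of the velocities at `a` and `b`. Being linear in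
this difference, it can be traded for a derivative of the phase without dividing by the gradient of the
phase. -/
lemma exists_velocity_decomposition (j : Fin 2) : ∃ (n n' : Fin 6 → R2 → ℝ) (κ : Fin 6 → Fin 2),
    (∀ M i, ∃ C, Symb M 2 C fun ξ => (n i ξ : ℂ)) ∧
    (∀ M i, ∃ C, Symb M 2 C fun ξ => (n' i ξ : ℂ)) ∧
    ∀ a b : R2, (jap a + jap b) * (2 * Real.pi * (a j - b j)) =
      ∑ i, n i a * n' i b * (vel a (κ i) - vel b (κ i)) := by
  let x : Fin 2 → R2 → ℝ := fun k ξ => 2 * Real.pi * ξ k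
  have s0 : ∀ M, ∃ C, Symb M 2 C fun _ => ((1 : ℝ) : ℂ) := fun M =>
    ⟨_, (Symb.const M ((1 : ℝ) : ℂ)).mono (Nat.zero_le 2) le_rfl⟩
  have s1 : ∀ M, ∃ C, Symb M 2 C fun ξ => ((jap ξ : ℝ) : ℂ) := fun M =>
    (exists_symb_jap M).imp fun C h => h.mono one_le_two le_rfl
  have s2 : ∀ M, ∃ C, Symb M 2 C fun ξ => ((jap ξ * jap ξ : ℝ) : ℂ) := fun M =>
    Symb.ofReal_mul (exists_symb_jap M) (exists_symb_jap M)
  have s3 : ∀ M k, ∃ C, Symb M 2 C fun ξ => ((jap ξ * x k ξ : ℝ) : ℂ) := fun M k =>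
    Symb.ofReal_mul (exists_symb_jap M) (exists_symb_coord M k)
  have s4 : ∀ M k l, ∃ C, Symb M 2 C fun ξ => ((x k ξ * x l ξ : ℝ) : ℂ) := fun M k l =>
    Symb.ofReal_mul (exists_symb_coord M k) (exists_symb_coord M l)
  refine ⟨![fun a => jap a * jap a, jap, fun a => jap a * x 0 a, fun a => jap a * x 1 a,
      fun a => jap a * jap a, fun a => jap a * jap a],
    ![fun _ => 1, jap, fun b => jap b * x j b, fun b => jap b * x j b,
      fun b => x j b * x 0 b, fun b => x j b * x 1 b],
    ![j, j, 0, 1, 0, 1], fun M i => ?_, fun M i => ?_, fun a b => ?_⟩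
  · fin_cases i
    exacts [s2 M, s1 M, s3 M 0, s3 M 1, s2 M, s2 M]
  · fin_cases i
    exacts [s0 M, s1 M, s3 M j, s3 M j, s4 M j 0, s4 M j 1]
  · have ha := jap_sq a
    have hb := jap_sq b
    have ea := jap_mul_vel a
    have eb := jap_mul_vel b
    have ca : ∀ k, x k a = jap a * vel a k := fun k => (ea k).symm
    have cb : ∀ k, x k b = jap b * vel b k := fun k => (eb k).symm
    simp only [Fin.sum_univ_six]
    simp only [Matrix.cons_val]
    rw [mul_sub, ← ea j, ← eb j]
    rw [← ea 0, ← ea 1] at ha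
    rw [← eb 0, ← eb 1] at hb
    simp only [ca, cb]
    -- this is `⟨a⟩² - ⟨b⟩² = ⟨a⟩²⟨b⟩² (p - q)·(p + q)` for the velocities `p` and `q`
    linear_combination (vel b j * jap b ^ 2) * ha - (vel b j * jap a ^ 2) * hb

/-- A family of bounds that is stable under addition and multiplication by constants. The integration
by parts is used for several such families: pointwise bounds, and those of `SplitBound`. -/
structure IsBoundClass (E : ℝ → (R2 → ℂ) → Prop) : Prop where
  mono : ∀ {c c' : ℝ} {q : R2 → ℂ}, c ≤ c' → E c q → E c' q
  add : ∀ {c c' : ℝ} {q q' : R2 → ℂ}, E c q → E c' q' → E (c + c') fun ζ => q ζ + q' ζ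
  smul : ∀ (a : ℂ) {c : ℝ} {q : R2 → ℂ}, E c q → E (‖a‖ * c) fun ζ => a * q ζ

/-- The decomposition of `ζ_j = a_j - b_j` under the integral; the factor `⟨a⟩ + ⟨b⟩` raises the
order of the forms by one. -/
lemma form_sum_identity (t : ℝ) (r : ℕ) (j : Fin 2) {n n' : Fin 6 → R2 → ℝ} {κ : Fin 6 → Fin 2}
    (hdec : ∀ a b : R2, (jap a + jap b) * (2 * Real.pi * (a j - b j)) =
      ∑ i, n i a * n' i b * (vel a (κ i) - vel b (κ i))) {F H : R2 → ℂ}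
    (hF : ∀ i, MemLp (fun ξ => (n i ξ : ℂ) * F ξ) 2 volume)
    (hH : ∀ i, MemLp (fun ξ => (n' i ξ : ℂ) * H ξ) 2 volume) (ζ : R2) :
    2 * Real.pi * (ζ j : ℂ) * form t r F H ζ = ∑ i,
      (form t (r + 1) (fun ξ => (vel ξ (κ i) : ℂ) * ((n i ξ : ℂ) * F ξ))
          (fun ξ => (n' i ξ : ℂ) * H ξ) ζ -
        form t (r + 1) (fun ξ => (n i ξ : ℂ) * F ξ)
          (fun ξ => (vel ξ (κ i) : ℂ) * ((n' i ξ : ℂ) * H ξ)) ζ) := by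
  have mv : ∀ {E : R2 → ℂ} (k : Fin 2), MemLp E 2 volume →
      MemLp (fun ξ => (vel ξ k : ℂ) * E ξ) 2 volume := fun k hE =>
    memLp_bounded_mul (contDiff_vel_apply k).continuous (fun η => norm_vel_apply_le η k) hE
  have i1 := fun i => integrable_form t (r + 1) (mv (κ i) (hF i)) (hH i) ζ
  have i2 := fun i => integrable_form t (r + 1) (hF i) (mv (κ i) (hH i)) ζ
  simp only [form]
  simp only [fun i => (integral_sub (i1 i) (i2 i)).symm]
  rw [← integral_finsetSum _ fun i _ => integrable_fun_sub (i1 i) (i2 i), ← integral_const_mul]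
  refine integral_congr_ae (Eventually.of_forall fun η => ?_)
  have h := congrArg (fun x : ℝ => (x : ℂ)) (hdec (ζ + η) η)
  simp only [PiLp.add_apply, add_sub_cancel_right] at h
  have hk : (((jap (ζ + η) + jap η : ℝ)) : ℂ) * formKernel t (r + 1) ζ η = formKernel t r ζ η := by
    have h0 := (jap_add_pos ζ η).ne'
    have h1 : (jap (ζ + η) + jap η) * invSum ζ η ^ (r + 1) = invSum ζ η ^ r := by
      rw [pow_succ', ← mul_assoc, invSum, mul_inv_cancel₀ h0, one_mul]
    rw [formKernel, formKernel, ← h1]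
    push_cast; ring
  simp only
  rw [← hk]
  have h' : 2 * Real.pi * (ζ j : ℂ) * ((jap (ζ + η) + jap η : ℝ) : ℂ) =
      ∑ i, (n i (ζ + η) : ℂ) * (n' i η : ℂ) * ((vel (ζ + η) (κ i) : ℂ) - (vel η (κ i) : ℂ)) := by
    push_cast at h ⊢
    rw [← h]; ring
  rw [mul_assoc ((jap (ζ + η) + jap η : ℝ) : ℂ), ← mul_assoc, h', Finset.sum_mul]
  refine Finset.sum_congr rfl fun i _ => ?_
  simp only [map_mul, Complex.conj_ofReal]
  ring

/-- One integration by parts. Multiplication of a form by `t ζ_j` produces forms of higher order in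
which one of the two factors is differentiated, or none is; every factor is multiplied by a symbol
of order two. -/
lemma exists_step (r m m' : ℕ) (j : Fin 2) : ∃ K : ℝ, 0 ≤ K ∧
    ∀ (E : ℝ → (R2 → ℂ) → Prop), IsBoundClass E →
    ∀ (t : ℝ) (w w' : ℕ) (c c' B : ℝ) (F H : R2 → ℂ), 0 ≤ B →
    Reg (m + 1) (w + 2) c F → Reg (m' + 1) (w' + 2) c' H →
    (∀ G N, Reg m w (K * c) G → Reg (m' + 1) w' (K * c') N → E B (form t (r + 1) G N)) →
    (∀ N G, Reg (m + 1) w (K * c) N → Reg m' w' (K * c') G → E B (form t (r + 1) N G)) →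
    (∀ N N', Reg (m + 1) w (K * c) N → Reg (m' + 1) w' (K * c') N' → E B (form t (r + 2) N N')) →
    E (K * B) fun ζ => t * (ζ j : ℂ) * form t r F H ζ := by
  obtain ⟨n, n', κ, hn, hn', hdec⟩ := exists_velocity_decomposition j
  choose C hC using hn (m + 1)
  choose C' hC' using hn' (m' + 1)
  choose D hD using (exists_symb_vel (m + 1)).1
  choose D' hD' using (exists_symb_vel (m' + 1)).1
  have pC := fun i => (hC i).nonneg
  have pC' := fun i => (hC' i).nonneg
  have pD := fun i => (hD i).nonneg
  have pD' := fun i => (hD' i).nonneg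
  -- `k i` bounds the constants of the symbols in the `i`-th term, and `K₀` counts the terms
  let k : Fin 6 → ℝ := fun i => 2 ^ (m + 1) * C i + 2 ^ (m + 1) * (D (κ i) * (2 ^ (m + 1) * C i)) +
    (2 ^ (m' + 1) * C' i + 2 ^ (m' + 1) * (D' (κ i) * (2 ^ (m' + 1) * C' i)))
  have pk : ∀ i, 0 ≤ k i := fun i => by
    have := pC i; have := pC' i; have := pD (κ i); have := pD' (κ i)
    positivity
  let a : ℂ := -(2 * Real.pi * (r + 1))
  let b : ℂ := (4 * Real.pi ^ 2 * Complex.I)⁻¹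
  let K₀ : ℝ := ‖b‖ * (6 * (2 + ‖a‖ * 2))
  have pK₀ : 0 ≤ K₀ := by positivity
  have pk' : 0 ≤ ∑ i, k i := Finset.sum_nonneg fun i _ => pk i
  refine ⟨K₀ + ∑ i, k i, by linarith, fun E hE t w w' c c' B F H hB hF hH h1 h2 h3 => ?_⟩
  have hc := hF.base.nonneg
  have hc' := hH.base.nonneg
  have hk : ∀ i, k i ≤ K₀ + ∑ i, k i := fun i => by
    have := Finset.single_le_sum (f := k) (fun i _ => pk i) (Finset.mem_univ i)
    linarith
  have b1 : ∀ i, 2 ^ (m + 1) * (C i * c) ≤ (K₀ + ∑ i, k i) * c := fun i => by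
    rw [← mul_assoc]
    refine mul_le_mul_of_nonneg_right (le_trans ?_ (hk i)) hc
    have := pC i; have := pC' i; have := pD (κ i); have := pD' (κ i)
    have : 0 ≤ 2 ^ (m + 1) * (D (κ i) * (2 ^ (m + 1) * C i)) := by positivity
    have : 0 ≤ 2 ^ (m' + 1) * C' i + 2 ^ (m' + 1) * (D' (κ i) * (2 ^ (m' + 1) * C' i)) := by
      positivity
    simp only [k]; linarith
  have b2 : ∀ i, 2 ^ (m + 1) * (D (κ i) * (2 ^ (m + 1) * (C i * c))) ≤
      (K₀ + ∑ i, k i) * c := fun i => by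
    refine le_trans (le_of_eq (by ring)) (mul_le_mul_of_nonneg_right (le_trans ?_ (hk i)) hc :
      2 ^ (m + 1) * (D (κ i) * (2 ^ (m + 1) * C i)) * c ≤ _)
    have := pC i; have := pC' i; have := pD (κ i); have := pD' (κ i)
    have : 0 ≤ 2 ^ (m + 1) * C i := by positivity
    have : 0 ≤ 2 ^ (m' + 1) * C' i + 2 ^ (m' + 1) * (D' (κ i) * (2 ^ (m' + 1) * C' i)) := by
      positivity
    simp only [k]; linarith
  have b1' : ∀ i, 2 ^ (m' + 1) * (C' i * c') ≤ (K₀ + ∑ i, k i) * c' := fun i => by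
    rw [← mul_assoc]
    refine mul_le_mul_of_nonneg_right (le_trans ?_ (hk i)) hc'
    have := pC i; have := pC' i; have := pD (κ i); have := pD' (κ i)
    have : 0 ≤ 2 ^ (m' + 1) * (D' (κ i) * (2 ^ (m' + 1) * C' i)) := by positivity
    have : 0 ≤ 2 ^ (m + 1) * C i + 2 ^ (m + 1) * (D (κ i) * (2 ^ (m + 1) * C i)) := by
      positivity
    simp only [k]; linarith
  have b2' : ∀ i, 2 ^ (m' + 1) * (D' (κ i) * (2 ^ (m' + 1) * (C' i * c'))) ≤
      (K₀ + ∑ i, k i) * c' := fun i => by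
    refine le_trans (le_of_eq (by ring)) (mul_le_mul_of_nonneg_right (le_trans ?_ (hk i)) hc' :
      2 ^ (m' + 1) * (D' (κ i) * (2 ^ (m' + 1) * C' i)) * c' ≤ _)
    have := pC i; have := pC' i; have := pD (κ i); have := pD' (κ i)
    have : 0 ≤ 2 ^ (m' + 1) * C' i := by positivity
    have : 0 ≤ 2 ^ (m + 1) * C i + 2 ^ (m + 1) * (D (κ i) * (2 ^ (m + 1) * C i)) := by
      positivity
    simp only [k]; linarith
  have rN := fun i => (hF.symb_mul (hC i)).mono le_rfl (b1 i)
  have rN' := fun i => (hH.symb_mul (hC' i)).mono le_rfl (b1' i)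
  have rP := fun i => (Reg.symb_mul (w := w) (r := 0) (hF.symb_mul (hC i)) (hD (κ i))).mono
    le_rfl (b2 i)
  have rP' := fun i => (Reg.symb_mul (w := w') (r := 0) (hH.symb_mul (hC' i)) (hD' (κ i))).mono
    le_rfl (b2' i)
  choose G hG rG using fun i => (rN i).2 (κ i)
  choose G' hG' rG' using fun i => (rN' i).2 (κ i)
  let T : Fin 6 → R2 → ℂ := fun i ζ =>
    form t (r + 1) (G i) (fun ξ => (n' i ξ : ℂ) * H ξ) ζ +
      form t (r + 1) (fun ξ => (n i ξ : ℂ) * F ξ) (G' i) ζ +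
    a * (form t (r + 2) (fun ξ => (vel ξ (κ i) : ℂ) * ((n i ξ : ℂ) * F ξ))
        (fun ξ => (n' i ξ : ℂ) * H ξ) ζ +
      form t (r + 2) (fun ξ => (n i ξ : ℂ) * F ξ)
        (fun ξ => (vel ξ (κ i) : ℂ) * ((n' i ξ : ℂ) * H ξ)) ζ)
  have hT : ∀ i, E (B + B + ‖a‖ * (B + B)) (T i) := fun i =>
    hE.add (hE.add (h1 _ _ (rG i) (rN' i)) (h2 _ _ (rN i) (rG' i)))
      (hE.smul a (hE.add (h3 _ _ (rP i) (rN' i)) (h3 _ _ (rN i) (rP' i))))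
  have hsum := hE.smul b (hE.add (hE.add (hE.add (hE.add (hE.add (hT 0) (hT 1)) (hT 2)) (hT 3))
    (hT 4)) (hT 5))
  refine hE.mono ?_ ((congrArg (E _) (funext fun ζ => ?_)).mp hsum)
  · have : 0 ≤ (∑ i, k i) * B := mul_nonneg pk' hB
    have e : ‖b‖ * (B + B + ‖a‖ * (B + B) + (B + B + ‖a‖ * (B + B)) + (B + B + ‖a‖ * (B + B)) +
        (B + B + ‖a‖ * (B + B)) + (B + B + ‖a‖ * (B + B)) + (B + B + ‖a‖ * (B + B))) = K₀ * B := by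
      simp only [K₀]; ring
    rw [e, add_mul]
    linarith
  · have id1 := form_sum_identity t r j hdec (fun i => (rN i).base.memLp)
      (fun i => (rN' i).base.memLp) ζ
    have id2 := fun i => form_vel_sub t (r + 1) (rN i).base (rN' i).base (rG i).base (rG' i).base
      (hG i) (hG' i) ζ
    have id3 : 2 * Real.pi * Complex.I * t * (2 * Real.pi * (ζ j : ℂ) * form t r F H ζ) =
        ∑ i, T i ζ := by
      rw [id1, Finset.mul_sum]
      refine Finset.sum_congr rfl fun i _ => ?_
      rw [id2 i]
      simp only [T, a]
      push_cast
      ring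
    rw [← Fin.sum_univ_six (fun i => T i ζ), ← id3]
    have : (Real.pi : ℂ) ≠ 0 := by exact_mod_cast Real.pi_ne_zero
    simp only [b]
    field_simp
    ring

/-! ### Forms as Fourier transforms of products -/

lemma continuous_fourier {f : R2 → ℂ} (hf : Integrable f) : Continuous (𝓕 f) :=
  VectorFourier.fourierIntegral_continuous Real.continuous_fourierChar
    (by exact continuous_inner) hf

lemma memLp_char_mul (u : L2) (ζ : R2) :
    MemLp (fun x => (Real.fourierChar (-inner ℝ x ζ) : ℂ) * u x) 2 volume := by
  refine memLp_bounded_mul (C := 1) ?_ (fun x => (Circle.norm_coe _).le) (Lp.memLp u)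
  exact continuous_subtype_val.comp (Real.continuous_fourierChar.comp
    (continuous_id.inner continuous_const).neg)

/-- On `L²` the Fourier transform takes a modulation to a translation. -/
lemma fourier_char_mul (u : L2) (ζ : R2) :
    ((𝓕 ((memLp_char_mul u ζ).toLp _) : L2) : R2 → ℂ) =ᵐ[volume] fun ξ => (𝓕 u : L2) (ζ + ξ) := by
  refine ae_eq_of_integral_contDiff_smul_eq (memLp_locallyIntegrable (Lp.memLp _))
    (memLp_locallyIntegrable (memLp_shift (Lp.memLp _) ζ)) fun g hg hc => ?_
  have hg' : ContDiff ℝ ∞ fun x => (g x : ℂ) := Complex.ofRealCLM.contDiff.comp hg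
  have hc' : HasCompactSupport fun x => (g x : ℂ) := hc.comp_left Complex.ofReal_zero
  have hs : ContDiff ℝ ∞ fun x => (g (x - ζ) : ℂ) := hg'.comp (contDiff_id.sub contDiff_const)
  have hsc : HasCompactSupport fun x => (g (x - ζ) : ℂ) :=
    hc'.comp_homeomorph (Homeomorph.subRight ζ)
  have h1 := integral_fourier_mul_eq ((memLp_char_mul u ζ).toLp _) (hc'.toSchwartzMap hg')
  have h2 := integral_fourier_mul_eq u (hsc.toSchwartzMap hs)
  change ∫ ξ, (g ξ : ℂ) * _ = ∫ ξ, (g ξ : ℂ) * _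
  change ∫ ξ, (g ξ : ℂ) * _ = ∫ x, 𝓕 (fun ξ => (g ξ : ℂ)) x * _ at h1
  change ∫ ξ, (g (ξ - ζ) : ℂ) * _ = ∫ x, 𝓕 (fun ξ => (g (ξ - ζ) : ℂ)) x * _ at h2
  rw [← integral_add_left_eq_self _ ζ] at h2
  simp only [add_sub_cancel_left] at h2
  rw [h1, h2]
  refine integral_congr_ae ?_
  filter_upwards [(memLp_char_mul u ζ).coeFn_toLp] with x hx
  rw [hx, ← mul_assoc]
  congr 1
  rw [Real.fourier_eq, Real.fourier_eq, ← integral_add_left_eq_self (fun v => _ • (g (v - ζ) : ℂ)) ζ,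
    ← integral_mul_const]
  congr 1; ext v
  simp only [add_sub_cancel_left, inner_add_left, neg_add, AddChar.map_add_eq_mul,
    Circle.smul_def, Circle.coe_mul, smul_eq_mul, real_inner_comm x ζ]
  ring

/-- The Fourier transform of `u v̄` is the correlation of the Fourier transforms. -/
lemma fourier_mul_conj (u v : L2) (ζ : R2) :
    𝓕 (fun x => u x * conj (v x)) ζ = ∫ η, (𝓕 u : L2) (ζ + η) * conj ((𝓕 v : L2) η) := by
  have h := integral_conj_mul_fourier (Lp.memLp v) (memLp_char_mul u ζ)
  rw [Lp.toLp_coeFn] at h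
  have e1 : (∫ ξ, conj ((𝓕 v : L2) ξ) * (𝓕 ((memLp_char_mul u ζ).toLp _) : L2) ξ) =
      ∫ η, (𝓕 u : L2) (ζ + η) * conj ((𝓕 v : L2) η) := by
    refine integral_congr_ae ?_
    filter_upwards [fourier_char_mul u ζ] with ξ hξ
    rw [hξ, mul_comm]
  rw [← e1, ← h, Real.fourier_eq]
  congr 1; ext x
  rw [Circle.smul_def, smul_eq_mul]
  ring

lemma integrable_mul_conj (u v : L2) : Integrable fun x => u x * conj (v x) :=
  memLp_mul_integrable (Lp.memLp u) (memLp_conj (Lp.memLp v))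

/-- The forms without weight, as Fourier transforms. -/
lemma form_zero_eq (t : ℝ) {F H : R2 → ℂ} (hF : MemLp F 2 volume) (hH : MemLp H 2 volume) :
    form t 0 F H = 𝓕 (fun x => (𝓕⁻ ((memLp_evo_mul t hF).toLp _) : L2) x *
      conj ((𝓕⁻ ((memLp_evo_mul t hH).toLp _) : L2) x)) := by
  ext ζ
  rw [fourier_mul_conj, FourierTransform.fourier_fourierInv_eq,
    FourierTransform.fourier_fourierInv_eq, form]
  refine integral_congr_ae ?_
  filter_upwards [(measurePreserving_add_left volume ζ).quasiMeasurePreserving.ae_eq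
    (memLp_evo_mul t hF).coeFn_toLp, (memLp_evo_mul t hH).coeFn_toLp] with η h1 h2
  simp only [Function.comp] at h1
  rw [h1, h2]
  simp only [formKernel, pow_zero, Complex.ofReal_one, one_mul, map_mul]
  ring

/-- By Plancherel, the form is the Fourier transform of a product in which one factor is bounded. -/
lemma eLpNorm_form_zero_le (t : ℝ) {F H : R2 → ℂ} (hF : MemLp F 2 volume) (hH : MemLp H 2 volume)
    {M : ℝ} (hb : ∀ᵐ x, ‖(𝓕⁻ ((memLp_evo_mul t hH).toLp _) : L2) x‖ ≤ M) :
    eLpNorm (form t 0 F H) 2 volume ≤ ENNReal.ofReal M * eLpNorm F 2 volume := by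
  rw [form_zero_eq t hF hH]
  set u : L2 := 𝓕⁻ ((memLp_evo_mul t hF).toLp _) with hu
  set v : L2 := 𝓕⁻ ((memLp_evo_mul t hH).toLp _) with hv
  have hle : ∀ᵐ x, ‖u x * conj (v x)‖ ≤ M * ‖u x‖ := by
    filter_upwards [hb] with x hx
    rw [norm_mul, RCLike.norm_conj, mul_comm]
    gcongr
  have hm : MemLp (fun x => u x * conj (v x)) 2 volume :=
    (Lp.memLp u).of_le_mul (integrable_mul_conj u v).1 hle
  rw [← eLpNorm_congr_ae (fourier_toLp_ae_eq (integrable_mul_conj u v) hm), eLpNorm_fourier,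
    eLpNorm_congr_ae hm.coeFn_toLp]
  refine (eLpNorm_le_mul_eLpNorm_of_ae_le_mul hle 2).trans ?_
  gcongr
  rw [hu, eLpNorm_fourierInv, eLpNorm_congr_ae (memLp_evo_mul t hF).coeFn_toLp]
  refine eLpNorm_mono fun ξ => ?_
  rw [norm_mul, norm_evo, one_mul]

/-! ### The Laplace representation of the weights -/

/-- `e^{-σ⟨2πξ⟩}` -/
noncomputable def expJap (σ : ℝ) (ξ : R2) : ℂ := ((Real.exp (-(σ * jap ξ)) : ℝ) : ℂ)

lemma integral_pow_mul_exp (n : ℕ) {S : ℝ} (hS : 0 < S) :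
    ∫ σ in Set.Ioi (0 : ℝ), σ ^ n * Real.exp (-(S * σ)) = n.factorial * S⁻¹ ^ (n + 1) := by
  have h := Real.integral_rpow_mul_exp_neg_mul_Ioi (a := n + 1) (by positivity) hS
  simp only [add_sub_cancel_right, Real.rpow_natCast, Real.Gamma_nat_eq_factorial] at h
  rw [h, one_div, ← Nat.cast_succ, Real.rpow_natCast, mul_comm]

lemma integrableOn_pow_mul_exp (n : ℕ) {S : ℝ} (hS : 0 < S) :
    IntegrableOn (fun σ => σ ^ n * Real.exp (-(S * σ))) (Set.Ioi (0 : ℝ)) := by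
  -- the integral of a function that is not integrable would be zero
  by_contra h
  have h1 := integral_undef h
  rw [integral_pow_mul_exp n hS] at h1
  have : (0 : ℝ) < n.factorial * S⁻¹ ^ (n + 1) := by positivity
  exact this.ne' h1

lemma continuous_expJap : Continuous fun p : ℝ × R2 => expJap p.1 p.2 := by
  have := continuous_jap
  unfold expJap
  fun_prop

lemma memLp_expJap_mul {σ : ℝ} (hσ : 0 ≤ σ) {F : R2 → ℂ} (hF : MemLp F 2 volume) :
    MemLp (fun ξ => expJap σ ξ * F ξ) 2 volume := by
  refine memLp_bounded_mul (C := 1) (continuous_expJap.comp (Continuous.prodMk_right σ))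
    (fun ξ => ?_) hF
  rw [expJap, Complex.norm_real, Real.norm_eq_abs, Real.abs_exp, Real.exp_le_one_iff]
  have := mul_nonneg hσ (jap_pos ξ).le
  linarith

/-- The integrand of a damped form, as a function of the damping and the frequencies. -/
noncomputable def dampedIntegrand (t : ℝ) (F H : R2 → ℂ) (σ : ℝ) (ζ η : R2) : ℂ :=
  formKernel t 0 ζ η * (expJap σ (ζ + η) * F (ζ + η) * conj (expJap σ η * H η))

lemma measurable_dampedIntegrand (t : ℝ) {F H : R2 → ℂ} (hF : Measurable F)
    (hH : Measurable H) : Measurable fun p : (ℝ × R2) × R2 =>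
      dampedIntegrand t F H p.1.1 p.1.2 p.2 := by
  have e := continuous_expJap.measurable
  have v := (contDiff_evo t).continuous.measurable
  have hadd : Measurable fun p : (ℝ × R2) × R2 => p.1.2 + p.2 := by fun_prop
  have e1 : Measurable fun p : (ℝ × R2) × R2 => expJap p.1.1 (p.1.2 + p.2) :=
    e.comp (measurable_fst.fst.prodMk hadd)
  have e2 : Measurable fun p : (ℝ × R2) × R2 => expJap p.1.1 p.2 :=
    e.comp (measurable_fst.fst.prodMk measurable_snd)
  have c : Measurable (starRingEnd ℂ) := Complex.continuous_conj.measurable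
  unfold dampedIntegrand formKernel
  simp only [pow_zero, Complex.ofReal_one, one_mul]
  exact ((v.comp hadd).mul (c.comp (v.comp measurable_snd))).mul
    ((e1.mul (hF.comp hadd)).mul (c.comp (e2.mul (hH.comp measurable_snd))))

lemma dampedIntegrand_eq (t : ℝ) (F H : R2 → ℂ) (σ : ℝ) (ζ η : R2) :
    dampedIntegrand t F H σ ζ η = ((Real.exp (-((jap (ζ + η) + jap η) * σ)) : ℝ) : ℂ) *
      (formKernel t 0 ζ η * (F (ζ + η) * conj (H η))) := by
  have : ((Real.exp (-((jap (ζ + η) + jap η) * σ)) : ℝ) : ℂ) = expJap σ (ζ + η) * expJap σ η := by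
    rw [expJap, expJap, ← Complex.ofReal_mul, ← Real.exp_add]
    congr 2; ring
  rw [this, dampedIntegrand, map_mul, expJap, expJap, Complex.conj_ofReal]
  ring

/-- A form with a negative power of `⟨a⟩ + ⟨b⟩` is a superposition of forms without weight of damped
functions. -/
lemma form_succ_eq (t : ℝ) (n : ℕ) {F H : R2 → ℂ} (hF : MemLp F 2 volume) (hH : MemLp H 2 volume)
    (mF : Measurable F) (mH : Measurable H) (ζ : R2) :
    (n.factorial : ℂ) * form t (n + 1) F H ζ = ∫ σ in Set.Ioi (0 : ℝ), ((σ ^ n : ℝ) : ℂ) *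
      form t 0 (fun ξ => expJap σ ξ * F ξ) (fun ξ => expJap σ ξ * H ξ) ζ := by
  have h1 : ∀ η, (n.factorial : ℂ) * (formKernel t (n + 1) ζ η * (F (ζ + η) * conj (H η))) =
      ∫ σ in Set.Ioi (0 : ℝ), ((σ ^ n : ℝ) : ℂ) * dampedIntegrand t F H σ ζ η := fun η => by
    simp only [dampedIntegrand_eq, ← mul_assoc]
    rw [integral_mul_const, integral_mul_const, integral_mul_const]
    simp only [← Complex.ofReal_mul]
    rw [integral_complex_ofReal, integral_pow_mul_exp n (jap_add_pos ζ η)]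
    simp only [formKernel, invSum]
    push_cast
    ring
  rw [form, ← integral_const_mul]
  simp only [h1]
  rw [integral_integral_swap]
  · congr 1; ext σ
    rw [integral_const_mul]
    rfl
  · have i1 : Integrable (fun p : R2 × ℝ => (F (ζ + p.1) * conj (H p.1)) *
        ((p.2 ^ n * Real.exp (-(2 * p.2)) : ℝ) : ℂ)) (volume.prod (volume.restrict (Set.Ioi 0))) :=
      (memLp_mul_integrable (memLp_shift hF ζ) (memLp_conj hH)).mul_prod
        (integrableOn_pow_mul_exp n two_pos).ofReal
    have hr : (volume : Measure R2).prod ((volume : Measure ℝ).restrict (Set.Ioi 0)) =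
        (volume.prod volume).restrict (Set.univ ×ˢ Set.Ioi 0) := by
      rw [← Measure.prod_restrict, Measure.restrict_univ]
    refine i1.mono ?_ ?_
    · refine Measurable.aestronglyMeasurable ?_
      have := (measurable_dampedIntegrand t mF mH).comp
        ((measurable_snd.prodMk measurable_const).prodMk measurable_fst :
          Measurable fun p : R2 × ℝ => ((p.2, ζ), p.1))
      exact (Complex.measurable_ofReal.comp (measurable_snd.pow_const n)).mul this
    · rw [hr]
      refine ae_restrict_of_forall_mem (MeasurableSet.univ.prod measurableSet_Ioi) fun p hp => ?_
      have hσ : 0 < p.2 := hp.2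
      simp only [Function.uncurry]
      rw [dampedIntegrand_eq]
      have e1 : Real.exp (-((jap (ζ + p.1) + jap p.1) * p.2)) ≤ Real.exp (-(2 * p.2)) := by
        have h2 : 2 ≤ jap (ζ + p.1) + jap p.1 := by
          linarith [one_le_jap (ζ + p.1), one_le_jap p.1]
        have := mul_le_mul_of_nonneg_right h2 hσ.le
        exact Real.exp_le_exp.2 (by linarith)
      have e2 := norm_formKernel_le t 0 ζ p.1
      have e3 : ∀ x : ℝ, 0 ≤ x → ‖((x : ℝ) : ℂ)‖ = x := fun x hx => by
        rw [Complex.norm_real, Real.norm_eq_abs, abs_of_nonneg hx]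
      have h0 : 0 ≤ p.2 ^ n := pow_nonneg hσ.le n
      rw [norm_mul, norm_mul, norm_mul, norm_mul _ ((p.2 ^ n * Real.exp (-(2 * p.2)) : ℝ) : ℂ),
        e3 _ h0, e3 _ (Real.exp_pos _).le, e3 _ (mul_nonneg h0 (Real.exp_pos _).le)]
      have hp := norm_nonneg (F (ζ + p.1) * conj (H p.1))
      calc p.2 ^ n * (Real.exp (-((jap (ζ + p.1) + jap p.1) * p.2)) *
            (‖formKernel t 0 ζ p.1‖ * ‖F (ζ + p.1) * conj (H p.1)‖)) ≤
          p.2 ^ n * (Real.exp (-(2 * p.2)) * (1 * ‖F (ζ + p.1) * conj (H p.1)‖)) := by gcongr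
        _ = _ := by ring

lemma eLpNorm_two_sq {f : R2 → ℂ} : eLpNorm f 2 volume ^ 2 = ∫⁻ ζ, ‖f ζ‖ₑ ^ 2 := by
  rw [eLpNorm_eq_lintegral_rpow_enorm_toReal two_ne_zero ENNReal.ofNat_ne_top, ← ENNReal.rpow_two,
    ← ENNReal.rpow_mul]
  simp

/-- The Cauchy-Schwarz inequality on the half line, with exponential weights. -/
lemma lintegral_pow_mul_sq_le (n : ℕ) {g : ℝ → ℝ≥0∞} (hg : Measurable g) :
    (∫⁻ σ in Set.Ioi (0 : ℝ), ENNReal.ofReal (σ ^ n) * g σ) ^ 2 ≤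
      ENNReal.ofReal (2 * n).factorial *
        ∫⁻ σ in Set.Ioi (0 : ℝ), ENNReal.ofReal (Real.exp σ) * g σ ^ 2 := by
  let μ : Measure ℝ := volume.restrict (Set.Ioi 0)
  let a : ℝ → ℝ≥0∞ := fun σ => ENNReal.ofReal (σ ^ n * Real.exp (-(σ / 2)))
  let b : ℝ → ℝ≥0∞ := fun σ => ENNReal.ofReal (Real.exp (σ / 2)) * g σ
  have ma : Measurable a := by fun_prop
  have mb : Measurable b := by fun_prop
  have h1 : ∫⁻ σ in Set.Ioi (0 : ℝ), ENNReal.ofReal (σ ^ n) * g σ = ∫⁻ σ, (a * b) σ ∂μ := by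
    refine setLIntegral_congr_fun measurableSet_Ioi fun σ hσ => ?_
    have hσ' : (0 : ℝ) < σ := hσ
    simp only [Pi.mul_apply, a, b]
    rw [← mul_assoc, ← ENNReal.ofReal_mul (by positivity), mul_assoc, ← Real.exp_add,
      neg_add_cancel, Real.exp_zero, mul_one]
  have h2 := ENNReal.lintegral_mul_le_Lp_mul_Lq μ Real.HolderConjugate.two_two
    ma.aemeasurable mb.aemeasurable
  have ha : ∫⁻ σ, a σ ^ (2 : ℝ) ∂μ = ENNReal.ofReal (2 * n).factorial := by
    have h3 := integral_pow_mul_exp (2 * n) one_pos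
    have h4 := integrableOn_pow_mul_exp (2 * n) one_pos
    rw [inv_one, one_pow, mul_one] at h3
    rw [← h3, ofReal_integral_eq_lintegral_ofReal h4]
    · refine setLIntegral_congr_fun measurableSet_Ioi fun σ hσ => ?_
      have hσ' : (0 : ℝ) < σ := hσ
      simp only [a]
      rw [ENNReal.rpow_two, ← ENNReal.ofReal_pow (by positivity), mul_pow, ← pow_mul,
        ← Real.exp_nat_mul]
      congr 3
      · ring
      · push_cast; ring
    · refine ae_restrict_of_forall_mem measurableSet_Ioi fun σ hσ => ?_
      have hσ' : (0 : ℝ) < σ := hσ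
      simp only [Pi.zero_apply]
      positivity
  have hb : ∫⁻ σ, b σ ^ (2 : ℝ) ∂μ = ∫⁻ σ, ENNReal.ofReal (Real.exp σ) * g σ ^ 2 ∂μ := by
    refine lintegral_congr fun σ => ?_
    simp only [b]
    rw [ENNReal.rpow_two, mul_pow, ← ENNReal.ofReal_pow (by positivity), ← Real.exp_nat_mul]
    congr 3
    push_cast; ring
  rw [ha, hb] at h2
  rw [h1]
  refine (pow_le_pow_left' h2 2).trans (le_of_eq ?_)
  rw [mul_pow, ← ENNReal.rpow_two, ← ENNReal.rpow_two, ← ENNReal.rpow_mul, ← ENNReal.rpow_mul]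
  norm_num [μ]

lemma measurable_damped (t : ℝ) {F H : R2 → ℂ} (mF : Measurable F) (mH : Measurable H) :
    Measurable fun p : ℝ × R2 =>
      form t 0 (fun ξ => expJap p.1 ξ * F ξ) (fun ξ => expJap p.1 ξ * H ξ) p.2 :=
  (StronglyMeasurable.integral_prod_right' (ν := (volume : Measure R2))
    (measurable_dampedIntegrand t mF mH).stronglyMeasurable).measurable

lemma measurable_integral_pow_mul (n : ℕ) {q : ℝ → R2 → ℂ}
    (hq : Measurable fun p : ℝ × R2 => q p.1 p.2) :
    Measurable fun ζ => ∫ σ in Set.Ioi (0 : ℝ), ((σ ^ n : ℝ) : ℂ) * q σ ζ := by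
  have h1 : Measurable fun p : R2 × ℝ => ((p.2 ^ n : ℝ) : ℂ) * q p.2 p.1 :=
    (Complex.measurable_ofReal.comp (measurable_snd.pow_const n)).mul (hq.comp measurable_swap)
  exact (StronglyMeasurable.integral_prod_right' (ν := volume.restrict (Set.Ioi (0 : ℝ)))
    h1.stronglyMeasurable).measurable

lemma measurable_form_succ (t : ℝ) (n : ℕ) {F H : R2 → ℂ} (hF : MemLp F 2 volume)
    (hH : MemLp H 2 volume) (mF : Measurable F) (mH : Measurable H) :
    Measurable (form t (n + 1) F H) := by
  have h2 : form t (n + 1) F H = fun ζ => (n.factorial : ℂ)⁻¹ *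
      ∫ σ in Set.Ioi (0 : ℝ), ((σ ^ n : ℝ) : ℂ) *
        form t 0 (fun ξ => expJap σ ξ * F ξ) (fun ξ => expJap σ ξ * H ξ) ζ := by
    ext ζ
    rw [← form_succ_eq t n hF hH mF mH, inv_mul_cancel_left₀ (by exact_mod_cast n.factorial_ne_zero)]
  rw [h2]
  exact measurable_const.mul (measurable_integral_pow_mul n (q := fun σ =>
    form t 0 (fun ξ => expJap σ ξ * F ξ) (fun ξ => expJap σ ξ * H ξ)) (measurable_damped t mF mH))

/-- The pointwise square is kept under the integral in `σ`, so that the `L²` norm in `ζ` can be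
taken for every damping separately. -/
lemma sq_enorm_form_succ_le (t : ℝ) (n : ℕ) {F H : R2 → ℂ} (hF : MemLp F 2 volume)
    (hH : MemLp H 2 volume) (mF : Measurable F) (mH : Measurable H) (ζ : R2) :
    ‖form t (n + 1) F H ζ‖ₑ ^ 2 ≤ ENNReal.ofReal (2 * n).factorial *
      ∫⁻ σ in Set.Ioi (0 : ℝ), ENNReal.ofReal (Real.exp σ) *
        ‖form t 0 (fun ξ => expJap σ ξ * F ξ) (fun ξ => expJap σ ξ * H ξ) ζ‖ₑ ^ 2 := by
  have hfac : (1 : ℝ) ≤ n.factorial := by exact_mod_cast n.factorial_pos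
  have h0 : ‖form t (n + 1) F H ζ‖ₑ ≤ ‖(n.factorial : ℂ) * form t (n + 1) F H ζ‖ₑ := by
    rw [enorm_le_iff_norm_le, norm_mul, Complex.norm_natCast]
    exact le_mul_of_one_le_left (norm_nonneg _) hfac
  have h1 : ‖(n.factorial : ℂ) * form t (n + 1) F H ζ‖ₑ ≤
      ∫⁻ σ in Set.Ioi (0 : ℝ), ENNReal.ofReal (σ ^ n) *
        ‖form t 0 (fun ξ => expJap σ ξ * F ξ) (fun ξ => expJap σ ξ * H ξ) ζ‖ₑ := by
    rw [form_succ_eq t n hF hH mF mH]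
    refine (enorm_integral_le_lintegral_enorm _).trans (le_of_eq ?_)
    refine setLIntegral_congr_fun measurableSet_Ioi fun σ hσ => ?_
    have hσ' : (0 : ℝ) < σ := hσ
    rw [enorm_mul, ← ofReal_norm ((σ ^ n : ℝ) : ℂ), Complex.norm_real,
      Real.norm_eq_abs, abs_of_nonneg (by positivity)]
  refine (pow_le_pow_left' (h0.trans h1) 2).trans (lintegral_pow_mul_sq_le n ?_)
  exact ((measurable_damped t mF mH).comp (measurable_id.prodMk measurable_const)).enorm

/-- `L²` bounds of the damped forms without weight give an `L²` bound of the forms with weight. -/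
lemma eLpNorm_form_succ_le (t : ℝ) (n : ℕ) {F H : R2 → ℂ} (hF : MemLp F 2 volume)
    (hH : MemLp H 2 volume) (mF : Measurable F) (mH : Measurable H) {κ : ℝ} (hκ : 0 ≤ κ)
    (hb : ∀ σ : ℝ, 0 < σ →
      eLpNorm (form t 0 (fun ξ => expJap σ ξ * F ξ) (fun ξ => expJap σ ξ * H ξ)) 2 volume ≤
        ENNReal.ofReal (κ * Real.exp (-σ))) :
    AEStronglyMeasurable (form t (n + 1) F H) volume ∧
      eLpNorm (form t (n + 1) F H) 2 volume ≤ ENNReal.ofReal ((2 * n).factorial * κ) := by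
  let q : ℝ → R2 → ℂ := fun σ => form t 0 (fun ξ => expJap σ ξ * F ξ) (fun ξ => expJap σ ξ * H ξ)
  have hq : Measurable fun p : ℝ × R2 => q p.1 p.2 := measurable_damped t mF mH
  refine ⟨(measurable_form_succ t n hF hH mF mH).aestronglyMeasurable, ?_⟩
  have hsq : eLpNorm (form t (n + 1) F H) 2 volume ^ 2 ≤
      ENNReal.ofReal ((2 * n).factorial * κ) ^ 2 := by
    rw [eLpNorm_two_sq]
    refine (lintegral_mono (sq_enorm_form_succ_le t n hF hH mF mH)).trans ?_
    have hm : Measurable fun p : R2 × ℝ => ENNReal.ofReal (Real.exp p.2) * ‖q p.2 p.1‖ₑ ^ 2 :=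
      (by fun_prop : Measurable fun p : R2 × ℝ => ENNReal.ofReal (Real.exp p.2)).mul
        ((hq.comp measurable_swap).enorm.pow_const 2)
    rw [lintegral_const_mul _ hm.lintegral_prod_right', lintegral_lintegral_swap hm.aemeasurable]
    -- the decay `e^{-2σ}` of the squares absorbs the weight `e^σ`
    have hin : ∀ σ ∈ Set.Ioi (0 : ℝ), ∫⁻ ζ, ENNReal.ofReal (Real.exp σ) * ‖q σ ζ‖ₑ ^ 2 ≤
        ENNReal.ofReal (κ ^ 2) * ENNReal.ofReal (σ ^ 0 * Real.exp (-(1 * σ))) := fun σ hσ => by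
      have mσ : Measurable fun ζ => ‖q σ ζ‖ₑ ^ 2 :=
        (hq.comp (measurable_const.prodMk measurable_id)).enorm.pow_const 2
      rw [lintegral_const_mul _ mσ, ← eLpNorm_two_sq, ← ENNReal.ofReal_mul (by positivity)]
      refine (mul_le_mul_right (pow_le_pow_left' (hb σ hσ) 2) _).trans (le_of_eq ?_)
      rw [← ENNReal.ofReal_pow (by positivity), ← ENNReal.ofReal_mul (by positivity), mul_pow,
        ← Real.exp_nat_mul, mul_left_comm, ← Real.exp_add, pow_zero, one_mul]
      congr 3
      push_cast; ring
    refine (mul_le_mul_right (setLIntegral_mono' measurableSet_Ioi hin) _).trans ?_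
    rw [lintegral_const_mul _ (by fun_prop), ← ofReal_integral_eq_lintegral_ofReal
      (integrableOn_pow_mul_exp 0 one_pos), integral_pow_mul_exp 0 one_pos,
      ← ENNReal.ofReal_mul (by positivity), ← ENNReal.ofReal_mul (by positivity),
      ← ENNReal.ofReal_pow (by positivity)]
    · refine ENNReal.ofReal_le_ofReal ?_
      have h1 : (1 : ℝ) ≤ (2 * n).factorial := by exact_mod_cast (2 * n).factorial_pos
      have : 0 ≤ κ ^ 2 := sq_nonneg κ
      simp only [Nat.factorial_zero, Nat.cast_one, inv_one, one_pow, mul_one]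
      nlinarith [mul_le_mul_of_nonneg_right h1 (by positivity : 0 ≤ ((2 * n).factorial : ℝ) * κ ^ 2)]
    · refine ae_restrict_of_forall_mem measurableSet_Ioi fun σ _ => ?_
      simp only [Pi.zero_apply]
      positivity
  exact (ENNReal.pow_le_pow_left_iff two_ne_zero).1 hsq

/-! ### Bilinear estimates -/

lemma WBound.congr {w : ℕ} {c : ℝ} {F F' : R2 → ℂ} (h : WBound w c F) (hF : F =ᵐ[volume] F') :
    WBound w c F' := by
  refine ⟨h.nonneg, (memLp_congr_ae hF).1 h.memLp, le_trans (le_of_eq ?_) h.le⟩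
  refine eLpNorm_congr_ae ?_
  filter_upwards [hF] with ξ hξ
  rw [hξ]

lemma Reg.congr {m w : ℕ} {c : ℝ} {F F' : R2 → ℂ} (h : Reg m w c F) (hF : F =ᵐ[volume] F') :
    Reg m w c F' := by
  cases m with
  | zero => exact WBound.congr h hF
  | succ m =>
    refine ⟨h.1.congr hF, fun k => ?_⟩
    obtain ⟨G, h1, h2⟩ := h.2 k
    exact ⟨G, h1.congr hF (ae_eq_refl G), h2⟩

/-- The bilinear estimate: in physical space one factor is bounded in `L²` and the other one decays
in `L^∞`. The order of the form has to be positive, since the weight is removed by the Laplace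
representation. -/
lemma exists_eLpNorm_form_le (n : ℕ) : ∃ C : ℝ, 0 ≤ C ∧ ∀ t : ℝ, 0 < t →
    ∀ (c c' : ℝ) (F H : R2 → ℂ), WBound 0 c F → Reg 2 4 c' H →
      AEStronglyMeasurable (form t (n + 1) F H) volume ∧
        eLpNorm (form t (n + 1) F H) 2 volume ≤ ENNReal.ofReal (C * (c * c') / t) := by
  obtain ⟨C₁, hC₁, hdisp⟩ := exists_dispersive
  obtain ⟨C₂, hexp⟩ := exists_symb_exp 2 0
  have hC₂ : 0 ≤ C₂ := (hexp 0 le_rfl).nonneg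
  refine ⟨(2 * n).factorial * (C₁ * (2 ^ 2 * C₂)), by positivity, fun t ht c c' F H hF hH => ?_⟩
  have hc := hF.nonneg
  have hc' := hH.base.nonneg
  have mF := hF.memLp
  have mH := hH.base.memLp
  -- Fubini's theorem in the damping parameter needs measurable representatives
  have eF := mF.1.ae_eq_mk
  have eH := mH.1.ae_eq_mk
  set F' := mF.1.mk F
  set H' := mH.1.mk H
  have mF' : MemLp F' 2 volume := (memLp_congr_ae eF).1 mF
  have mH' : MemLp H' 2 volume := (memLp_congr_ae eH).1 mH
  have key := eLpNorm_form_succ_le t n mF' mH' mF.1.stronglyMeasurable_mk.measurable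
    mH.1.stronglyMeasurable_mk.measurable (κ := C₁ * (2 ^ 2 * (C₂ * c')) / t * c) (by positivity)
    fun σ hσ => by
      have hR : Reg 2 4 (2 ^ 2 * (C₂ * c')) fun ξ => expJap σ ξ * H' ξ := by
        have h1 : Symb 2 0 C₂ (expJap σ) := by
          refine (congrArg (Symb 2 0 C₂) ?_).mp (hexp σ hσ.le)
          ext ξ
          rw [expJap, pow_zero, one_mul]
        exact Reg.symb_mul (w := 4) (r := 0) (hH.congr eH) h1
      refine (eLpNorm_form_zero_le t (memLp_expJap_mul hσ.le mF') (memLp_expJap_mul hσ.le mH')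
        (hdisp t ht _ _ hR _)).trans ?_
      rw [mul_assoc _ c, ENNReal.ofReal_mul (p := C₁ * (2 ^ 2 * (C₂ * c')) / t) (by positivity)]
      gcongr
      rw [mul_comm c, ENNReal.ofReal_mul (Real.exp_pos _).le]
      refine (eLpNorm_le_mul_eLpNorm_of_ae_le_mul (g := F') (c := Real.exp (-σ))
        (Eventually.of_forall fun ξ => ?_) 2).trans ?_
      · rw [norm_mul, expJap, Complex.norm_real, Real.norm_eq_abs, Real.abs_exp]
        gcongr
        exact le_mul_of_one_le_right hσ.le (one_le_jap ξ)
      · gcongr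
        exact (hF.congr eF).eLpNorm_le
  rw [form_congr t (n + 1) eF eH]
  refine ⟨key.1, key.2.trans (ENNReal.ofReal_le_ofReal (le_of_eq ?_))⟩
  ring

/-- Functions of frequency that are, up to an error bounded by `c/|ζ|`, bounded by `c` in `L²`. On a
dyadic annulus of the plane both parts have `L²` norm `O(c)`. -/
def SplitBound (c : ℝ) (q : R2 → ℂ) : Prop :=
  ∃ S : R2 → ℂ, AEStronglyMeasurable S volume ∧ eLpNorm S 2 volume ≤ ENNReal.ofReal c ∧
    ∀ ζ, ‖ζ‖ * ‖q ζ - S ζ‖ ≤ c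

lemma SplitBound.nonneg {c : ℝ} {q : R2 → ℂ} (h : SplitBound c q) : 0 ≤ c := by
  obtain ⟨S, -, -, h⟩ := h
  simpa using h 0

lemma SplitBound.mono {c c' : ℝ} {q : R2 → ℂ} (hc : c ≤ c') (h : SplitBound c q) :
    SplitBound c' q := by
  obtain ⟨S, h1, h2, h3⟩ := h
  exact ⟨S, h1, h2.trans (ENNReal.ofReal_le_ofReal hc), fun ζ => (h3 ζ).trans hc⟩

lemma isBoundClass_splitBound : IsBoundClass SplitBound where
  mono := SplitBound.mono
  add := by
    intro c c' q q' h h'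
    have hc := h.nonneg
    have hc' := h'.nonneg
    obtain ⟨S, h1, h2, h3⟩ := h
    obtain ⟨S', h1', h2', h3'⟩ := h'
    refine ⟨fun ζ => S ζ + S' ζ, h1.add h1', ?_, fun ζ => ?_⟩
    · rw [ENNReal.ofReal_add hc hc']
      exact (eLpNorm_add_le h1 h1' (by norm_num)).trans (add_le_add h2 h2')
    · rw [add_sub_add_comm]
      calc _ ≤ ‖ζ‖ * (‖q ζ - S ζ‖ + ‖q' ζ - S' ζ‖) := by gcongr; exact norm_add_le _ _
        _ ≤ _ := by rw [mul_add]; exact add_le_add (h3 ζ) (h3' ζ)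
  smul := by
    rintro a c q ⟨S, h1, h2, h3⟩
    refine ⟨fun ζ => a * S ζ, h1.const_mul a, ?_, fun ζ => ?_⟩
    · rw [ENNReal.ofReal_mul (norm_nonneg a)]
      refine (eLpNorm_le_mul_eLpNorm_of_ae_le_mul (g := S) (c := ‖a‖)
        (Eventually.of_forall fun ξ => (norm_mul _ _).le) 2).trans ?_
      gcongr
    · rw [← mul_sub, norm_mul, mul_left_comm]
      gcongr
      exact h3 ζ

lemma SplitBound.conj_neg {c : ℝ} {q : R2 → ℂ} (h : SplitBound c q) :
    SplitBound c fun ζ => conj (q (-ζ)) := by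
  obtain ⟨S, h1, h2, h3⟩ := h
  have hmp := Measure.measurePreserving_neg (volume : Measure R2)
  refine ⟨fun ζ => conj (S (-ζ)), Complex.continuous_conj.comp_aestronglyMeasurable
    (h1.comp_measurePreserving hmp), ?_, fun ζ => ?_⟩
  · rw [eLpNorm_congr_norm_ae (g := S ∘ Neg.neg) (Eventually.of_forall fun η => by simp),
      eLpNorm_comp_measurePreserving h1 hmp]
    exact h2
  · rw [← map_sub, RCLike.norm_conj, ← norm_neg ζ]
    exact h3 (-ζ)

lemma SplitBound.of_eLpNorm {c : ℝ} {q : R2 → ℂ} (hc : 0 ≤ c) (h1 : AEStronglyMeasurable q volume)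
    (h2 : eLpNorm q 2 volume ≤ ENNReal.ofReal c) : SplitBound c q :=
  ⟨q, h1, h2, fun ζ => by simpa using hc⟩

lemma SplitBound.of_norm_mul_le {c : ℝ} {q : R2 → ℂ} (h : ∀ ζ, ‖ζ‖ * ‖q ζ‖ ≤ c) :
    SplitBound c q :=
  ⟨0, aestronglyMeasurable_zero, by simp, fun ζ => by simpa using h ζ⟩

lemma norm_le_add_coord (ζ : R2) : ‖ζ‖ ≤ |ζ 0| + |ζ 1| := by
  rw [EuclideanSpace.norm_eq, Fin.sum_univ_two, Real.sqrt_le_iff]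
  refine ⟨by positivity, ?_⟩
  rw [Real.norm_eq_abs, Real.norm_eq_abs]
  nlinarith [abs_nonneg (ζ 0), abs_nonneg (ζ 1), mul_nonneg (abs_nonneg (ζ 0)) (abs_nonneg (ζ 1))]

/-- A form of two functions with one weak derivative each does not allow for the dispersive
estimate. One more integration by parts gives the factor `t⁻¹`, at the price of `|ζ|⁻¹`. -/
lemma exists_norm_mul_form_le (r : ℕ) : ∃ C : ℝ, 0 ≤ C ∧ ∀ t : ℝ, 0 < t →
    ∀ (c c' : ℝ) (F H : R2 → ℂ), Reg 1 2 c F → Reg 1 2 c' H →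
      ∀ ζ, ‖ζ‖ * ‖form t r F H ζ‖ ≤ C * (c * c') / t := by
  have hE : IsBoundClass fun c q => ∀ ζ : R2, ‖(q ζ : ℂ)‖ ≤ c :=
    ⟨fun hc h ζ => (h ζ).trans hc, fun h h' ζ => (norm_add_le _ _).trans (add_le_add (h ζ) (h' ζ)),
      fun a _ _ h ζ => by rw [norm_mul]; gcongr; exact h ζ⟩
  choose K hK hstep using exists_step r 0 0
  refine ⟨K 0 * (K 0 * K 0) + K 1 * (K 1 * K 1), ?_, fun t ht c c' F H hF hH ζ => ?_⟩
  · have := hK 0; have := hK 1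
    positivity
  have hc := hF.base.nonneg
  have hc' := hH.base.nonneg
  have key : ∀ j, ‖(t : ℂ) * (ζ j : ℂ) * form t r F H ζ‖ ≤ K j * (K j * c * (K j * c')) := fun j => by
    have := hK j
    exact hstep j _ hE t 0 0 c c' (K j * c * (K j * c')) F H (by positivity) hF hH
      (fun G N h1 h2 => norm_form_le t _ h1.base h2.base)
      (fun G N h1 h2 => norm_form_le t _ h1.base h2.base)
      (fun G N h1 h2 => norm_form_le t _ h1.base h2.base) ζ
  have k0 := key 0
  have k1 := key 1
  simp only [norm_mul, Complex.norm_real, Real.norm_eq_abs, abs_of_pos ht] at k0 k1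
  rw [le_div_iff₀ ht]
  calc ‖ζ‖ * ‖form t r F H ζ‖ * t ≤ (|ζ 0| + |ζ 1|) * ‖form t r F H ζ‖ * t := by
        gcongr; exact norm_le_add_coord ζ
    _ = t * |ζ 0| * ‖form t r F H ζ‖ + t * |ζ 1| * ‖form t r F H ζ‖ := by ring
    _ ≤ _ := by linarith

/-- One integration by parts when the second factor has a derivative to spare. If the derivative falls on
the first factor or on the weight, the bilinear estimate applies to the result; if it falls on the
second one, both factors are left with one derivative, and `exists_norm_mul_form_le` applies. -/
lemma exists_splitBound_coord_mul_form (r : ℕ) (j : Fin 2) : ∃ C : ℝ, 0 ≤ C ∧ ∀ t : ℝ, 0 < t →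
    ∀ (c c' : ℝ) (F H : R2 → ℂ), Reg 1 4 c F → Reg 2 6 c' H →
      SplitBound (C * (c * c') / t) fun ζ => (t : ℂ) * (ζ j : ℂ) * form t r F H ζ := by
  obtain ⟨K, hK, hstep⟩ := exists_step r 0 1 j
  obtain ⟨C₁, hC₁, h1⟩ := exists_eLpNorm_form_le r
  obtain ⟨C₂, hC₂, h2⟩ := exists_eLpNorm_form_le (r + 1)
  obtain ⟨C₃, hC₃, h3⟩ := exists_norm_mul_form_le (r + 1)
  refine ⟨K * ((C₁ + C₂ + C₃) * (K * K)), by positivity, fun t ht c c' F H hF hH => ?_⟩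
  have hc := hF.base.nonneg
  have hc' := hH.base.nonneg
  have le : ∀ C, 0 ≤ C → C ≤ C₁ + C₂ + C₃ →
      C * (K * c * (K * c')) / t ≤ (C₁ + C₂ + C₃) * (K * c * (K * c')) / t := fun C _ h => by
    gcongr
  have := hstep _ isBoundClass_splitBound t 2 4 c c' ((C₁ + C₂ + C₃) * (K * c * (K * c')) / t) F H
    (by positivity) hF hH
    (fun G N hG hN => SplitBound.mono (le C₁ hC₁ (by linarith)) <| by
      have := h1 t ht _ _ G N (hG.base.mono (Nat.zero_le _) le_rfl) hN
      exact .of_eLpNorm (by positivity) this.1 this.2)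
    (fun N G hN hG => SplitBound.mono (le C₃ hC₃ (by linarith)) <|
      .of_norm_mul_le (h3 t ht _ _ N G hN (hG.mono (by norm_num) le_rfl)))
    (fun G N hG hN => SplitBound.mono (le C₂ hC₂ (by linarith)) <| by
      have := h2 t ht _ _ G N (hG.base.mono (Nat.zero_le _) le_rfl) hN
      exact .of_eLpNorm (by positivity) this.1 this.2)
  exact SplitBound.mono (le_of_eq (by ring)) this

lemma exists_splitBound_coord_mul_form_swap (r : ℕ) (j : Fin 2) : ∃ C : ℝ, 0 ≤ C ∧
    ∀ t : ℝ, 0 < t → ∀ (c c' : ℝ) (F H : R2 → ℂ), Reg 2 6 c F → Reg 1 4 c' H →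
      SplitBound (C * (c * c') / t) fun ζ => (t : ℂ) * (ζ j : ℂ) * form t r F H ζ := by
  obtain ⟨C, hC, h⟩ := exists_splitBound_coord_mul_form r j
  refine ⟨C, hC, fun t ht c c' F H hF hH => ?_⟩
  have h1 := isBoundClass_splitBound.smul (-1) (h t ht c' c H F hH hF).conj_neg
  rw [norm_neg, norm_one, one_mul, mul_comm c'] at h1
  refine (congrArg (SplitBound _) ?_).mp h1
  ext ζ
  rw [form_conj_swap]
  simp

/-- Two integrations by parts: every one gains a factor `t⁻¹`, and the dispersive decay of one of the
factors gains the third one. -/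
theorem exists_splitBound_coord_sq_mul_form (j : Fin 2) : ∃ C : ℝ, 0 ≤ C ∧ ∀ t : ℝ, 0 < t →
    ∀ (c c' : ℝ) (F H : R2 → ℂ), Reg 2 8 c F → Reg 2 8 c' H →
      SplitBound (C * (c * c') / t) fun ζ => (t : ℂ) * (ζ j : ℂ) *
        ((t : ℂ) * (ζ j : ℂ) * form t 0 F H ζ) := by
  obtain ⟨K, hK, hstep⟩ := exists_step 0 1 1 j
  obtain ⟨C₁, hC₁, h1⟩ := exists_splitBound_coord_mul_form 1 j
  obtain ⟨C₂, hC₂, h2⟩ := exists_splitBound_coord_mul_form_swap 1 j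
  obtain ⟨C₃, hC₃, h3⟩ := exists_splitBound_coord_mul_form 2 j
  refine ⟨K * ((C₁ + C₂ + C₃) * (K * K)), by positivity, fun t ht c c' F H hF hH => ?_⟩
  have hc := hF.base.nonneg
  have hc' := hH.base.nonneg
  have le : ∀ C, 0 ≤ C → C ≤ C₁ + C₂ + C₃ →
      C * (K * c * (K * c')) / t ≤ (C₁ + C₂ + C₃) * (K * c * (K * c')) / t := fun C _ h => by
    gcongr
  have hE : IsBoundClass fun c q => SplitBound c fun ζ => (t : ℂ) * (ζ j : ℂ) * q ζ :=
    ⟨fun hc h => SplitBound.mono hc h, fun h h' => by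
      simp only [mul_add]; exact isBoundClass_splitBound.add h h', fun a _ _ h => by
      simp only [mul_left_comm _ a]; exact isBoundClass_splitBound.smul a h⟩
  have := hstep _ hE t 6 6 c c' ((C₁ + C₂ + C₃) * (K * c * (K * c')) / t) F H
    (by positivity) hF hH
    (fun G N hG hN => SplitBound.mono (le C₁ hC₁ (by linarith)) <|
      h1 t ht _ _ G N (hG.mono (by norm_num) le_rfl) hN)
    (fun N G hN hG => SplitBound.mono (le C₂ hC₂ (by linarith)) <|
      h2 t ht _ _ N G hN (hG.mono (by norm_num) le_rfl))
    (fun N N' hN hN' => SplitBound.mono (le C₃ hC₃ (by linarith)) <|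
      h3 t ht _ _ N N' (hN.pred.mono (by norm_num) le_rfl) hN')
  exact SplitBound.mono (le_of_eq (by ring)) this

/-! ### High frequencies and Littlewood-Paley projections -/

lemma absSq_eq (u : L2) : absSq u = fun x => u x * conj (u x) := by
  ext x
  rw [absSq, Complex.mul_conj']
  push_cast; rfl

lemma integrable_absSq (u : L2) : Integrable (absSq u) := by
  rw [absSq_eq]; exact integrable_mul_conj u u

/-- The Fourier transform of the density as a form of the profile. -/
lemma fourier_absSq_eq_form (t : ℝ) (u : L2) :
    𝓕 (absSq u) = form t 0 (𝓕 (propagator t u) : L2) (𝓕 (propagator t u) : L2) := by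
  ext ζ
  have h := fourier_eq_evo_mul t u
  rw [absSq_eq, fourier_mul_conj, form]
  refine integral_congr_ae ?_
  filter_upwards [(measurePreserving_add_left volume ζ).quasiMeasurePreserving.ae_eq h, h]
    with η h1 h2
  simp only [Function.comp] at h1
  rw [h1, h2]
  simp only [formKernel, pow_zero, Complex.ofReal_one, one_mul, map_mul]
  ring

lemma bracket_sub_le (x y : R2) : bracket (x - y) ≤ bracket x + bracket y := by
  have hx := bracket_pos x
  have hy := bracket_pos y
  have ex := bracket_sq x
  have ey := bracket_sq y
  refine abs_le_of_sq_le_sq' ?_ (by positivity) |>.2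
  have h1 : ‖x - y‖ ^ 2 ≤ (‖x‖ + ‖y‖) ^ 2 := by gcongr; exact norm_sub_le x y
  have h2 : ‖x‖ * ‖y‖ ≤ bracket x * bracket y :=
    mul_le_mul (Real.le_sqrt_of_sq_le (by linarith)) (Real.le_sqrt_of_sq_le (by linarith))
      (norm_nonneg _) hx.le
  rw [bracket_sq]
  nlinarith

lemma jap_le_add (ζ η : R2) : jap ζ ≤ jap (ζ + η) + jap η := by
  have := bracket_sub_le ((2 * Real.pi) • (ζ + η)) ((2 * Real.pi) • η)
  rwa [← smul_sub, add_sub_cancel_right] at this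

lemma add_rpow_le {a b s : ℝ} (ha : 0 ≤ a) (hb : 0 ≤ b) (hs : 0 ≤ s) :
    (a + b) ^ s ≤ 2 ^ s * (a ^ s + b ^ s) := by
  have h0 := Real.rpow_nonneg ha s
  have h1 := Real.rpow_nonneg hb s
  have h2 : (0 : ℝ) ≤ 2 ^ s := by positivity
  rcases le_total a b with h | h
  · calc (a + b) ^ s ≤ (2 * b) ^ s := Real.rpow_le_rpow (by positivity) (by linarith) hs
      _ = 2 ^ s * b ^ s := Real.mul_rpow zero_le_two hb
      _ ≤ _ := by gcongr; linarith
  · calc (a + b) ^ s ≤ (2 * a) ^ s := Real.rpow_le_rpow (by positivity) (by linarith) hs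
      _ = 2 ^ s * a ^ s := Real.mul_rpow zero_le_two ha
      _ ≤ _ := by gcongr; linarith

/-- The decay of the Fourier transform of the density at high frequency: one of the two interacting
frequencies is at least half as large as the output frequency. -/
lemma norm_fourier_absSq_le {s ε : ℝ} (hs : 0 ≤ s) (hε : 0 ≤ ε) {u : L2}
    (hu : sobolevNorm s u ≤ ENNReal.ofReal ε) (ζ : R2) :
    ‖𝓕 (absSq u) ζ‖ ≤ 2 * 2 ^ s * ε ^ 2 * jap ζ ^ (-s) := by
  have hmem : MemLp u 2 volume := Lp.memLp u
  unfold sobolevNorm at hu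
  rw [dif_pos hmem, Lp.toLp_coeFn] at hu
  set U : L2 := 𝓕 u with hU
  let V : R2 → ℂ := fun ξ => ((jap ξ ^ s : ℝ) : ℂ) * U ξ
  have cw : Continuous fun ξ => ((jap ξ ^ s : ℝ) : ℂ) :=
    Complex.continuous_ofReal.comp (continuous_jap.rpow_const fun ξ => Or.inl (jap_pos ξ).ne')
  have nw : ∀ ξ, ‖((jap ξ ^ s : ℝ) : ℂ)‖ = jap ξ ^ s := fun ξ => by
    rw [Complex.norm_real, Real.norm_eq_abs, abs_of_pos (Real.rpow_pos_of_pos (jap_pos ξ) s)]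
  have hV : eLpNorm V 2 volume ≤ ENNReal.ofReal ε := hu
  have mV : MemLp V 2 volume := ⟨cw.aestronglyMeasurable.mul (Lp.memLp U).1,
    hV.trans_lt ENNReal.ofReal_lt_top⟩
  have hU' : eLpNorm U 2 volume ≤ ENNReal.ofReal ε := by
    refine le_trans (eLpNorm_mono fun ξ => ?_) hV
    rw [norm_mul, nw]
    exact le_mul_of_one_le_left (norm_nonneg _) (Real.one_le_rpow (one_le_jap ξ) hs)
  have mU : MemLp U 2 volume := Lp.memLp U
  have shift : ∀ {f : R2 → ℂ}, MemLp f 2 volume → eLpNorm f 2 volume ≤ ENNReal.ofReal ε →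
      eLpNorm (fun η => f (ζ + η)) 2 volume ≤ ENNReal.ofReal ε := fun hf h =>
    (eLpNorm_comp_measurePreserving hf.1 (measurePreserving_add_left volume ζ)).le.trans h
  have b1 := integral_norm_mul_le (memLp_shift mV ζ) mU hε hε (shift mV hV) hU'
  have b2 := integral_norm_mul_le (memLp_shift mU ζ) mV hε hε (shift mU hU') hV
  have i1 := (memLp_mul_integrable (memLp_shift mV ζ) mU).norm
  have i2 := (memLp_mul_integrable (memLp_shift mU ζ) mV).norm
  have hp := Real.rpow_pos_of_pos (jap_pos ζ) s
  have key : jap ζ ^ s * ‖𝓕 (absSq u) ζ‖ ≤ 2 ^ s * (ε * ε + ε * ε) := by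
    rw [absSq_eq, fourier_mul_conj]
    calc _ ≤ jap ζ ^ s * ∫ η, ‖U (ζ + η) * conj (U η)‖ := by
          gcongr; exact norm_integral_le_integral_norm _
      _ = ∫ η, jap ζ ^ s * ‖U (ζ + η) * conj (U η)‖ := (integral_const_mul _ _).symm
      _ ≤ ∫ η, 2 ^ s * (‖V (ζ + η) * U η‖ + ‖U (ζ + η) * V η‖) := by
          refine integral_mono
            ((memLp_mul_integrable (memLp_shift mU ζ) (memLp_conj mU)).norm.const_mul _)
            ((i1.add i2).const_mul _) fun η => ?_
          simp only [norm_mul, RCLike.norm_conj, V, nw]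
          have h1 : jap ζ ^ s ≤ 2 ^ s * (jap (ζ + η) ^ s + jap η ^ s) :=
            (Real.rpow_le_rpow (jap_pos ζ).le (jap_le_add ζ η) hs).trans
              (add_rpow_le (jap_pos _).le (jap_pos _).le hs)
          have h2 := mul_le_mul_of_nonneg_right h1
            (mul_nonneg (norm_nonneg (U (ζ + η))) (norm_nonneg (U η)))
          linarith
      _ = 2 ^ s * ((∫ η, ‖V (ζ + η) * U η‖) + ∫ η, ‖U (ζ + η) * V η‖) := by
          rw [integral_const_mul, integral_add i1 i2]
      _ ≤ _ := by gcongr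
  rw [Real.rpow_neg (jap_pos ζ).le, ← div_eq_mul_inv, le_div_iff₀ hp]
  linarith

section LittlewoodPaley

variable {χ : R2 → ℝ}

lemma IsBump.exists_bound (hχ : IsBump χ) : ∃ M : ℝ, 0 ≤ M ∧ ∀ ξ, |χ ξ| ≤ M := by
  have hc : HasCompactSupport χ :=
    (isCompact_closedBall (0 : R2) 2).of_isClosed_subset (isClosed_tsupport χ)
      (hχ.support.trans Metric.ball_subset_closedBall)
  obtain ⟨M, hM⟩ := hc.exists_bound_of_continuous hχ.smooth.continuous
  exact ⟨M, (norm_nonneg _).trans (hM 0), hM⟩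

lemma IsBump.eq_zero (hχ : IsBump χ) {ξ : R2} (hξ : 2 ≤ ‖ξ‖) : χ ξ = 0 := by
  by_contra h
  have := hχ.support (subset_tsupport χ h)
  rw [mem_ball_zero_iff] at this
  linarith

lemma IsBump.cutoff_eq_zero (hχ : IsBump χ) {L : ℝ} (hL : 0 < L) {ξ : R2}
    (h : ‖ξ‖ < L / 2 ∨ 2 * L < ‖ξ‖) : dyadicCutoff χ L ξ = 0 := by
  have n1 : ‖(1 / L) • ξ‖ = ‖ξ‖ / L := by
    rw [norm_smul, Real.norm_eq_abs, abs_of_pos (by positivity)]; ring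
  have n2 : ‖(2 / L) • ξ‖ = 2 * ‖ξ‖ / L := by
    rw [norm_smul, Real.norm_eq_abs, abs_of_pos (by positivity)]; ring
  unfold dyadicCutoff
  rcases h with h | h
  · rw [hχ.eq_one _ (by rw [n1, div_le_one hL]; linarith),
      hχ.eq_one _ (by rw [n2, div_le_one hL]; linarith), sub_self]
  · rw [hχ.eq_zero (by rw [n1, le_div_iff₀ hL]; linarith),
      hχ.eq_zero (by rw [n2, le_div_iff₀ hL]; linarith), sub_self]

lemma IsBump.continuous_cutoff (hχ : IsBump χ) (L : ℝ) : Continuous (dyadicCutoff χ L) := by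
  have := hχ.smooth.continuous
  unfold dyadicCutoff
  fun_prop

/-- The multiplier of the Littlewood-Paley projection of `g`, in the normalisation of `𝓕`. -/
noncomputable def projHat (χ : R2 → ℝ) (L : ℝ) (g : R2 → ℂ) (ζ : R2) : ℂ :=
  (dyadicCutoff χ L ((2 * Real.pi) • ζ) : ℂ) * 𝓕 g ζ

lemma fourierHat_smul (g : R2 → ℂ) (ζ : R2) : fourierHat g ((2 * Real.pi) • ζ) = 𝓕 g ζ := by
  rw [Real.fourier_eq', fourierHat]
  congr 1; ext x
  rw [smul_eq_mul, inner_smul_right]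
  congr 2
  push_cast; ring

lemma dyadicProj_eq_fourierInv (χ : R2 → ℝ) (L : ℝ) (g : R2 → ℂ) :
    dyadicProj χ L g = 𝓕⁻ (projHat χ L g) := by
  ext x
  have h := Measure.integral_comp_smul (volume : Measure R2)
    (fun ξ => Complex.exp (Complex.I * (inner ℝ x ξ : ℝ)) *
      ((dyadicCutoff χ L ξ : ℂ) * fourierHat g ξ)) (2 * Real.pi)
  have e1 : 𝓕⁻ (projHat χ L g) x = ∫ ζ : R2,
      Complex.exp (Complex.I * (inner ℝ x ((2 * Real.pi) • ζ) : ℝ)) *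
      ((dyadicCutoff χ L ((2 * Real.pi) • ζ) : ℂ) * fourierHat g ((2 * Real.pi) • ζ)) := by
    rw [Real.fourierInv_eq']
    congr 1; ext ζ
    rw [smul_eq_mul, projHat, fourierHat_smul, inner_smul_right, real_inner_comm]
    congr 2
    push_cast; ring
  rw [e1, h, dyadicProj, finrank_euclideanSpace_fin, Complex.real_smul,
    abs_of_pos (by positivity), one_div]

lemma continuous_projHat (hχ : IsBump χ) (L : ℝ) {g : R2 → ℂ} (hg : Integrable g) :
    Continuous (projHat χ L g) :=
  (Complex.continuous_ofReal.comp ((hχ.continuous_cutoff L).comp (continuous_const_smul _))).mul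
    (continuous_fourier hg)

lemma projHat_eq_zero (hχ : IsBump χ) {L : ℝ} (hL : 0 < L) (g : R2 → ℂ) {ζ : R2} (hζ : L < ‖ζ‖) :
    projHat χ L g ζ = 0 := by
  rw [projHat, hχ.cutoff_eq_zero hL (Or.inr ?_), Complex.ofReal_zero, zero_mul]
  rw [norm_smul, Real.norm_eq_abs, abs_of_pos (by positivity)]
  nlinarith [Real.pi_gt_three]

lemma hasCompactSupport_projHat (hχ : IsBump χ) {L : ℝ} (hL : 0 < L) (g : R2 → ℂ) :
    HasCompactSupport (projHat χ L g) :=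
  HasCompactSupport.intro (isCompact_closedBall (0 : R2) L) fun ζ hζ =>
    projHat_eq_zero hχ hL g (by simpa using hζ)

lemma exists_eLpNorm_indicator_ball : ∃ c : ℝ, 0 ≤ c ∧ ∀ r : ℝ, 0 ≤ r →
    MemLp ((Metric.closedBall (0 : R2) r).indicator fun _ => (1 : ℂ)) 2 volume ∧
    eLpNorm ((Metric.closedBall (0 : R2) r).indicator fun _ => (1 : ℂ)) 2 volume ≤
      ENNReal.ofReal (c * r) := by
  set v := volume (Metric.ball (0 : R2) 1) with hv
  have hv' : v ^ (1 / 2 : ℝ) ≠ ⊤ := ENNReal.rpow_ne_top_of_nonneg (by norm_num) measure_ball_lt_top.ne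
  refine ⟨(v ^ (1 / 2 : ℝ)).toReal, ENNReal.toReal_nonneg, fun r hr => ?_⟩
  have h2 : eLpNorm ((Metric.closedBall (0 : R2) r).indicator fun _ => (1 : ℂ)) 2 volume ≤
      ENNReal.ofReal ((v ^ (1 / 2 : ℝ)).toReal * r) := by
    rw [eLpNorm_indicator_const Metric.isClosed_closedBall.measurableSet (by norm_num)
      (by norm_num), Measure.addHaar_closedBall _ _ hr, finrank_euclideanSpace_fin, ← hv, enorm_one,
      one_mul, ENNReal.ofReal_mul ENNReal.toReal_nonneg, ENNReal.ofReal_toReal hv',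
      ENNReal.toReal_ofNat, ENNReal.mul_rpow_of_nonneg _ _ (by norm_num),
      ENNReal.ofReal_rpow_of_nonneg (by positivity) (by norm_num), ← Real.sqrt_eq_rpow,
      Real.sqrt_sq hr, mul_comm]
  exact ⟨⟨aestronglyMeasurable_const.indicator Metric.isClosed_closedBall.measurableSet,
    h2.trans_lt ENNReal.ofReal_lt_top⟩, h2⟩

/-- The two norms of a Littlewood-Paley projection are controlled by the `L²` norm of the multiplier;
the bound in `L^∞` is Bernstein's inequality. -/
lemma exists_eLpNorm_dyadicProj_le (hχ : IsBump χ) : ∃ c : ℝ, 0 ≤ c ∧ ∀ (L : ℝ), 0 < L →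
    ∀ (g : R2 → ℂ), Integrable g → ∀ N : ℝ, 0 ≤ N →
    eLpNorm (projHat χ L g) 2 volume ≤ ENNReal.ofReal N →
      eLpNorm (dyadicProj χ L g) 2 volume ≤ ENNReal.ofReal N ∧
      eLpNorm (dyadicProj χ L g) ∞ volume ≤ ENNReal.ofReal (c * L * N) := by
  obtain ⟨c, hc, hind⟩ := exists_eLpNorm_indicator_ball
  refine ⟨c, hc, fun L hL g hg N hN h => ?_⟩
  have hcont := continuous_projHat hχ L hg
  have hsupp := hasCompactSupport_projHat hχ hL g
  have i1 : Integrable (projHat χ L g) := hcont.integrable_of_hasCompactSupport hsupp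
  have m2 : MemLp (projHat χ L g) 2 volume := hcont.memLp_of_hasCompactSupport hsupp
  rw [dyadicProj_eq_fourierInv]
  constructor
  · rw [← eLpNorm_congr_ae (fourierInv_toLp_ae_eq i1 m2), eLpNorm_fourierInv,
      eLpNorm_congr_ae m2.coeFn_toLp]
    exact h
  · rw [eLpNorm_exponent_top]
    refine eLpNormEssSup_le_of_ae_bound (Eventually.of_forall fun x => ?_)
    have h1 := integral_norm_mul_le m2 (hind L hL.le).1 hN (by positivity) h (hind L hL.le).2
    refine le_trans ?_ (h1.trans (le_of_eq (by ring)))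
    rw [Real.fourierInv_eq]
    refine (norm_integral_le_integral_norm _).trans (le_of_eq ?_)
    refine integral_congr_ae (Eventually.of_forall fun ζ => ?_)
    simp only [Circle.norm_smul]
    by_cases hζ : ζ ∈ Metric.closedBall (0 : R2) L
    · rw [Set.indicator_of_mem hζ, mul_one]
    · rw [projHat_eq_zero hχ hL g (by simpa using hζ), zero_mul]

end LittlewoodPaley

/-! ### Bounds of the multiplier -/

section Multiplier

variable {χ : R2 → ℝ}

lemma IsBump.exists_cutoff_bound (hχ : IsBump χ) : ∃ M : ℝ, 0 ≤ M ∧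
    ∀ L ξ, |dyadicCutoff χ L ξ| ≤ M := by
  obtain ⟨M, hM, h⟩ := hχ.exists_bound
  refine ⟨M + M, by positivity, fun L ξ => ?_⟩
  exact (abs_sub _ _).trans (add_le_add (h _) (h _))

/-- The bound of the multiplier by the regularity of `u`. -/
lemma exists_eLpNorm_projHat_le_high (hχ : IsBump χ) {s : ℝ} (hs : 0 ≤ s) : ∃ C : ℝ, 0 ≤ C ∧
    ∀ (ε L : ℝ) (u : L2), 0 ≤ ε → 0 < L → sobolevNorm s u ≤ ENNReal.ofReal ε →
      eLpNorm (projHat χ L (absSq u)) 2 volume ≤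
        ENNReal.ofReal (C * (L * bracket L ^ (-s)) * ε ^ 2) := by
  obtain ⟨M, hM, hcut⟩ := hχ.exists_cutoff_bound
  obtain ⟨c, hc, hind⟩ := exists_eLpNorm_indicator_ball
  refine ⟨M * (2 * 2 ^ s * 2 ^ s) * c, by positivity, fun ε L u hε hL hu => ?_⟩
  have hbL : 0 < bracket L := bracket_pos L
  set a := M * (2 * 2 ^ s * ε ^ 2 * (2 ^ s * bracket L ^ (-s))) with ha
  have ha0 : 0 ≤ a := by positivity
  have hpt : ∀ ζ, ‖projHat χ L (absSq u) ζ‖ ≤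
      a * ‖(Metric.closedBall (0 : R2) L).indicator (fun _ => (1 : ℂ)) ζ‖ := by
    intro ζ
    by_cases h1 : ‖(2 * Real.pi) • ζ‖ < L / 2
    · rw [projHat, hχ.cutoff_eq_zero hL (Or.inl h1), Complex.ofReal_zero, zero_mul, norm_zero]
      positivity
    by_cases hζ : ζ ∈ Metric.closedBall (0 : R2) L
    · rw [Set.indicator_of_mem hζ, norm_one, mul_one, projHat, norm_mul, Complex.norm_real,
        Real.norm_eq_abs]
      refine mul_le_mul (hcut _ _) ((norm_fourier_absSq_le hs hε hu ζ).trans ?_)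
        (norm_nonneg _) hM
      gcongr
      have h2 : bracket L / 2 ≤ jap ζ := by
        refine abs_le_of_sq_le_sq' ?_ (jap_pos ζ).le |>.2
        rw [div_pow, bracket_sq, jap, bracket_sq, Real.norm_eq_abs, sq_abs]
        nlinarith [not_lt.1 h1]
      calc jap ζ ^ (-s) ≤ (bracket L / 2) ^ (-s) :=
            Real.rpow_le_rpow_of_nonpos (by positivity) h2 (by linarith)
        _ = 2 ^ s * bracket L ^ (-s) := by
            rw [Real.div_rpow hbL.le zero_le_two, Real.rpow_neg zero_le_two, div_inv_eq_mul,
              mul_comm]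
    · rw [projHat_eq_zero hχ hL _ (by simpa using hζ), norm_zero]
      positivity
  refine (eLpNorm_le_mul_eLpNorm_of_ae_le_mul (Eventually.of_forall hpt) 2).trans ?_
  refine (mul_le_mul_right (hind L hL.le).2 _).trans (le_of_eq ?_)
  rw [← ENNReal.ofReal_mul ha0]
  congr 1
  rw [ha]; ring

/-- The bound of the multiplier for large times: two integrations by parts and the dispersive
decay. -/
lemma exists_eLpNorm_projHat_le_low (hχ : IsBump χ) : ∃ C : ℝ, 0 ≤ C ∧
    ∀ (ε L t : ℝ) (u : L2), 0 ≤ ε → 0 < L → 0 < t →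
      sobolevNorm 10 (fun x : R2 => ((bracket x ^ 2 : ℝ) : ℂ) * propagator t u x) ≤
        ENNReal.ofReal ε →
      eLpNorm (projHat χ L (absSq u)) 2 volume ≤
        ENNReal.ofReal (C * (L⁻¹ ^ 2 * t⁻¹ ^ 3) * ε ^ 2) := by
  obtain ⟨M, hM, hcut⟩ := hχ.exists_cutoff_bound
  obtain ⟨c, hc, hind⟩ := exists_eLpNorm_indicator_ball
  obtain ⟨K, hK, hreg⟩ := exists_reg_fourier
  choose D hD hsplit using exists_splitBound_coord_sq_mul_form
  set E := (D 0 + D 1) * (K * K) with hE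
  have hE0 : 0 ≤ E := by
    have := hD 0; have := hD 1
    positivity
  refine ⟨M * (4 * Real.pi) ^ 2 * (E * (1 + 4 * Real.pi * c)), by positivity,
    fun ε L t u hε hL ht hu => ?_⟩
  have hF := hreg ε hε _ hu
  have hρ := fourier_absSq_eq_form t u
  set F : R2 → ℂ := ((𝓕 (propagator t u) : L2) : R2 → ℂ)
  have hF8 : Reg 2 8 (K * ε) F := hF.mono (by norm_num) le_rfl
  have hs := isBoundClass_splitBound.add (hsplit 0 t ht _ _ F F hF8 hF8)
    (hsplit 1 t ht _ _ F F hF8 hF8)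
  have hcst : D 0 * (K * ε * (K * ε)) / t + D 1 * (K * ε * (K * ε)) / t = E * ε ^ 2 / t := by
    rw [hE]; ring
  rw [hcst] at hs
  set κ := E * ε ^ 2 / t with hκ
  have hκ0 : 0 ≤ κ := by positivity
  obtain ⟨S, mS, nS, hR⟩ := hs
  -- the multiplier lives on `L/2 ≤ |2πζ|`, that is `ℓ ≤ |ζ|`, and inside `|ζ| ≤ L`
  set ℓ := L / (4 * Real.pi) with hℓ
  have hℓ0 : 0 < ℓ := by positivity
  let I : R2 → ℂ := (Metric.closedBall (0 : R2) L).indicator fun _ => (1 : ℂ)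
  let B : R2 → ℂ := fun ζ => ((‖S ζ‖ : ℝ) : ℂ) + ((κ / ℓ : ℝ) : ℂ) * I ζ
  have mI : AEStronglyMeasurable I volume := (hind L hL.le).1.1
  have nB : eLpNorm B 2 volume ≤ ENNReal.ofReal (κ + κ / ℓ * (c * L)) := by
    rw [ENNReal.ofReal_add hκ0 (by positivity), ENNReal.ofReal_mul (by positivity)]
    refine (eLpNorm_add_le (Complex.continuous_ofReal.comp_aestronglyMeasurable mS.norm)
      (mI.const_mul _) (by norm_num)).trans (add_le_add ?_ ?_)
    · rw [eLpNorm_congr_norm_ae (g := S) (Eventually.of_forall fun ζ => by simp)]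
      exact nS
    · refine (eLpNorm_le_mul_eLpNorm_of_ae_le_mul (g := I) (c := κ / ℓ)
        (Eventually.of_forall fun ζ => ?_) 2).trans (mul_le_mul_right (hind L hL.le).2 _)
      rw [norm_mul, Complex.norm_real, Real.norm_eq_abs, abs_of_nonneg (by positivity)]
  have hpt : ∀ ζ, ‖projHat χ L (absSq u) ζ‖ ≤ M * ((t⁻¹ ^ 2 * ℓ⁻¹ ^ 2)) * ‖B ζ‖ := by
    intro ζ
    by_cases h1 : ‖(2 * Real.pi) • ζ‖ < L / 2
    · rw [projHat, hχ.cutoff_eq_zero hL (Or.inl h1), Complex.ofReal_zero, zero_mul, norm_zero]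
      positivity
    by_cases hζ : ζ ∈ Metric.closedBall (0 : R2) L
    · rw [projHat, norm_mul, Complex.norm_real, Real.norm_eq_abs, mul_assoc]
      refine mul_le_mul (hcut _ _) ?_ (norm_nonneg _) hM
      have hn : ℓ ≤ ‖ζ‖ := by
        rw [norm_smul, Real.norm_eq_abs, abs_of_pos (by positivity), not_lt] at h1
        rw [hℓ, div_le_iff₀ (by positivity)]
        linarith
      have hn0 : 0 < ‖ζ‖ := hℓ0.trans_le hn
      have hsq : ‖ζ‖ ^ 2 = ζ 0 ^ 2 + ζ 1 ^ 2 := by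
        rw [EuclideanSpace.norm_sq_eq]; simp [Fin.sum_univ_two]
      have e1 : (t : ℂ) * (ζ 0 : ℂ) * ((t : ℂ) * (ζ 0 : ℂ) * form t 0 F F ζ) +
          (t : ℂ) * (ζ 1 : ℂ) * ((t : ℂ) * (ζ 1 : ℂ) * form t 0 F F ζ) =
          ((t ^ 2 * ‖ζ‖ ^ 2 : ℝ) : ℂ) * form t 0 F F ζ := by
        rw [hsq]; push_cast; ring
      have h2 := hR ζ
      simp only [e1] at h2
      have h3 : ‖((t ^ 2 * ‖ζ‖ ^ 2 : ℝ) : ℂ) * form t 0 F F ζ‖ ≤ ‖S ζ‖ + κ / ℓ := by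
        have h4 : ‖((t ^ 2 * ‖ζ‖ ^ 2 : ℝ) : ℂ) * form t 0 F F ζ - S ζ‖ ≤ κ / ℓ := by
          rw [le_div_iff₀ hℓ0, mul_comm]
          exact (mul_le_mul_of_nonneg_right hn (norm_nonneg _)).trans h2
        have := norm_le_norm_add_norm_sub' (((t ^ 2 * ‖ζ‖ ^ 2 : ℝ) : ℂ) * form t 0 F F ζ) (S ζ)
        linarith
      have nBζ : ‖B ζ‖ = ‖S ζ‖ + κ / ℓ := by
        simp only [B, I, Set.indicator_of_mem hζ, mul_one]
        rw [← Complex.ofReal_add, Complex.norm_real, Real.norm_eq_abs,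
          abs_of_nonneg (by positivity)]
      rw [nBζ, hρ]
      rw [norm_mul, Complex.norm_real, Real.norm_eq_abs, abs_of_nonneg (by positivity)] at h3
      have h5 : t ^ 2 * ℓ ^ 2 * ‖form t 0 F F ζ‖ ≤ ‖S ζ‖ + κ / ℓ :=
        le_trans (by gcongr) h3
      calc ‖form t 0 F F ζ‖ = t⁻¹ ^ 2 * ℓ⁻¹ ^ 2 * (t ^ 2 * ℓ ^ 2 * ‖form t 0 F F ζ‖) := by
            field_simp
        _ ≤ _ := by gcongr
    · rw [projHat_eq_zero hχ hL _ (by simpa using hζ), norm_zero]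
      positivity
  refine (eLpNorm_le_mul_eLpNorm_of_ae_le_mul (Eventually.of_forall hpt) 2).trans ?_
  refine (mul_le_mul_right nB _).trans (le_of_eq ?_)
  rw [← ENNReal.ofReal_mul (by positivity)]
  congr 1
  rw [hκ, hℓ]
  field_simp

lemma le_bracket (a : ℝ) : a ≤ bracket a := by
  refine Real.le_sqrt_of_sq_le ?_
  rw [Real.norm_eq_abs, sq_abs]
  linarith

/-- Both bounds of the multiplier. For small times the first one follows from the second one. -/
lemma exists_eLpNorm_projHat_le (hχ : IsBump χ) {s : ℝ} (hs : 3 ≤ s) : ∃ C : ℝ, 0 ≤ C ∧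
    ∀ (ε L t : ℝ) (u : L2), 0 ≤ ε → 0 < L → 0 ≤ t → sobolevNorm s u ≤ ENNReal.ofReal ε →
      sobolevNorm 10 (fun x : R2 => ((bracket x ^ 2 : ℝ) : ℂ) * propagator t u x) ≤
        ENNReal.ofReal ε →
      eLpNorm (projHat χ L (absSq u)) 2 volume ≤ ENNReal.ofReal
        (C * min (L ^ (-2 : ℝ) * bracket t ^ (-3 : ℝ)) (L * bracket L ^ (-s)) * ε ^ 2) := by
  obtain ⟨C₁, hC₁, h1⟩ := exists_eLpNorm_projHat_le_high hχ (s := s) (by linarith)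
  obtain ⟨C₂, hC₂, h2⟩ := exists_eLpNorm_projHat_le_low hχ
  refine ⟨8 * (C₁ + C₂), by positivity, fun ε L t u hε hL ht hu hf => ?_⟩
  have hbL : 0 < bracket L := bracket_pos L
  have hbt : 0 < bracket t := bracket_pos t
  have eL : L ^ (-2 : ℝ) = L⁻¹ ^ 2 := by
    rw [Real.rpow_neg hL.le, Real.rpow_two, inv_pow]
  have et : bracket t ^ (-3 : ℝ) = (bracket t)⁻¹ ^ 3 := by
    rw [Real.rpow_neg hbt.le, inv_pow]; norm_cast
  have hp := Real.rpow_pos_of_pos hbL (-s)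
  have high := h1 ε L u hε hL hu
  have hbts : bracket t ^ 2 = 1 + t ^ 2 := by rw [bracket_sq, Real.norm_eq_abs, sq_abs]
  have low : eLpNorm (projHat χ L (absSq u)) 2 volume ≤ ENNReal.ofReal
      (8 * (C₁ + C₂) * (L⁻¹ ^ 2 * (bracket t)⁻¹ ^ 3) * ε ^ 2) := by
    -- `L⟨L⟩⁻ˢ ≤ L⁻²` covers `t ≤ 1`, as `3 ≤ s`
    rcases le_total t 1 with ht1 | ht1
    · refine high.trans (ENNReal.ofReal_le_ofReal ?_)
      have hb2 : bracket t ≤ 2 := by nlinarith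
      have k1 : 1 ≤ 8 * (bracket t)⁻¹ ^ 3 := by
        have : (2 : ℝ)⁻¹ ^ 3 ≤ (bracket t)⁻¹ ^ 3 := by gcongr
        norm_num at this ⊢
        linarith
      have k2 : L * bracket L ^ (-s) ≤ L⁻¹ ^ 2 := by
        have k3 : bracket L ^ (-s) ≤ L⁻¹ ^ 3 := by
          calc bracket L ^ (-s) ≤ bracket L ^ (-3 : ℝ) :=
                Real.rpow_le_rpow_of_exponent_le (one_le_bracket L) (by linarith)
            _ ≤ L ^ (-3 : ℝ) := Real.rpow_le_rpow_of_nonpos hL (le_bracket L) (by norm_num)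
            _ = L⁻¹ ^ 3 := by rw [Real.rpow_neg hL.le, inv_pow]; norm_cast
        calc L * bracket L ^ (-s) ≤ L * L⁻¹ ^ 3 := by gcongr
          _ = L⁻¹ ^ 2 := by field_simp
      calc C₁ * (L * bracket L ^ (-s)) * ε ^ 2 ≤
            (C₁ + C₂) * (L⁻¹ ^ 2 * 1) * ε ^ 2 := by
            rw [mul_one]; gcongr; linarith
        _ ≤ (C₁ + C₂) * (L⁻¹ ^ 2 * (8 * (bracket t)⁻¹ ^ 3)) * ε ^ 2 := by gcongr
        _ = _ := by ring
    · have ht0 : 0 < t := by linarith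
      refine (h2 ε L t u hε hL ht0 hf).trans (ENNReal.ofReal_le_ofReal ?_)
      have hb2 : bracket t ≤ 2 * t := by nlinarith
      have k1 : t⁻¹ ^ 3 ≤ 8 * (bracket t)⁻¹ ^ 3 := by
        have : (2 * t)⁻¹ ^ 3 ≤ (bracket t)⁻¹ ^ 3 := by gcongr
        rw [mul_inv, mul_pow] at this
        norm_num at this ⊢
        linarith
      calc C₂ * (L⁻¹ ^ 2 * t⁻¹ ^ 3) * ε ^ 2 ≤
            (C₁ + C₂) * (L⁻¹ ^ 2 * (8 * (bracket t)⁻¹ ^ 3)) * ε ^ 2 := by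
            gcongr; linarith
        _ = _ := by ring
  rw [eL, et]
  rcases min_choice (L⁻¹ ^ 2 * (bracket t)⁻¹ ^ 3) (L * bracket L ^ (-s)) with h | h
  · rw [h]; exact low
  · rw [h]
    refine high.trans (ENNReal.ofReal_le_ofReal ?_)
    gcongr
    linarith

end Multiplier

end SemiRel

theorem mainTheorem3 (s : ℝ) (hs : 30 ≤ s) (χ : SemiRel.R2 → ℝ) (hχ : SemiRel.IsBump χ) :
    ∃ C : ℝ, 0 < C ∧
      ∀ (T ε₁ : ℝ) (u : ℝ → SemiRel.L2), 0 < ε₁ →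
        SemiRel.normX s T u ≤ ENNReal.ofReal ε₁ →
        ∀ t ∈ Set.Icc (0 : ℝ) T, ∀ (k : ℤ) (L : ℝ), L = (2 : ℝ) ^ k →
          eLpNorm (SemiRel.dyadicProj χ L (SemiRel.absSq (u t))) 2 volume ≤
            ENNReal.ofReal
              (C * min (L ^ (-2 : ℝ) * SemiRel.bracket t ^ (-3 : ℝ))
                (L * SemiRel.bracket L ^ (-s)) * ε₁ ^ 2) ∧
          eLpNorm (SemiRel.dyadicProj χ L (SemiRel.absSq (u t))) ∞ volume ≤
            ENNReal.ofReal
              (C * min (L ^ (-1 : ℝ) * SemiRel.bracket t ^ (-3 : ℝ))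
                (L ^ 2 * SemiRel.bracket L ^ (-s)) * ε₁ ^ 2) := by
  obtain ⟨C, hC, hm⟩ := SemiRel.exists_eLpNorm_projHat_le hχ (s := s) (by linarith)
  obtain ⟨c, hc, hproj⟩ := SemiRel.exists_eLpNorm_dyadicProj_le hχ
  refine ⟨C + c * C + 1, by positivity, fun T ε₁ u hε hX t ht k L hL => ?_⟩
  have hL0 : 0 < L := by rw [hL]; positivity
  have hsum : SemiRel.sobolevNorm s (u t) + SemiRel.sobolevNorm 10 (fun x : SemiRel.R2 =>
      ((SemiRel.bracket x ^ 2 : ℝ) : ℂ) * SemiRel.propagator t (u t) x) ≤ ENNReal.ofReal ε₁ :=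
    le_trans (le_iSup₂ (f := fun t (_ : t ∈ Set.Icc (0 : ℝ) T) =>
      SemiRel.sobolevNorm s (u t) + SemiRel.sobolevNorm 10 (fun x : SemiRel.R2 =>
      ((SemiRel.bracket x ^ 2 : ℝ) : ℂ) * SemiRel.propagator t (u t) x)) t ht) hX
  have hbL := Real.rpow_pos_of_pos (SemiRel.bracket_pos L) (-s)
  have hbt := Real.rpow_pos_of_pos (SemiRel.bracket_pos t) (-3)
  have hLp := Real.rpow_pos_of_pos hL0 (-2)
  set X := min (L ^ (-2 : ℝ) * SemiRel.bracket t ^ (-3 : ℝ)) (L * SemiRel.bracket L ^ (-s)) with hX'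
  have hX0 : 0 ≤ X := le_min (by positivity) (by positivity)
  obtain ⟨h2, hinf⟩ := hproj L hL0 _ (SemiRel.integrable_absSq (u t)) (C * X * ε₁ ^ 2)
    (by positivity) (hm ε₁ L t (u t) hε.le hL0 ht.1 (le_self_add.trans hsum)
      (le_add_self.trans hsum))
  have hLX : L * X = min (L ^ (-1 : ℝ) * SemiRel.bracket t ^ (-3 : ℝ))
      (L ^ 2 * SemiRel.bracket L ^ (-s)) := by
    rw [hX', mul_min_of_nonneg _ _ hL0.le, ← mul_assoc, ← mul_assoc, ← sq]
    congr 2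
    rw [show (-1 : ℝ) = 1 + -2 by norm_num, Real.rpow_add hL0, Real.rpow_one]
  have hcC : 0 ≤ c * C := mul_nonneg hc hC
  refine ⟨h2.trans (ENNReal.ofReal_le_ofReal ?_), hinf.trans (ENNReal.ofReal_le_ofReal ?_)⟩
  · gcongr
    linarith
  · rw [← hLX]
    calc c * L * (C * X * ε₁ ^ 2) = c * C * (L * X) * ε₁ ^ 2 := by ring
      _ ≤ (C + c * C + 1) * (L * X) * ε₁ ^ 2 := by gcongr; linarith
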